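/- \textbf{Setting.} Fix $T>0$, a continuous $f:\mathbb{R}\to(0,\infty)$ whose antiderivative $F(y)=\int_0^y f(z)\,dz$ tends to $\pm\infty$ at $\pm\infty$, a $C^2$ function $\lambda:[0,T]\to(0,\infty)$ and a $C^1$ function $\rho:[0,T]\to(0,\infty)$; put $\eta_t=\lambda'(t)/\lambda(t)$, $\tilde F(y)=\int_0^y zf(z)\,dz$, $G=\tilde F\circ F^{-1}$ and $$h_{V,t}(y)=F^{-1}(y)+\frac{\eta_t+\rho_t}{\rho_t}\,\frac{y}{f(F^{-1}(y))}.$$ Let $(S^0_t)_{t\ge0}$ be a right-continuous martingale on a filtered probability space $(\Omega,\mathcal F,(\mathcal F_t)_{t\ge 0},\mathbb P)$. For $x\in\mathbb{R}$, a liquidation path of $x$ is a left-continuous function $X$ of finite total variation on $[0,T+]$ with $X_0=x$ and $X_{T+}=0$; an admissible strategy for $x$ is an adapted process all of whose paths are liquidation paths of $x$ and whose total variation is a.s. bounded by a constant. Let $\Delta X_t=X_{t+}-X_t$, let $dX$ be the signed measure on $[0,T]$ associated with $X$, let $dX^c$ be its non-atomic part, and let $E$ solve $dE_t=dX_t-\rho_tE_t\,dt$,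 $E_0=0$. Define $$C^V(X)=\int_0^T F^{-1}\!\Big(\frac{E_t}{\lambda(t)}\Big)dX^c_t+\sum_{t\le T}\lambda(t)\Big[G\Big(\frac{E_t+\Delta X_t}{\lambda(t)}\Big)-G\Big(\frac{E_t}{\lambda(t)}\Big)\Big],$$ $$\mathcal C(X)=\mathbb E\Big[\int_0^T\Big(S^0_t+F^{-1}\!\Big(\frac{E_t}{\lambda(t)}\Big)\Big)dX^c_t+\sum_{t\le T}\Big(S^0_t\Delta X_t+\lambda(t)\Big[G\Big(\frac{E_t+\Delta X_t}{\lambda(t)}\Big)-G\Big(\frac{E_t}{\lambda(t)}\Big)\Big]\Big)\Big].$$ The model admits transaction-triggered price manipulations (TTPM) if for some $x$ there is an admissible strategy $X$ for $x$ with $\mathcal C(X)<\inf\{\mathcal C(\tilde X):\tilde X\text{ admissible for }x\text{ and nonincreasing or nondecreasing}\}$. \textbf{Statement.} Assume that $f\in C^1(\mathbb{R})$, that $f$ is nondecreasing on $\mathbb{R}_-$ and nonincreasing on $\mathbb{R}_+$, and that $\rho_t+\eta_t\ge0$ for all $t\in[0,T]$. Then: 1. For every $t\in[0,T]$, $h_{V,t}$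 is a $C^1$ bijection of $\mathbb{R}$ with $h_{V,t}'>0$. 2. $C^V(X)\ge0$ for every liquidation path $X$ of every $x$, and for every admissible strategy the random variable inside the expectation defining $\mathcal C(X)$ is integrable. 3. For every $x\in\mathbb{R}$ the equation $\int_0^T\lambda(t)\rho_t h_{V,t}^{-1}(\nu)\,dt+\lambda(T)F(\nu)=-x$ has a unique solution $\nu\in\mathbb{R}$. With $\zeta_t=h_{V,t}^{-1}(\nu)$, which is $C^1$ on $[0,T]$, let $$\xi^\star_0=\lambda(0)\zeta_0,\qquad \xi^\star_t=\lambda(t)\Big[\frac{d\zeta_t}{dt}+(\rho_t+\eta_t)\zeta_t\Big],\qquad \xi^\star_T=\lambda(T)(F(\nu)-\zeta_T)$$ be the initial trade, the trading rate at time $t\in(0,T)$ and the last trade. The strategy $X^\star$ with $X^\star_0=x$ and $dX^\star_t=\xi^\star_0\,\delta_0(dt)+\xi^\star_t\,dt+\xi^\star_T\,\delta_T(dt)$ is admissible for $x$. It is the unique minimizer of $C^V$ among the liquidation paths of $x$, and it minimizes $\mathcal C$ among the admissible strategies for $x$, any minimizer of $\mathcal C$ being a.s. equal to $X^\star$. 4.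 The initial trade $\xi^\star_0$ has the (strict) sign of $-x$. The last trade $\xi^\star_T$ has the same sign as $-x$ in the weak sense ($\xi^\star_T\ge0$ if $-x\ge0$, and $\xi^\star_T\le0$ if $-x\le0$). 5. If in addition $$\rho_t+\eta_t\ge0\quad\text{and}\quad\Big(\frac{\rho_t}{2\rho_t+\eta_t}\Big)'+\rho_t\,\frac{\rho_t+\eta_t}{2\rho_t+\eta_t}\ge0\qquad\text{for all }t\in[0,T],$$ then for every $x$ and every $0<t<T$ the rate $\xi^\star_t$ has the same sign as $-x$ in the weak sense, and the model does not admit TTPM. -/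

import Mathlib

open MeasureTheory ProbabilityTheory Set Filter Topology
open scoped NNReal

noncomputable section

/-- The deterministic data of a limit order book on the horizon `[0, T]`: the shape function `f`,
the depth `lam` and the resilience `rho`, with the standing regularity assumptions of the model. -/
structure OrderBook where
  /-- the time horizon -/
  T : ℝ
  T_pos : 0 < T
  /-- the shape function of the book -/
  f : ℝ → ℝ
  f_continuous : Continuous f
  f_pos : ∀ y, 0 < f y
  f_atTop : Tendsto (fun y => ∫ z in (0 : ℝ)..y, f z) atTop atTop
  f_atBot : Tendsto (fun y => ∫ z in (0 : ℝ)..y, f z) atBot atBot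
  /-- the depth of the book -/
  lam : ℝ → ℝ
  lam_pos : ∀ t ∈ Icc 0 T, 0 < lam t
  lam_contDiff : ContDiffOn ℝ 2 lam (Icc 0 T)
  /-- the resilience -/
  rho : ℝ → ℝ
  rho_pos : ∀ t ∈ Icc 0 T, 0 < rho t
  rho_contDiff : ContDiffOn ℝ 1 rho (Icc 0 T)

/-- The jump `X (t+) - X t` of a left-continuous path at time `t`. -/
def pathJump (X : ℝ → ℝ) (t : ℝ) : ℝ := Function.rightLim X t - X t

open scoped Classical in
/-- The signed (Lebesgue-Stieltjes) measure `dX` of a path of bounded variation; it gives the mass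
`X (b+) - X (a-)` to `[a, b]`. -/
def stieltjesOf (X : ℝ → ℝ) : VectorMeasure ℝ ℝ :=
  if h : BoundedVariationOn X univ then h.vectorMeasure else 0

/-- `X` is the path of a strategy that liquidates `x` shares over `[0, T]`: `X t` is the number of
shares still to be liquidated at time `t`, so `X 0 = x` and `X (T+) = 0`; it is left-continuous with
finite total variation. A path on `[0, T+]` is extended to the real line by `x` before time `0` and
by `0` after time `T`. -/
structure IsLiquidationPath (T x : ℝ) (X : ℝ → ℝ) : Prop where
  before : ∀ t, t ≤ 0 → X t = x
  after : ∀ t, T < t → X t = 0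
  left_continuous : ∀ t, ContinuousWithinAt X (Iic t) t
  finite_variation : BoundedVariationOn X univ

/-- Admissible strategies: adapted processes whose paths liquidate `x` shares and whose total
variation is almost surely bounded by a constant. -/
structure IsAdmissible {Ω : Type*} [mΩ : MeasurableSpace Ω] (P : Measure Ω)
    (ℱ : Filtration ℝ≥0 mΩ) (T x : ℝ) (X : ℝ → Ω → ℝ) : Prop where
  path : ∀ ω, IsLiquidationPath T x (fun t => X t ω)
  adapted : ∀ t : ℝ≥0, Measurable[ℱ t] (X t)
  bounded_variation : ∃ M : ℝ≥0, ∀ᵐ ω ∂P, eVariationOn (fun t => X t ω) univ ≤ M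

/-- `a` has the same sign as `b`, in the weak sense in which a vanishing trade is allowed. -/
def SameSignWeak (a b : ℝ) : Prop := (0 ≤ b → 0 ≤ a) ∧ (b ≤ 0 → a ≤ 0)

namespace OrderBook

variable (B : OrderBook)

/-- The antiderivative `F` of the shape function. -/
def F (y : ℝ) : ℝ := ∫ z in (0 : ℝ)..y, B.f z

/-- The inverse `F⁻¹`. -/
def Finv : ℝ → ℝ := Function.invFun B.F

/-- `F̃ y = ∫₀ʸ z f(z) dz`. -/
def Ftilde (y : ℝ) : ℝ := ∫ z in (0 : ℝ)..y, z * B.f z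

/-- `G = F̃ ∘ F⁻¹`. -/
def G (x : ℝ) : ℝ := B.Ftilde (B.Finv x)

/-- The logarithmic derivative `η = λ' / λ` of the depth. -/
def eta (t : ℝ) : ℝ := derivWithin B.lam (Icc 0 B.T) t / B.lam t

/-- The function `h_{V,t}`. -/
def hV (t x : ℝ) : ℝ :=
  B.Finv x + (B.eta t + B.rho t) / B.rho t * (x / B.f (B.Finv x))

/-- The volume impact `E` in model `V`, i.e. the solution of `dE = dX - ρ E dt`, `E 0 = 0`, written
by variation of constants; see `volumeImpact_eq` for the equation itself. -/
def volumeImpact (X : ℝ → ℝ) (t : ℝ) : ℝ :=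
  (X t - X 0) -
    ∫ s in (0 : ℝ)..t, B.rho s * Real.exp (-∫ u in s..t, B.rho u) * (X s - X 0)

/-- The volume impact solves `E t = X t - X 0 - ∫₀ᵗ ρ E ds`, i.e. `dE = dX - ρ E dt`, `E 0 = 0`. -/
theorem volumeImpact_eq {X : ℝ → ℝ} (hX : BoundedVariationOn X univ) {t : ℝ}
    (ht : t ∈ Icc 0 B.T) :
    B.volumeImpact X t = X t - X 0 - ∫ s in (0 : ℝ)..t, B.rho s * B.volumeImpact X s := by
  obtain ⟨p, q, hp, hq, hpq⟩ :=
    hX.locallyBoundedVariationOn.exists_monotoneOn_sub_monotoneOn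
  rw [monotoneOn_univ] at hp hq
  set Y : ℝ → ℝ := fun s => X s - X 0 with hY
  have hYpq : Y = fun s => p s - q s - X 0 := by
    funext s
    simp [hY, hpq]
  have hYint : IntervalIntegrable Y volume 0 t := by
    rw [hYpq]
    exact ((hp.intervalIntegrable).sub (hq.intervalIntegrable)).sub intervalIntegrable_const
  have hsub : Icc 0 t ⊆ Icc 0 B.T := Icc_subset_Icc_right ht.2
  have hrho : ContinuousOn B.rho (Icc 0 t) := B.rho_contDiff.continuousOn.mono hsub
  have hrho' : ContinuousOn B.rho (uIcc 0 t) := by rwa [uIcc_of_le ht.1]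
  set R : ℝ → ℝ := fun s => ∫ u in (0 : ℝ)..s, B.rho u with hR
  have hRc : ContinuousOn R (Icc 0 t) := by
    have := intervalIntegral.continuousOn_primitive_interval (μ := volume) (a := 0) (b := t)
      (f := B.rho) (by rw [uIcc_of_le ht.1]; exact hrho.integrableOn_Icc)
    rwa [uIcc_of_le ht.1] at this
  have hRd : ∀ s ∈ Ioo 0 t, HasDerivAt R (B.rho s) s := by
    intro s hs
    refine intervalIntegral.integral_hasDerivAt_right ?_ ?_ ?_
    · exact (hrho.mono (by rw [uIcc_of_le hs.1.le]; exact Icc_subset_Icc_right hs.2.le)).intervalIntegrable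
    · exact (hrho.mono Ioo_subset_Icc_self).stronglyMeasurableAtFilter isOpen_Ioo s hs
    · exact hrho.continuousAt (Icc_mem_nhds hs.1 hs.2)
  set g : ℝ → ℝ := fun s => B.rho s * Real.exp (R s) * Y s with hg
  have hcoef : ContinuousOn (fun s => B.rho s * Real.exp (R s)) (Icc 0 t) :=
    hrho.mul hRc.rexp
  have hgint : IntervalIntegrable g volume 0 t :=
    hYint.continuousOn_mul (by rwa [uIcc_of_le ht.1])
  set W : ℝ → ℝ := fun s => ∫ u in (0 : ℝ)..s, g u with hW
  have hWc : ContinuousOn W (Icc 0 t) := by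
    have := intervalIntegral.continuousOn_primitive_interval (μ := volume) (a := 0) (b := t)
      (f := g) (by
        rw [uIcc_of_le ht.1]
        exact (intervalIntegrable_iff_integrableOn_Icc_of_le ht.1).1 hgint)
    rwa [uIcc_of_le ht.1] at this
  have hE : ∀ s ∈ Icc 0 t, B.volumeImpact X s = Y s - Real.exp (-R s) * W s := by
    intro s hs
    have hs0 : IntervalIntegrable B.rho volume 0 s :=
      (hrho.mono (by rw [uIcc_of_le hs.1]; exact Icc_subset_Icc_right hs.2)).intervalIntegrable
    simp only [volumeImpact, hW, hY]
    rw [← intervalIntegral.integral_const_mul]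
    congr 1
    refine intervalIntegral.integral_congr fun u hu => ?_
    rw [uIcc_of_le hs.1] at hu
    have hu0 : IntervalIntegrable B.rho volume 0 u :=
      (hrho.mono (by
        rw [uIcc_of_le hu.1]; exact Icc_subset_Icc_right (hu.2.trans hs.2))).intervalIntegrable
    have h1 : ∫ v in u..s, B.rho v = R s - R u :=
      (intervalIntegral.integral_interval_sub_left hs0 hu0).symm
    simp only [hg, hY, h1]
    rw [show -(R s - R u) = -R s + R u by ring, Real.exp_add]
    ring
  set D : Set ℝ := {s | ¬ ContinuousAt p s} ∪ {s | ¬ ContinuousAt q s} with hD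
  have hDc : D.Countable := hp.countable_not_continuousAt.union hq.countable_not_continuousAt
  have key : ∫ s in (0 : ℝ)..t, B.rho s * (Y s - Real.exp (-R s) * W s) =
      Real.exp (-R t) * W t - Real.exp (-R 0) * W 0 := by
    refine MeasureTheory.integral_eq_of_hasDerivAt_off_countable_of_le
      (fun s => Real.exp (-R s) * W s) _ ht.1 hDc (hRc.neg.rexp.mul hWc) ?_ ?_
    · rintro s ⟨hs, hsD⟩
      simp only [hD, mem_union, mem_ofPred_eq, not_or, not_not] at hsD
      have hYs : ContinuousAt Y s := by
        rw [hYpq]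
        exact (hsD.1.sub hsD.2).sub continuousAt_const
      have hWd : HasDerivAt W (g s) s := by
        refine intervalIntegral.integral_hasDerivAt_right ?_ ?_ ?_
        · exact hgint.mono_set (by
            rw [uIcc_of_le hs.1.le, uIcc_of_le ht.1]; exact Icc_subset_Icc_right hs.2.le)
        · exact ⟨Ioo 0 t, Ioo_mem_nhds hs.1 hs.2,
            (((intervalIntegrable_iff_integrableOn_Ioo_of_le ht.1).1 hgint)).aestronglyMeasurable⟩
        · exact (hcoef.continuousAt (Icc_mem_nhds hs.1 hs.2)).mul hYs
      convert! ((hRd s hs).neg.exp).mul hWd using 1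
      simp only [hg]
      have : Real.exp (-R s) * Real.exp (R s) = 1 := by rw [← Real.exp_add]; simp
      linear_combination -(B.rho s * Y s) * this
    · refine (hYint.sub (ContinuousOn.intervalIntegrable ?_)).continuousOn_mul hrho'
      rw [uIcc_of_le ht.1]
      exact hRc.neg.rexp.mul hWc
  have hcongr : ∫ s in (0 : ℝ)..t, B.rho s * B.volumeImpact X s =
      ∫ s in (0 : ℝ)..t, B.rho s * (Y s - Real.exp (-R s) * W s) :=
    intervalIntegral.integral_congr fun s hs => by
      rw [uIcc_of_le ht.1] at hs
      simp only [hE s hs]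
  have hW0 : W 0 = 0 := by simp [hW]
  rw [hcongr, key, hW0, hE t ⟨ht.1, le_rfl⟩]
  simp [hY]

/-- The deterministic cost functional of model `V`:
`C^V(X) = ∫_{[0,T]} F⁻¹(E/λ) dX^c + ∑_{t ≤ T} λ(t) [G((E + ΔX)/λ) - G(E/λ)]`.
The measure `dX^c` of the continuous part is the restriction of `dX` to the times at which `X` does
not jump. -/
def costV (X : ℝ → ℝ) : ℝ :=
  (∫ᵛ t in Icc 0 B.T ∩ {t | pathJump X t = 0},
      B.Finv (B.volumeImpact X t / B.lam t) ∂•(stieltjesOf X)) +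
    ∑' t : Icc (0 : ℝ) B.T, B.lam t *
      (B.G ((B.volumeImpact X t + pathJump X t) / B.lam t) - B.G (B.volumeImpact X t / B.lam t))

/-- The realized total cost of the path `X` in model `V` when the unaffected price is `S`:
`∫_{[0,T]} [S + F⁻¹(E/λ)] dX^c + ∑_{t ≤ T} (S ΔX + λ(t) [G((E + ΔX)/λ) - G(E/λ)])`. -/
def realizedCost (S : ℝ≥0 → ℝ) (X : ℝ → ℝ) : ℝ :=
  (∫ᵛ t in Icc 0 B.T ∩ {t | pathJump X t = 0},
      (S t.toNNReal + B.Finv (B.volumeImpact X t / B.lam t)) ∂•(stieltjesOf X)) +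
    ∑' t : Icc (0 : ℝ) B.T, (S (t : ℝ).toNNReal * pathJump X t + B.lam t *
      (B.G ((B.volumeImpact X t + pathJump X t) / B.lam t) - B.G (B.volumeImpact X t / B.lam t)))

/-- The expected cost of the strategy `X` in model `V` with unaffected price process `S`. -/
def expectedCost {Ω : Type*} [MeasurableSpace Ω] (P : Measure Ω) (S : ℝ≥0 → Ω → ℝ)
    (X : ℝ → Ω → ℝ) : ℝ :=
  ∫ ω, B.realizedCost (fun t => S t ω) (fun t => X t ω) ∂P

/-- Model `V` admits transaction-triggered price manipulations: for some position `x`, some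
admissible strategy has an expected cost below the infimum (taken in the extended reals) of the
expected costs of the nonincreasing or nondecreasing admissible strategies. -/
def AdmitsTTPM {Ω : Type*} [mΩ : MeasurableSpace Ω] (P : Measure Ω)
    (ℱ : Filtration ℝ≥0 mΩ) (S : ℝ≥0 → Ω → ℝ) : Prop :=
  ∃ (x : ℝ) (X : ℝ → Ω → ℝ), IsAdmissible P ℱ B.T x X ∧
    (B.expectedCost P S X : EReal) <
      ⨅ Y ∈ {Y : ℝ → Ω → ℝ | IsAdmissible P ℱ B.T x Y ∧
        ((∀ ω, Antitone fun t => Y t ω) ∨ (∀ ω, Monotone fun t => Y t ω))},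
        (B.expectedCost P S Y : EReal)

/-- `ζ_t = h_{V,t}⁻¹(ν)`. -/
def zeta (ν t : ℝ) : ℝ := Function.invFun (B.hV t) ν

/-- `ν` solves `∫₀ᵀ λ(t) ρ_t h_{V,t}⁻¹(ν) dt + λ(T) F(ν) = -x`. -/
def SolvesNu (x ν : ℝ) : Prop :=
  (∫ t in (0 : ℝ)..B.T, B.lam t * B.rho t * B.zeta ν t) + B.lam B.T * B.F ν = -x

/-- The initial trade `ξ₀ = λ(0) ζ₀`. -/
def initialTrade (ν : ℝ) : ℝ := B.lam 0 * B.zeta ν 0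

/-- The intermediate trading rate `ξ_t = λ(t) [dζ_t/dt + (ρ_t + η_t) ζ_t]`. -/
def tradingRate (ν t : ℝ) : ℝ :=
  B.lam t * (derivWithin (B.zeta ν) (Icc 0 B.T) t + (B.rho t + B.eta t) * B.zeta ν t)

/-- The last trade `ξ_T = λ(T) (F(ν) - ζ_T)`. -/
def lastTrade (ν : ℝ) : ℝ := B.lam B.T * (B.F ν - B.zeta ν B.T)

/-- The left-continuous path with `X 0 = x` and `dX = ξ₀ δ₀(dt) + ξ_t dt + ξ_T δ_T(dt)`. -/
def strategyPath (x ν t : ℝ) : ℝ :=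
  if t ≤ 0 then x
  else if t ≤ B.T then x + B.initialTrade ν + ∫ s in (0 : ℝ)..t, B.tradingRate ν s
  else x + B.initialTrade ν + (∫ s in (0 : ℝ)..B.T, B.tradingRate ν s) + B.lastTrade ν

/-- The condition that excludes transaction-triggered manipulations for a block-shaped book:
`ρ + η ≥ 0` and `(ρ/(2ρ+η))' + ρ (ρ+η)/(2ρ+η) ≥ 0` on `[0, T]`. -/
def BlockCondition : Prop :=
  ∀ t ∈ Icc 0 B.T, 0 ≤ B.rho t + B.eta t ∧
    0 ≤ derivWithin (fun s => B.rho s / (2 * B.rho s + B.eta s)) (Icc 0 B.T) t +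
      B.rho t * ((B.rho t + B.eta t) / (2 * B.rho t + B.eta t))

end OrderBook

end

/-! Let y = E/λ. As G' = F⁻¹, the chain rule for λG(y) along a path of bounded variation turns the
cost into a terminal term plus a Lebesgue integral (`costV_eq`): C^V(X) = λ(T)G(y_{T+}) + ∫ λ[(ρ+η)
y F⁻¹(y) − ηG(y)] dt. No derivative of y survives. Nonnegativity follows from 0 ≤ G(y) ≤ yF⁻¹(y).

The liquidation condition also becomes an integral constraint, λ(T)y_{T+} + ∫ ρλy dt = −x. With a
multiplier ν the problem separates over time: the integrand has y-derivative λρ(h_{V,t}(y) − ν), so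
it is minimal exactly at ζ_t, and the terminal term is minimal at F(ν) (`lagrangian_lt`,
`G_sub_mul_le`). The trades of X⋆ are those that keep E = λζ, and the equation for ν says that X⋆
ends at 0. In the case of equality y = ζ almost everywhere, and left-continuity recovers the path.

In the price variable z = F⁻¹(y) one has h_{V,t} = z + cφ(z) with c = (η+ρ)/ρ and φ = F/f.
Unimodality of f gives φ' ≥ 1, hence monotonicity, regularity of ζ in time and the signs of the
trades. The condition on ρ/(2ρ+η) is a bound on c', sharp when φ' = 1 and sufficient when φ' ≥ 1.

For random strategies, the mean of ∫ S⁰ dX is −x E[S⁰_T] whatever the strategy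
(`IsAdmissible.integral_tradedValue`): Riemann sums at right endpoints are weighted sums of
conditional expectations of S⁰_T, and these are uniformly integrable. Only the mean of C^V is left
to minimize, which is done path by path. When X⋆ is monotone it competes in the infimum that defines
TTPM, so nothing can beat that infimum. -/

noncomputable section

/-! ### Calculus of the shape function: F, its inverse, the convex function G and the ratio φ = F/f.
-/

namespace OrderBook

variable (B : OrderBook)

theorem F_hasDerivAt (y : ℝ) : HasDerivAt B.F (B.f y) y :=
  intervalIntegral.integral_hasDerivAt_right (B.f_continuous.intervalIntegrable _ _)
    (B.f_continuous.stronglyMeasurableAtFilter _ _) B.f_continuous.continuousAt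

theorem F_zero : B.F 0 = 0 := by simp [F]

theorem F_continuous : Continuous B.F :=
  continuous_iff_continuousAt.2 fun y => (B.F_hasDerivAt y).continuousAt

theorem F_strictMono : StrictMono B.F :=
  strictMono_of_deriv_pos fun y => by rw [(B.F_hasDerivAt y).deriv]; exact B.f_pos y

theorem F_surjective : Function.Surjective B.F :=
  B.F_continuous.surjective B.f_atTop B.f_atBot

theorem F_Finv (y : ℝ) : B.F (B.Finv y) = y :=
  Function.rightInverse_invFun B.F_surjective y

theorem Finv_F (y : ℝ) : B.Finv (B.F y) = y :=
  Function.leftInverse_invFun B.F_strictMono.injective y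

theorem Finv_zero : B.Finv 0 = 0 := by
  have := B.Finv_F 0
  rwa [B.F_zero] at this

theorem Finv_strictMono : StrictMono B.Finv := fun a b hab => by
  rw [← B.F_strictMono.lt_iff_lt, B.F_Finv, B.F_Finv]
  exact hab

theorem Finv_continuous : Continuous B.Finv :=
  B.Finv_strictMono.monotone.continuous_of_surjective fun y => ⟨B.F y, B.Finv_F y⟩

theorem Finv_hasDerivAt (y : ℝ) : HasDerivAt B.Finv (B.f (B.Finv y))⁻¹ y :=
  HasDerivAt.of_local_left_inverse B.Finv_continuous.continuousAt (B.F_hasDerivAt _)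
    (B.f_pos _).ne' (Eventually.of_forall B.F_Finv)

theorem Ftilde_hasDerivAt (y : ℝ) : HasDerivAt B.Ftilde (y * B.f y) y := by
  have h : Continuous fun z => z * B.f z := continuous_id.mul B.f_continuous
  exact intervalIntegral.integral_hasDerivAt_right (h.intervalIntegrable _ _)
    (h.stronglyMeasurableAtFilter _ _) h.continuousAt

/-- The factor f from F̃' = z f(z) cancels against (F⁻¹)' = 1/f. Since F⁻¹ increases, G is strictly
convex. -/
theorem G_hasDerivAt (y : ℝ) : HasDerivAt B.G (B.Finv y) y := by
  refine ((B.Ftilde_hasDerivAt (B.Finv y)).comp y (B.Finv_hasDerivAt y)).congr_deriv ?_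
  field_simp [(B.f_pos (B.Finv y)).ne']

theorem G_zero : B.G 0 = 0 := by simp [G, B.Finv_zero, Ftilde]

theorem G_continuous : Continuous B.G :=
  continuous_iff_continuousAt.2 fun y => (B.G_hasDerivAt y).continuousAt

/-- The strict gradient inequality for the convex function `G`. -/
theorem G_gradient_lt {a b : ℝ} (hab : a ≠ b) : B.G a + B.Finv a * (b - a) < B.G b := by
  have hd : ∀ y, HasDerivAt (fun y => B.G y - B.Finv a * y) (B.Finv y - B.Finv a) y := fun y =>
    ((B.G_hasDerivAt y).sub ((hasDerivAt_id y).const_mul (B.Finv a))).congr_deriv (by simp)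
  have hc : Continuous (fun y => B.G y - B.Finv a * y) :=
    continuous_iff_continuousAt.2 fun y => (hd y).continuousAt
  rcases hab.lt_or_gt with h | h
  · have := strictMonoOn_of_deriv_pos (convex_Ici a) hc.continuousOn (fun y hy => by
      rw [interior_Ici, mem_Ioi] at hy
      rw [(hd y).deriv, sub_pos]
      exact B.Finv_strictMono hy) (mem_Ici.2 le_rfl) (mem_Ici.2 h.le) h
    simp only at this
    linarith
  · have := strictAntiOn_of_deriv_neg (convex_Iic a) hc.continuousOn (fun y hy => by
      rw [interior_Iic, mem_Iio] at hy
      rw [(hd y).deriv, sub_neg]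
      exact B.Finv_strictMono hy) (mem_Iic.2 h.le) (mem_Iic.2 le_rfl) h
    simp only at this
    linarith

theorem G_gradient_le (a b : ℝ) : B.G a + B.Finv a * (b - a) ≤ B.G b := by
  rcases eq_or_ne a b with rfl | h
  · simp
  · exact (B.G_gradient_lt h).le

theorem G_nonneg (y : ℝ) : 0 ≤ B.G y := by
  have := B.G_gradient_le 0 y
  rwa [B.G_zero, B.Finv_zero, zero_mul, add_zero] at this

/-- The tangent of G at y lies below G at 0, where G vanishes. This drives the nonnegativity of the
cost. -/
theorem G_le_mul_Finv (y : ℝ) : B.G y ≤ y * B.Finv y := by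
  have := B.G_gradient_le y 0
  rw [B.G_zero] at this
  linarith

/-- The ratio `F / f`. -/
def phi (z : ℝ) : ℝ := B.F z / B.f z

/-- The derivative of `F / f`. -/
def phi' (z : ℝ) : ℝ := 1 - B.F z * deriv B.f z / B.f z ^ 2

theorem phi_zero : B.phi 0 = 0 := by simp [phi, B.F_zero]

theorem phi_hasDerivAt (hf : ContDiff ℝ 1 B.f) (z : ℝ) : HasDerivAt B.phi (B.phi' z) z := by
  have h1 : HasDerivAt B.f (deriv B.f z) z := (hf.differentiable one_ne_zero z).hasDerivAt
  refine ((B.F_hasDerivAt z).div h1 (B.f_pos z).ne').congr_deriv ?_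
  have := (B.f_pos z).ne'
  simp only [phi']
  field_simp

theorem phi_continuous : Continuous B.phi :=
  B.F_continuous.div B.f_continuous fun z => (B.f_pos z).ne'

theorem phi'_continuous (hf : ContDiff ℝ 1 B.f) : Continuous B.phi' :=
  continuous_const.sub ((B.F_continuous.mul (hf.continuous_deriv le_rfl)).div
    (B.f_continuous.pow 2) fun z => (pow_pos (B.f_pos z) 2).ne')

theorem F_pos {z : ℝ} (hz : 0 < z) : 0 < B.F z := by simpa [B.F_zero] using B.F_strictMono hz

theorem F_neg {z : ℝ} (hz : z < 0) : B.F z < 0 := by simpa [B.F_zero] using B.F_strictMono hz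

/-- F has the sign of z and f' the opposite sign, so F f' ≤ 0. The bound 1 is attained by a
block-shaped book, and it is what the last sign argument needs. -/
theorem one_le_phi' (hf_left : MonotoneOn B.f (Iic 0)) (hf_right : AntitoneOn B.f (Ici 0))
    (z : ℝ) : 1 ≤ B.phi' z := by
  have key : B.F z * deriv B.f z ≤ 0 := by
    rcases lt_trichotomy z 0 with hz | rfl | hz
    · have : 0 ≤ deriv B.f z := by
        rw [← derivWithin_of_mem_nhds (Iic_mem_nhds hz)]
        exact hf_left.derivWithin_nonneg
      exact mul_nonpos_of_nonpos_of_nonneg (B.F_neg hz).le this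
    · simp [B.F_zero]
    · have : deriv B.f z ≤ 0 := by
        rw [← derivWithin_of_mem_nhds (Ici_mem_nhds hz)]
        exact hf_right.derivWithin_nonpos
      exact mul_nonpos_of_nonneg_of_nonpos (B.F_pos hz).le this
  have := div_nonpos_of_nonpos_of_nonneg key (sq_nonneg (B.f z))
  simp only [phi']
  linarith

/-- The regularity of the shape function under which the optimal strategy is explicit. -/
structure IsUnimodal : Prop where
  contDiff : ContDiff ℝ 1 B.f
  left : MonotoneOn B.f (Iic 0)
  right : AntitoneOn B.f (Ici 0)

/-- The coefficient `(η + ρ) / ρ`. -/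
def coef (t : ℝ) : ℝ := (B.eta t + B.rho t) / B.rho t

variable {B}

theorem phi_monotone (hB : B.IsUnimodal) : Monotone B.phi :=
  monotone_of_deriv_nonneg (fun z => (B.phi_hasDerivAt hB.contDiff z).differentiableAt) fun z => by
    rw [(B.phi_hasDerivAt hB.contDiff z).deriv]
    exact zero_le_one.trans (B.one_le_phi' hB.left hB.right z)

/-- The identity plus a nondecreasing map expands distances, so its inverse is 1-Lipschitz uniformly
in c ≥ 0. -/
theorem abs_sub_le_abs_add_mul_phi_sub (hB : B.IsUnimodal) {c : ℝ} (hc : 0 ≤ c) (z w : ℝ) :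
    |z - w| ≤ |(z + c * B.phi z) - (w + c * B.phi w)| := by
  rcases le_total z w with h | h
  · have := mul_le_mul_of_nonneg_left (phi_monotone hB h) hc
    rw [abs_of_nonpos (by linarith), abs_of_nonpos (by linarith)]
    linarith
  · have := mul_le_mul_of_nonneg_left (phi_monotone hB h) hc
    rw [abs_of_nonneg (by linarith), abs_of_nonneg (by linarith)]
    linarith

theorem add_mul_phi_surjective (hB : B.IsUnimodal) {c : ℝ} (hc : 0 ≤ c) :
    Function.Surjective fun z => z + c * B.phi z := by
  have hcont : Continuous fun z => z + c * B.phi z :=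
    continuous_id.add (continuous_const.mul B.phi_continuous)
  refine hcont.surjective ?_ ?_
  · refine tendsto_atTop_mono' _ ?_ tendsto_id
    filter_upwards [eventually_ge_atTop 0] with z hz
    have := mul_nonneg hc (by simpa [B.phi_zero] using phi_monotone hB hz)
    simp only [id]; linarith
  · refine tendsto_atBot_mono' _ ?_ tendsto_id
    filter_upwards [eventually_le_atBot 0] with z hz
    have := mul_nonpos_of_nonneg_of_nonpos hc (by simpa [B.phi_zero] using phi_monotone hB hz)
    simp only [id]; linarith

/-- In the price variable z = F⁻¹(y) the time dependence sits in the single coefficient c, and h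
becomes the identity plus c times a monotone function. -/
theorem hV_eq (t y : ℝ) : B.hV t y = B.Finv y + B.coef t * B.phi (B.Finv y) := by
  simp [hV, coef, phi, B.F_Finv]

theorem hV_F (t z : ℝ) : B.hV t (B.F z) = z + B.coef t * B.phi z := by
  rw [hV_eq, B.Finv_F]

theorem hV_hasDerivAt (hB : B.IsUnimodal) (t y : ℝ) :
    HasDerivAt (B.hV t) ((1 + B.coef t * B.phi' (B.Finv y)) * (B.f (B.Finv y))⁻¹) y := by
  have h1 := ((hasDerivAt_id (B.Finv y)).add
    ((B.phi_hasDerivAt hB.contDiff (B.Finv y)).const_mul (B.coef t))).comp y (B.Finv_hasDerivAt y)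
  exact h1.congr_of_eventuallyEq (Eventually.of_forall fun y => hV_eq t y)

theorem one_le_one_add_mul_phi' (hB : B.IsUnimodal) {c : ℝ} (hc : 0 ≤ c) (z : ℝ) :
    1 ≤ 1 + c * B.phi' z := by
  have := mul_nonneg hc (zero_le_one.trans (B.one_le_phi' hB.left hB.right z))
  linarith

theorem hV_contDiff (hB : B.IsUnimodal) (t : ℝ) : ContDiff ℝ 1 (B.hV t) := by
  rw [contDiff_one_iff_deriv]
  refine ⟨fun y => (hV_hasDerivAt hB t y).differentiableAt, ?_⟩
  have : deriv (B.hV t) = fun y => (1 + B.coef t * B.phi' (B.Finv y)) * (B.f (B.Finv y))⁻¹ :=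
    funext fun y => (hV_hasDerivAt hB t y).deriv
  rw [this]
  exact (continuous_const.add (continuous_const.mul
    ((B.phi'_continuous hB.contDiff).comp B.Finv_continuous))).mul
      ((B.f_continuous.comp B.Finv_continuous).inv₀ fun y => (B.f_pos _).ne')

theorem hV_deriv_pos (hB : B.IsUnimodal) {t : ℝ} (hc : 0 ≤ B.coef t) (y : ℝ) :
    0 < deriv (B.hV t) y := by
  rw [(hV_hasDerivAt hB t y).deriv]
  exact mul_pos (one_pos.trans_le (one_le_one_add_mul_phi' hB hc _)) (inv_pos.2 (B.f_pos _))

theorem hV_strictMono (hB : B.IsUnimodal) {t : ℝ} (hc : 0 ≤ B.coef t) : StrictMono (B.hV t) :=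
  strictMono_of_deriv_pos (hV_deriv_pos hB hc)

theorem hV_bijective (hB : B.IsUnimodal) {t : ℝ} (hc : 0 ≤ B.coef t) :
    Function.Bijective (B.hV t) := by
  refine ⟨(hV_strictMono hB hc).injective, fun ν => ?_⟩
  obtain ⟨z, hz⟩ := add_mul_phi_surjective hB hc ν
  exact ⟨B.F z, by rw [hV_F]; exact hz⟩

theorem coef_nonneg {t : ℝ} (ht : t ∈ Icc 0 B.T) (hrho : 0 ≤ B.rho t + B.eta t) :
    0 ≤ B.coef t :=
  div_nonneg (by linarith) (B.rho_pos t ht).le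

theorem hV_zeta (hB : B.IsUnimodal) {t : ℝ} (hc : 0 ≤ B.coef t) (ν : ℝ) :
    B.hV t (B.zeta ν t) = ν :=
  Function.rightInverse_invFun (hV_bijective hB hc).2 ν

variable (B) in
/-- The price level `F⁻¹(ζ_t)` that corresponds to the volume level `ζ_t`. -/
def level (ν t : ℝ) : ℝ := B.Finv (B.zeta ν t)

theorem F_level (ν t : ℝ) : B.F (B.level ν t) = B.zeta ν t := B.F_Finv _

theorem level_eq (hB : B.IsUnimodal) {t : ℝ} (hc : 0 ≤ B.coef t) (ν : ℝ) :
    B.level ν t + B.coef t * B.phi (B.level ν t) = ν := by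
  have := hV_zeta hB hc ν
  rwa [hV_eq] at this

/-- Subtracting the two defining equations leaves only ν − μ and the change of c on the right; the
expansion bound then controls the difference of the levels. Continuity in t and in ν both come from
here. -/
theorem abs_level_sub_le (hB : B.IsUnimodal) {s t : ℝ} (hs : 0 ≤ B.coef s) (ht : 0 ≤ B.coef t)
    (ν μ : ℝ) : |B.level ν s - B.level μ t| ≤
      |ν - μ| + |B.coef s - B.coef t| * |B.phi (B.level μ t)| := by
  refine (abs_sub_le_abs_add_mul_phi_sub hB hs _ _).trans ?_
  have h : (B.level ν s + B.coef s * B.phi (B.level ν s)) -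
      (B.level μ t + B.coef s * B.phi (B.level μ t)) =
      (ν - μ) - (B.coef s - B.coef t) * B.phi (B.level μ t) := by
    linear_combination level_eq hB hs ν - level_eq hB ht μ
  rw [h, ← abs_mul]
  exact abs_sub _ _

theorem eta_contDiffOn : ContDiffOn ℝ 1 B.eta (Icc 0 B.T) := by
  have h : ContDiffOn ℝ 1 (derivWithin B.lam (Icc 0 B.T)) (Icc 0 B.T) :=
    B.lam_contDiff.derivWithin (uniqueDiffOn_Icc B.T_pos) (by norm_num)
  exact h.div (B.lam_contDiff.of_le (by norm_num)) fun t ht => (B.lam_pos t ht).ne'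

theorem coef_contDiffOn : ContDiffOn ℝ 1 B.coef (Icc 0 B.T) :=
  (eta_contDiffOn.add B.rho_contDiff).div B.rho_contDiff fun t ht => (B.rho_pos t ht).ne'

variable (B) in
/-- The standing assumption `ρ + η ≥ 0` on `[0, T]`. -/
def ResilienceDominates : Prop := ∀ t ∈ Icc 0 B.T, 0 ≤ B.rho t + B.eta t

theorem ResilienceDominates.coef_nonneg (hR : B.ResilienceDominates) {t : ℝ}
    (ht : t ∈ Icc 0 B.T) : 0 ≤ B.coef t :=
  OrderBook.coef_nonneg ht (hR t ht)

theorem level_continuousOn (hB : B.IsUnimodal) (hR : B.ResilienceDominates) (ν : ℝ) :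
    ContinuousOn (B.level ν) (Icc 0 B.T) := by
  intro t ht
  refine tendsto_iff_dist_tendsto_zero.2 (squeeze_zero' (Eventually.of_forall fun _ => dist_nonneg)
    (g := fun s => |B.coef s - B.coef t| * |B.phi (B.level ν t)|) ?_ ?_)
  · filter_upwards [self_mem_nhdsWithin] with s hs
    have := abs_level_sub_le hB (hR.coef_nonneg hs) (hR.coef_nonneg ht) ν ν
    simpa [Real.dist_eq] using this
  · have h := ((coef_contDiffOn (B := B)).continuousOn t ht).sub
      (continuousWithinAt_const (b := B.coef t))
    have : Tendsto (fun s => |B.coef s - B.coef t| * |B.phi (B.level ν t)|) (𝓝[Icc 0 B.T] t)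
        (𝓝 (|B.coef t - B.coef t| * |B.phi (B.level ν t)|)) :=
      (h.abs.mul (continuousWithinAt_const (b := |B.phi (B.level ν t)|))).tendsto
    simpa using this

theorem level_continuous_left (hB : B.IsUnimodal) {t : ℝ} (hc : 0 ≤ B.coef t) :
    Continuous fun ν => B.level ν t := by
  have : LipschitzWith 1 fun ν => B.level ν t := LipschitzWith.of_dist_le_mul fun ν μ => by
    simpa [Real.dist_eq] using abs_level_sub_le hB hc hc ν μ
  exact this.continuous

/-- Implicit differentiation of z + cφ(z) = ν, done with difference quotients. Subtracting the
equations at s and t gives exactly (z_s − z_t)(1 + c_s D) = −(c_s − c_t)φ(z_t), with D the slope of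
φ between the two levels; let s tend to t. -/
theorem level_hasDerivWithinAt (hB : B.IsUnimodal) (hR : B.ResilienceDominates) (ν : ℝ) {t : ℝ}
    (ht : t ∈ Icc 0 B.T) :
    HasDerivWithinAt (B.level ν) (-(derivWithin B.coef (Icc 0 B.T) t * B.phi (B.level ν t)) /
      (1 + B.coef t * B.phi' (B.level ν t))) (Icc 0 B.T) t := by
  have hc : HasDerivWithinAt B.coef (derivWithin B.coef (Icc 0 B.T) t) (Icc 0 B.T) t :=
    ((coef_contDiffOn (B := B)).differentiableOn one_ne_zero t ht).hasDerivWithinAt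
  have hφ := B.phi_hasDerivAt hB.contDiff (B.level ν t)
  rw [hasDerivWithinAt_iff_tendsto_slope] at hc ⊢
  have hsub : 𝓝[Icc 0 B.T \ {t}] t ≤ 𝓝[Icc 0 B.T] t := nhdsWithin_mono _ sdiff_subset
  -- `dslope` rather than the plain slope, because the level may take the same value at s and t.
  have hds : ContinuousAt (dslope B.phi (B.level ν t)) (B.level ν t) :=
    continuousAt_dslope_same.2 hφ.differentiableAt
  have hlev : Tendsto (B.level ν) (𝓝[Icc 0 B.T \ {t}] t) (𝓝 (B.level ν t)) :=
    (level_continuousOn hB hR ν t ht).tendsto.mono_left hsub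
  have h1 := hds.tendsto.comp hlev
  rw [dslope_same, hφ.deriv] at h1
  have h2 : Tendsto B.coef (𝓝[Icc 0 B.T \ {t}] t) (𝓝 (B.coef t)) :=
    ((coef_contDiffOn (B := B)).continuousOn t ht).tendsto.mono_left hsub
  have h3 := ((hc.mul_const (B.phi (B.level ν t))).neg).div
    ((h2.mul h1).const_add 1) (one_pos.trans_le
      (one_le_one_add_mul_phi' hB (hR.coef_nonneg ht) (B.level ν t))).ne'
  refine h3.congr' ?_
  filter_upwards [self_mem_nhdsWithin] with s hs
  have hst : s - t ≠ 0 := sub_ne_zero.2 hs.2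
  have hd : 0 ≤ dslope B.phi (B.level ν t) (B.level ν s) := by
    rcases eq_or_ne (B.level ν s) (B.level ν t) with h | h
    · rw [h, dslope_same, hφ.deriv]
      exact zero_le_one.trans (B.one_le_phi' hB.left hB.right _)
    · rw [dslope_of_ne _ h, slope_def_field]
      rcases h.lt_or_gt with h | h
      · exact div_nonneg_of_nonpos (sub_nonpos.2 (phi_monotone hB h.le)) (sub_nonpos.2 h.le)
      · exact div_nonneg (sub_nonneg.2 (phi_monotone hB h.le)) (sub_nonneg.2 h.le)
  have hpos : 0 < 1 + B.coef s * dslope B.phi (B.level ν t) (B.level ν s) := by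
    have := mul_nonneg (hR.coef_nonneg hs.1) hd
    linarith
  have hsl : (B.level ν s - B.level ν t) * dslope B.phi (B.level ν t) (B.level ν s) =
      B.phi (B.level ν s) - B.phi (B.level ν t) := by
    simpa using sub_smul_dslope B.phi (B.level ν t) (B.level ν s)
  simp only [Function.comp, slope_def_field, Pi.div_apply]
  rw [div_eq_iff hpos.ne']
  field_simp
  linear_combination -level_eq hB (hR.coef_nonneg hs.1) ν + level_eq hB (hR.coef_nonneg ht) ν -
    B.coef s * hsl

/-- Chain rule for ζ = F(z): the factor f(z) from F' cancels the denominator of φ, since fφ = F. -/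
theorem zeta_hasDerivWithinAt (hB : B.IsUnimodal) (hR : B.ResilienceDominates) (ν : ℝ) {t : ℝ}
    (ht : t ∈ Icc 0 B.T) :
    HasDerivWithinAt (B.zeta ν) (-(derivWithin B.coef (Icc 0 B.T) t * B.zeta ν t) /
      (1 + B.coef t * B.phi' (B.level ν t))) (Icc 0 B.T) t := by
  have h := (B.F_hasDerivAt (B.level ν t)).comp_hasDerivWithinAt t
    (level_hasDerivWithinAt hB hR ν ht)
  refine (h.congr_of_eventuallyEq (Eventually.of_forall fun s => (F_level ν s).symm)
    (F_level ν t).symm).congr_deriv ?_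
  have := (B.f_pos (B.level ν t)).ne'
  rw [← F_level ν t, phi]
  field_simp

theorem zeta_continuousOn (hB : B.IsUnimodal) (hR : B.ResilienceDominates) (ν : ℝ) :
    ContinuousOn (B.zeta ν) (Icc 0 B.T) := fun _ ht =>
  (zeta_hasDerivWithinAt hB hR ν ht).continuousWithinAt

theorem zeta_contDiffOn (hB : B.IsUnimodal) (hR : B.ResilienceDominates) (ν : ℝ) :
    ContDiffOn ℝ 1 (B.zeta ν) (Icc 0 B.T) := by
  have hu := uniqueDiffOn_Icc B.T_pos
  rw [show (1 : WithTop ℕ∞) = 0 + 1 by norm_num, contDiffOn_succ_iff_derivWithin hu]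
  refine ⟨fun t ht => (zeta_hasDerivWithinAt hB hR ν ht).differentiableWithinAt, by simp, ?_⟩
  rw [contDiffOn_zero]
  have : ContinuousOn (fun t => -(derivWithin B.coef (Icc 0 B.T) t * B.zeta ν t) /
      (1 + B.coef t * B.phi' (B.level ν t))) (Icc 0 B.T) := by
    refine ((((coef_contDiffOn (B := B)).continuousOn_derivWithin hu le_rfl).mul
      (zeta_continuousOn hB hR ν)).neg).div (continuousOn_const.add
      ((coef_contDiffOn (B := B)).continuousOn.mul ((B.phi'_continuous hB.contDiff).comp_continuousOn
        (level_continuousOn hB hR ν)))) fun t ht => ?_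
    exact (one_pos.trans_le
      (one_le_one_add_mul_phi' hB (hR.coef_nonneg ht) (B.level ν t))).ne'
  exact this.congr fun t ht => (zeta_hasDerivWithinAt hB hR ν ht).derivWithin (hu t ht)

theorem zeta_strictMono (hB : B.IsUnimodal) {t : ℝ} (hc : 0 ≤ B.coef t) :
    StrictMono fun ν => B.zeta ν t := fun ν μ h => by
  rw [← (hV_strictMono hB hc).lt_iff_lt, hV_zeta hB hc, hV_zeta hB hc]
  exact h

theorem zeta_continuous_left (hB : B.IsUnimodal) {t : ℝ} (hc : 0 ≤ B.coef t) :
    Continuous fun ν => B.zeta ν t := by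
  simp_rw [← F_level]
  exact B.F_continuous.comp (level_continuous_left hB hc)

theorem zeta_zero (hB : B.IsUnimodal) {t : ℝ} (hc : 0 ≤ B.coef t) : B.zeta 0 t = 0 :=
  (hV_strictMono hB hc).injective (by
    rw [hV_zeta hB hc, hV_eq, B.Finv_zero, B.phi_zero, mul_zero, add_zero])

/-- In z + cφ(z) = ν both summands have the same sign, so z lies between 0 and ν; apply F. This
decides the sign of the last trade. -/
theorem zeta_le_F_and_F_le_zeta (hB : B.IsUnimodal) {t : ℝ} (hc : 0 ≤ B.coef t) {ν : ℝ} :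
    (0 ≤ ν → B.zeta ν t ≤ B.F ν) ∧ (ν ≤ 0 → B.F ν ≤ B.zeta ν t) := by
  constructor <;> intro h
  · have h0 : 0 ≤ B.zeta ν t := zeta_zero hB hc ▸ (zeta_strictMono hB hc).monotone h
    have h1 : 0 ≤ B.level ν t := B.Finv_zero ▸ B.Finv_strictMono.monotone h0
    have h2 : 0 ≤ B.phi (B.level ν t) := B.phi_zero ▸ phi_monotone hB h1
    rw [← F_level]
    apply B.F_strictMono.monotone
    have := level_eq hB hc ν
    have := mul_nonneg hc h2
    linarith
  · have h0 : B.zeta ν t ≤ 0 := zeta_zero hB hc ▸ (zeta_strictMono hB hc).monotone h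
    have h1 : B.level ν t ≤ 0 := B.Finv_zero ▸ B.Finv_strictMono.monotone h0
    have h2 : B.phi (B.level ν t) ≤ 0 := B.phi_zero ▸ phi_monotone hB h1
    rw [← F_level]
    apply B.F_strictMono.monotone
    have := level_eq hB hc ν
    have := mul_nonpos_of_nonneg_of_nonpos hc h2
    linarith

end OrderBook

/-! ### Equidistant partitions of [0, T]. -/

/-- The `i`-th point of the partition of `[0, T]` into `n + 1` intervals of equal length. -/
def gridPt (T : ℝ) (n i : ℕ) : ℝ := i * (T / (n + 1))

/-- The index of the interval of the partition that contains `s`. -/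
def gridIdx (T : ℝ) (n : ℕ) (s : ℝ) : ℕ := ⌊s / (T / (n + 1))⌋₊

section Grid

variable {T : ℝ}

theorem gridPt_zero (n : ℕ) : gridPt T n 0 = 0 := by simp [gridPt]

theorem gridPt_last (n : ℕ) : gridPt T n (n + 1) = T := by
  simp only [gridPt]
  push_cast
  field_simp

theorem gridPt_strictMono (hT : 0 < T) (n : ℕ) : StrictMono (gridPt T n) := fun i j hij => by
  have : (i : ℝ) < j := by exact_mod_cast hij
  exact mul_lt_mul_of_pos_right this (by positivity)

theorem gridPt_mem_Icc (hT : 0 < T) {n i : ℕ} (hi : i ≤ n + 1) : gridPt T n i ∈ Icc 0 T := by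
  constructor
  · exact (gridPt_zero (T := T) n) ▸ (gridPt_strictMono hT n).monotone (Nat.zero_le i)
  · exact ((gridPt_strictMono hT n).monotone hi).trans_eq (gridPt_last n)

theorem gridPt_gridIdx_le (hT : 0 < T) (n : ℕ) {s : ℝ} (hs : 0 ≤ s) :
    gridPt T n (gridIdx T n s) ≤ s := by
  have hd : 0 < T / (n + 1) := by positivity
  have := Nat.floor_le (div_nonneg hs hd.le)
  rwa [le_div_iff₀ hd] at this

theorem lt_gridPt_gridIdx_succ (hT : 0 < T) (n : ℕ) (s : ℝ) :
    s < gridPt T n (gridIdx T n s + 1) := by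
  have hd : 0 < T / (n + 1) := by positivity
  have := Nat.lt_floor_add_one (s / (T / (n + 1)))
  rw [div_lt_iff₀ hd] at this
  simpa [gridPt, gridIdx] using this

theorem gridPt_succ (n i : ℕ) : gridPt T n (i + 1) = gridPt T n i + T / (n + 1) := by
  simp only [gridPt]
  push_cast
  ring

theorem gridIdx_le (hT : 0 < T) (n : ℕ) {s : ℝ} (hs : s ∈ Ico 0 T) : gridIdx T n s ≤ n := by
  have h := (gridPt_strictMono hT n).lt_iff_lt.1
    (((gridPt_gridIdx_le hT n hs.1).trans_lt hs.2).trans_eq (gridPt_last n).symm)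
  omega

theorem gridIdx_eq (hT : 0 < T) (n : ℕ) {i : ℕ} {s : ℝ}
    (hs : s ∈ Ico (gridPt T n i) (gridPt T n (i + 1))) : gridIdx T n s = i := by
  have hm := gridPt_strictMono hT n
  have h0 : 0 ≤ s := (gridPt_zero (T := T) n ▸ hm.monotone (Nat.zero_le i)).trans hs.1
  have h1 := hm.lt_iff_lt.1 ((gridPt_gridIdx_le hT n h0).trans_lt hs.2)
  have h2 := hm.lt_iff_lt.1 (hs.1.trans_lt (lt_gridPt_gridIdx_succ hT n s))
  omega

theorem tendsto_mesh : Tendsto (fun n : ℕ => T / ((n : ℝ) + 1)) atTop (𝓝 0) := by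
  have := (tendsto_one_div_add_atTop_nhds_zero_nat (𝕜 := ℝ)).const_mul T
  simpa [div_eq_mul_inv] using this

theorem tendsto_gridPt_left (hT : 0 < T) {s : ℝ} (hs : 0 ≤ s) :
    Tendsto (fun n => gridPt T n (gridIdx T n s)) atTop (𝓝[≤] s) := by
  refine tendsto_nhdsWithin_of_tendsto_nhds_of_eventually_within _ ?_
    (Eventually.of_forall fun n => gridPt_gridIdx_le hT n hs)
  refine tendsto_of_tendsto_of_tendsto_of_le_of_le
    (by simpa using (tendsto_mesh (T := T)).const_sub s) tendsto_const_nhds (fun n => ?_)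
    fun n => gridPt_gridIdx_le hT n hs
  have := lt_gridPt_gridIdx_succ hT n s
  rw [gridPt_succ] at this
  simp only
  linarith

theorem tendsto_gridPt_right (hT : 0 < T) {s : ℝ} (hs : 0 ≤ s) :
    Tendsto (fun n => gridPt T n (gridIdx T n s + 1)) atTop (𝓝[>] s) := by
  refine tendsto_nhdsWithin_of_tendsto_nhds_of_eventually_within _ ?_
    (Eventually.of_forall fun n => lt_gridPt_gridIdx_succ hT n s)
  refine tendsto_of_tendsto_of_tendsto_of_le_of_le tendsto_const_nhds
    (by simpa using (tendsto_mesh (T := T)).const_add s)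
    (fun n => (lt_gridPt_gridIdx_succ hT n s).le) fun n => ?_
  have := gridPt_gridIdx_le hT n hs
  rw [gridPt_succ]
  simp only
  linarith

theorem measurable_gridIdx (n : ℕ) : Measurable (gridIdx T n) :=
  Nat.measurable_floor.comp (measurable_id.div_const _)

theorem biUnion_Ico_gridPt (hT : 0 < T) (n : ℕ) :
    ⋃ i ∈ Finset.range (n + 1), Ico (gridPt T n i) (gridPt T n (i + 1)) = Ico 0 T := by
  ext s
  simp only [mem_iUnion, Finset.mem_range, exists_prop]
  constructor
  · rintro ⟨i, hi, hs⟩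
    exact ⟨(gridPt_mem_Icc hT hi.le).1.trans hs.1, hs.2.trans_le (gridPt_mem_Icc hT hi).2⟩
  · intro hs
    exact ⟨gridIdx T n s, Nat.lt_succ_of_le (gridIdx_le hT n hs), gridPt_gridIdx_le hT n hs.1,
      lt_gridPt_gridIdx_succ hT n s⟩

end Grid

/-! ### Convergence of Riemann sums for signed measures and for densities. -/

instance signedMeasure_isFiniteMeasure_variation {α : Type*} [MeasurableSpace α]
    (μ : SignedMeasure α) : IsFiniteMeasure (VectorMeasure.variation μ) := by
  rw [← SignedMeasure.totalVariation_eq_variation]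
  infer_instance

theorem integrableOn_of_forall_abs_le {μ : SignedMeasure ℝ} {s : Set ℝ} (hs : MeasurableSet s)
    {h : ℝ → ℝ} {C : ℝ} (hm : AEStronglyMeasurable h ((VectorMeasure.variation μ).restrict s))
    (hC : ∀ t ∈ s, |h t| ≤ C) : VectorMeasure.IntegrableOn μ h s := by
  rw [VectorMeasure.IntegrableOn, VectorMeasure.Integrable, VectorMeasure.variation_restrict hs]
  exact Integrable.of_bound hm C ((ae_restrict_iff' hs).2 (Eventually.of_forall hC))

/-- Riemann sums over the equidistant partitions converge to the integral with respect to a signed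
measure. -/
theorem tendsto_sum_mul_signedMeasure {T : ℝ} (hT : 0 < T) (μ : SignedMeasure ℝ) {a : ℕ → ℕ → ℝ}
    {h : ℝ → ℝ} {C : ℝ} (hC : ∀ n i, i ≤ n → |a n i| ≤ C)
    (hlim : ∀ s ∈ Ico 0 T, Tendsto (fun n => a n (gridIdx T n s)) atTop (𝓝 (h s))) :
    Tendsto (fun n => ∑ i ∈ Finset.range (n + 1),
      a n i * μ (Ico (gridPt T n i) (gridPt T n (i + 1)))) atTop
      (𝓝 (∫ᵛ s in Ico 0 T, h s ∂•μ)) := by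
  have hmeas : ∀ n, Measurable fun s => a n (gridIdx T n s) := fun n =>
    (measurable_from_nat (f := a n)).comp (measurable_gridIdx n)
  have hbd : ∀ n, ∀ s ∈ Ico 0 T, |a n (gridIdx T n s)| ≤ C := fun n s hs =>
    hC n _ (gridIdx_le hT n hs)
  -- The sum is the integral of a step function that is constant on each cell, so dominated
  -- convergence for the finite variation measure applies.
  have key : ∀ n, ∑ i ∈ Finset.range (n + 1),
      a n i * μ (Ico (gridPt T n i) (gridPt T n (i + 1))) =
      ∫ᵛ s in Ico 0 T, a n (gridIdx T n s) ∂•μ := by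
    intro n
    rw [← biUnion_Ico_gridPt hT n, VectorMeasure.setIntegral_biUnion_finset
      (s := fun i => Ico (gridPt T n i) (gridPt T n (i + 1))) _ (fun i _ => measurableSet_Ico)
      (fun i _ j _ hij => (gridPt_strictMono hT n).monotone.pairwise_disjoint_on_Ico_succ hij)]
    · refine Finset.sum_congr rfl fun i _ => ?_
      rw [VectorMeasure.setIntegral_congr_fun (g := fun _ => a n i) fun s hs => by
        simp only [gridIdx_eq hT n hs], VectorMeasure.setIntegral_const]
      simp
    · intro i hi
      rw [Finset.mem_range] at hi
      refine integrableOn_of_forall_abs_le measurableSet_Ico (hmeas n).aestronglyMeasurable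
        fun s hs => hbd n s ?_
      exact ⟨(gridPt_mem_Icc hT hi.le).1.trans hs.1, hs.2.trans_le (gridPt_mem_Icc hT hi).2⟩
  simp_rw [key]
  refine VectorMeasure.tendsto_integral_filter_of_norm_le_const
    (Eventually.of_forall fun n => (hmeas n).aestronglyMeasurable)
    ⟨C, Eventually.of_forall fun n => ?_⟩ ?_ <;>
    rw [VectorMeasure.variation_restrict measurableSet_Ico, ae_restrict_iff' measurableSet_Ico]
  · exact Eventually.of_forall (hbd n)
  · exact Eventually.of_forall hlim

/-- Riemann sums over the equidistant partitions converge to the integral with respect to a measure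
with a density. -/
theorem tendsto_sum_mul_integral {T : ℝ} (hT : 0 < T) {k : ℝ → ℝ}
    (hk : IntervalIntegrable k volume 0 T) {a : ℕ → ℕ → ℝ} {h : ℝ → ℝ} {C : ℝ}
    (hC : ∀ n i, i ≤ n → |a n i| ≤ C)
    (hlim : ∀ s ∈ Ico 0 T, Tendsto (fun n => a n (gridIdx T n s)) atTop (𝓝 (h s))) :
    Tendsto (fun n => ∑ i ∈ Finset.range (n + 1),
      a n i * ∫ s in (gridPt T n i)..(gridPt T n (i + 1)), k s) atTop
      (𝓝 (∫ s in (0 : ℝ)..T, h s * k s)) := by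
  have hmeas : ∀ n, Measurable fun s => a n (gridIdx T n s) := fun n =>
    (measurable_from_nat (f := a n)).comp (measurable_gridIdx n)
  have hsub : ∀ n i, i ≤ n → uIcc (gridPt T n i) (gridPt T n (i + 1)) ⊆ uIcc 0 T := by
    intro n i hi
    rw [uIcc_of_le hT.le, uIcc_of_le ((gridPt_strictMono hT n).monotone i.le_succ)]
    exact Icc_subset_Icc (gridPt_mem_Icc hT (by omega)).1 (gridPt_mem_Icc hT (by omega)).2
  -- Interval integrals live on half-open cells closed on the right, while `gridIdx` changes value
  -- at the right end; that single point is null.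
  have hae : ∀ n i, ∀ᵐ s ∂volume, s ∈ uIoc (gridPt T n i) (gridPt T n (i + 1)) →
      a n (gridIdx T n s) = a n i := by
    intro n i
    filter_upwards [compl_mem_ae_iff.2 (measure_singleton (gridPt T n (i + 1)))] with s hs hs'
    rw [uIoc_of_le ((gridPt_strictMono hT n).monotone i.le_succ)] at hs'
    rw [gridIdx_eq hT n ⟨hs'.1.le, lt_of_le_of_ne hs'.2 hs⟩]
  have key : ∀ n, ∑ i ∈ Finset.range (n + 1),
      a n i * ∫ s in (gridPt T n i)..(gridPt T n (i + 1)), k s =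
      ∫ s in (0 : ℝ)..T, a n (gridIdx T n s) * k s := by
    intro n
    have hsum := intervalIntegral.sum_integral_adjacent_intervals (μ := volume) (n := n + 1)
      (a := gridPt T n) (f := fun s => a n (gridIdx T n s) * k s) ?_
    · rw [gridPt_zero, gridPt_last] at hsum
      rw [← hsum]
      refine Finset.sum_congr rfl fun i _ => ?_
      rw [← intervalIntegral.integral_const_mul]
      refine intervalIntegral.integral_congr_ae ?_
      filter_upwards [hae n i] with s hs hs'
      rw [hs hs']
    · intro i hi
      have h1 : IntervalIntegrable (fun s => a n i * k s) volume (gridPt T n i)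
        (gridPt T n (i + 1)) := (hk.mono_set (hsub n i (by omega))).const_mul _
      refine h1.congr_ae ?_
      rw [EventuallyEq, ae_restrict_iff' measurableSet_uIoc]
      filter_upwards [hae n i] with s hs hs'
      rw [hs hs']
  simp_rw [key]
  refine intervalIntegral.tendsto_integral_filter_of_dominated_convergence (fun s => C * |k s|)
    (Eventually.of_forall fun n => ?_) (Eventually.of_forall fun n => ?_) (hk.abs.const_mul C) ?_
  · exact (hmeas n).aestronglyMeasurable.mul hk.def'.aestronglyMeasurable
  · filter_upwards [compl_mem_ae_iff.2 (measure_singleton T)] with s hs hs'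
    rw [uIoc_of_le hT.le] at hs'
    rw [Real.norm_eq_abs, abs_mul]
    exact mul_le_mul_of_nonneg_right (hC n _ (gridIdx_le hT n ⟨hs'.1.le, lt_of_le_of_ne hs'.2 hs⟩))
      (abs_nonneg _)
  · filter_upwards [compl_mem_ae_iff.2 (measure_singleton T)] with s hs hs'
    rw [uIoc_of_le hT.le] at hs'
    exact (hlim s ⟨hs'.1.le, lt_of_le_of_ne hs'.2 hs⟩).mul_const _

/-! ### Liquidation paths and their Stieltjes measures. -/

theorem abs_sub_le_of_eVariationOn_le {X : ℝ → ℝ} {M : ℝ≥0} (hM : eVariationOn X univ ≤ M)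
    (s t : ℝ) : |X s - X t| ≤ M := by
  have h := (eVariationOn.edist_le X (mem_univ s) (mem_univ t)).trans hM
  rwa [edist_nndist, ENNReal.coe_le_coe, ← NNReal.coe_le_coe, coe_nndist, Real.dist_eq] at h

namespace IsLiquidationPath

variable {T x : ℝ} {X : ℝ → ℝ}

theorem leftLim_eq (hX : IsLiquidationPath T x X) (t : ℝ) : Function.leftLim X t = X t :=
  (hX.left_continuous t).leftLim_eq

theorem stieltjesOf_eq (hX : IsLiquidationPath T x X) :
    stieltjesOf X = hX.finite_variation.vectorMeasure := dif_pos hX.finite_variation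

/-- Left-continuity makes both endpoint limits equal to values of X; this is why the partitions use
cells closed on the left. -/
theorem stieltjesOf_Ico (hX : IsLiquidationPath T x X) {a b : ℝ} (hab : a ≤ b) :
    stieltjesOf X (Ico a b) = X b - X a := by
  rw [hX.stieltjesOf_eq, hX.finite_variation.vectorMeasure_Ico hab, hX.leftLim_eq, hX.leftLim_eq]

theorem stieltjesOf_singleton (hX : IsLiquidationPath T x X) (t : ℝ) :
    stieltjesOf X {t} = pathJump X t := by
  rw [hX.stieltjesOf_eq, hX.finite_variation.vectorMeasure_singleton, hX.leftLim_eq, pathJump]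

theorem tendsto_right (hX : IsLiquidationPath T x X) (t : ℝ) :
    Tendsto X (𝓝[>] t) (𝓝 (X t + pathJump X t)) := by
  have := hX.finite_variation.tendsto_rightLim t
  simpa [pathJump] using this

theorem apply_zero (hX : IsLiquidationPath T x X) : X 0 = x := hX.before 0 le_rfl

/-- X vanishes after T, so its right limit at T is 0: whatever is left is traded at T. -/
theorem pathJump_last (hX : IsLiquidationPath T x X) : pathJump X T = -X T := by
  have h1 : Tendsto X (𝓝[>] T) (𝓝 0) := by
    refine tendsto_const_nhds.congr' ?_
    filter_upwards [self_mem_nhdsWithin] with t ht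
    exact (hX.after t ht).symm
  have := tendsto_nhds_unique (hX.tendsto_right T) h1
  linarith

theorem exists_monotone_sub (hX : IsLiquidationPath T x X) :
    ∃ p q : ℝ → ℝ, Monotone p ∧ Monotone q ∧ X = p - q := by
  obtain ⟨p, q, hp, hq, h⟩ :=
    hX.finite_variation.locallyBoundedVariationOn.exists_monotoneOn_sub_monotoneOn
  exact ⟨p, q, monotoneOn_univ.1 hp, monotoneOn_univ.1 hq, h⟩

theorem measurable (hX : IsLiquidationPath T x X) : Measurable X := by
  obtain ⟨p, q, hp, hq, rfl⟩ := hX.exists_monotone_sub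
  exact hp.measurable.sub hq.measurable

theorem countable_jumps (hX : IsLiquidationPath T x X) : {t | pathJump X t ≠ 0}.Countable := by
  obtain ⟨p, q, hp, hq, h⟩ := hX.exists_monotone_sub
  refine (hp.countable_not_continuousAt.union hq.countable_not_continuousAt).mono fun t ht => ?_
  by_contra hc
  simp only [mem_union, mem_ofPred_eq, not_or, not_not] at hc
  have hcont : ContinuousAt X t := h ▸ hc.1.sub hc.2
  have := tendsto_nhds_unique (hX.tendsto_right t) (hcont.tendsto.mono_left nhdsWithin_le_nhds)
  exact ht (by linarith)

theorem exists_variation_le (hX : IsLiquidationPath T x X) :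
    ∃ M : ℝ≥0, eVariationOn X univ ≤ M :=
  ⟨(eVariationOn X univ).toNNReal, (ENNReal.coe_toNNReal hX.finite_variation).ge⟩

theorem measurableSet_no_jump (hX : IsLiquidationPath T x X) :
    MeasurableSet {t | pathJump X t = 0} := by
  have := hX.countable_jumps.measurableSet.compl
  simpa [compl_ofPred] using this

/-- The integral with respect to the jump part of the path is the sum over the jumps. -/
theorem hasSum_jumps (hX : IsLiquidationPath T x X) {h : ℝ → ℝ}
    (hint : VectorMeasure.IntegrableOn (stieltjesOf X) h (Icc 0 T)) :
    HasSum (fun t : Icc (0 : ℝ) T => h t * pathJump X t)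
      (∫ᵛ t in Icc 0 T \ {t | pathJump X t = 0}, h t ∂•(stieltjesOf X)) := by
  set D : Set ℝ := Icc 0 T \ {t | pathJump X t = 0} with hD
  have hDc : D.Countable := hX.countable_jumps.mono fun t ht => ht.2
  have : Countable D := hDc.to_subtype
  have hU : ⋃ t : D, ({(t : ℝ)} : Set ℝ) = D := by ext; simp
  have h1 := VectorMeasure.hasSum_setIntegral_iUnion (μ := stieltjesOf X) (f := h)
    (B := ContinuousLinearMap.lsmul ℝ ℝ)
    (s := fun t : D => ({(t : ℝ)} : Set ℝ)) (fun t => measurableSet_singleton _)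
    (fun s t hst => by simpa [Subtype.ext_iff] using fun h => hst (Subtype.ext h))
    (by rw [hU]; exact hint.mono measurableSet_Icc sdiff_subset)
  rw [hU] at h1
  simp only [VectorMeasure.integral_singleton, hX.stieltjesOf_singleton,
    ContinuousLinearMap.lsmul_apply, smul_eq_mul] at h1
  -- The sum over the countable set of jump times and the sum over all of [0, T] are compared as
  -- sums over ℝ of indicators; the extra terms contain a zero jump.
  have e1 := (hasSum_subtype_iff_indicator (f := fun t => h t * pathJump X t) (s := D)).1 h1
  refine (hasSum_subtype_iff_indicator (f := fun t => h t * pathJump X t) (s := Icc 0 T)).2 ?_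
  convert e1 using 1
  ext t
  by_cases ht : t ∈ Icc 0 T <;> by_cases hj : pathJump X t = 0 <;> simp [indicator, hD, ht, hj]

theorem setIntegral_eq_add_tsum (hX : IsLiquidationPath T x X) {h : ℝ → ℝ}
    (hint : VectorMeasure.IntegrableOn (stieltjesOf X) h (Icc 0 T)) :
    ∫ᵛ t in Icc 0 T, h t ∂•(stieltjesOf X) =
      (∫ᵛ t in Icc 0 T ∩ {t | pathJump X t = 0}, h t ∂•(stieltjesOf X)) +
        ∑' t : Icc (0 : ℝ) T, h t * pathJump X t := by
  rw [(hX.hasSum_jumps hint).tsum_eq,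
    VectorMeasure.setIntegral_inter_add_sdiff measurableSet_Icc hX.measurableSet_no_jump hint]

theorem setIntegral_Icc_eq (hX : IsLiquidationPath T x X) (hT : 0 ≤ T) {h : ℝ → ℝ}
    (hint : VectorMeasure.IntegrableOn (stieltjesOf X) h (Icc 0 T)) :
    ∫ᵛ t in Icc 0 T, h t ∂•(stieltjesOf X) =
      (∫ᵛ t in Ico 0 T, h t ∂•(stieltjesOf X)) + h T * pathJump X T := by
  rw [← Ico_union_right hT, VectorMeasure.setIntegral_union (by simp) measurableSet_Ico
    (measurableSet_singleton T) (hint.mono measurableSet_Icc Ico_subset_Icc_self)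
    (hint.mono measurableSet_Icc (by simpa using hT)), VectorMeasure.integral_singleton,
    hX.stieltjesOf_singleton]
  simp

end IsLiquidationPath

theorem IsLiquidationPath.measurable_pathJump {T x : ℝ} {X : ℝ → ℝ}
    (hX : IsLiquidationPath T x X) : Measurable (pathJump X) := by
  have h : Measurable (Function.rightLim X) := by
    refine measurable_of_tendsto_metrizable (f := fun (n : ℕ) t => X (t + 1 / ((n : ℝ) + 1)))
      (fun n => hX.measurable.comp (measurable_id.add_const _)) ?_
    refine tendsto_pi_nhds.2 fun t => (hX.finite_variation.tendsto_rightLim t).comp ?_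
    refine tendsto_nhdsWithin_of_tendsto_nhds_of_eventually_within _ ?_
      (Eventually.of_forall fun n => ?_)
    · simpa using (tendsto_one_div_add_atTop_nhds_zero_nat (𝕜 := ℝ)).const_add t
    · have : (0 : ℝ) < 1 / ((n : ℝ) + 1) := by positivity
      simpa using this
  exact h.sub hX.measurable

/-! ### The scaled impact E/λ, and the cost as one integral against dX. -/

namespace OrderBook

variable (B : OrderBook)

/-- The mean of `F⁻¹` over the interval between `a` and `b`. -/
def meanPrice (a b : ℝ) : ℝ := ∫ θ in (0 : ℝ)..1, B.Finv (a + θ * (b - a))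

theorem meanPrice_self (a : ℝ) : B.meanPrice a a = B.Finv a := by simp [meanPrice]

theorem meanPrice_continuous : Continuous fun p : ℝ × ℝ => B.meanPrice p.1 p.2 := by
  unfold meanPrice
  refine intervalIntegral.continuous_parametric_intervalIntegral_of_continuous'
    (f := fun (p : ℝ × ℝ) θ => B.Finv (p.1 + θ * (p.2 - p.1))) ?_ 0 1
  exact B.Finv_continuous.comp (by fun_prop)

/-- A block trade is paid at the mean of F⁻¹ over the range it consumes. As that mean is F⁻¹ itself
for a range of length zero, one integrand serves both jumps and continuous trading. -/
theorem G_sub_G (a b : ℝ) : B.G b - B.G a = B.meanPrice a b * (b - a) := by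
  have h := intervalIntegral.integral_eq_sub_of_hasDerivAt (a := 0) (b := 1)
    (f := fun θ => B.G (a + θ * (b - a))) (f' := fun θ => B.Finv (a + θ * (b - a)) * (b - a))
    (fun θ _ => by
      have h1 : HasDerivAt (fun θ : ℝ => a + θ * (b - a)) (b - a) θ := by
        simpa using ((hasDerivAt_id θ).mul_const (b - a)).const_add a
      exact (B.G_hasDerivAt _).comp θ h1)
    (Continuous.intervalIntegrable ((B.Finv_continuous.comp (by fun_prop)).mul continuous_const)
      _ _)
  rw [intervalIntegral.integral_mul_const] at h
  rw [meanPrice, h]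
  simp

theorem exists_meanPrice_bound (C : ℝ) :
    ∃ K, ∀ a b : ℝ, |a| ≤ C → |b| ≤ C → |B.meanPrice a b| ≤ K := by
  obtain ⟨K, hK⟩ := (isCompact_Icc.prod isCompact_Icc).exists_bound_of_continuousOn
    (s := Icc (-C) C ×ˢ Icc (-C) C) B.meanPrice_continuous.continuousOn
  exact ⟨K, fun a b ha hb => hK (a, b) ⟨abs_le.1 ha, abs_le.1 hb⟩⟩

theorem exists_G_bound (C : ℝ) : ∃ K, ∀ a : ℝ, |a| ≤ C → |B.G a| ≤ K := by
  obtain ⟨K, hK⟩ := isCompact_Icc.exists_bound_of_continuousOn (s := Icc (-C) C)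
    B.G_continuous.continuousOn
  exact ⟨K, fun a ha => hK a (abs_le.1 ha)⟩

/-- The integrated resilience `∫₀ᵗ ρ`. -/
def cumRho (t : ℝ) : ℝ := ∫ u in (0 : ℝ)..t, B.rho u

/-- The volume that the resilience has removed from the book by time `t`. -/
def recovered (X : ℝ → ℝ) (t : ℝ) : ℝ :=
  Real.exp (-B.cumRho t) * ∫ s in (0 : ℝ)..t, B.rho s * Real.exp (B.cumRho s) * (X s - X 0)

theorem rho_continuousOn : ContinuousOn B.rho (Icc 0 B.T) := B.rho_contDiff.continuousOn

theorem lam_continuousOn : ContinuousOn B.lam (Icc 0 B.T) := B.lam_contDiff.continuousOn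

theorem rho_intervalIntegrable {a b : ℝ} (ha : a ∈ Icc 0 B.T) (hb : b ∈ Icc 0 B.T) :
    IntervalIntegrable B.rho volume a b :=
  (B.rho_continuousOn.mono (uIcc_subset_Icc ha hb)).intervalIntegrable

theorem zero_mem : (0 : ℝ) ∈ Icc 0 B.T := ⟨le_rfl, B.T_pos.le⟩

theorem T_mem : B.T ∈ Icc 0 B.T := ⟨B.T_pos.le, le_rfl⟩

theorem cumRho_continuousOn : ContinuousOn B.cumRho (Icc 0 B.T) := by
  have h := intervalIntegral.continuousOn_primitive_interval (μ := volume) (a := 0) (b := B.T)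
    (f := B.rho) (by rw [uIcc_of_le B.T_pos.le]; exact B.rho_continuousOn.integrableOn_Icc)
  rwa [uIcc_of_le B.T_pos.le] at h

variable {B} {x : ℝ} {X : ℝ → ℝ}

/-- Splitting the kernel into a factor in t and a factor in s shows that E differs from X by a
continuous function, so E jumps exactly when and as X does. -/
theorem volumeImpact_eq_sub_recovered {t : ℝ} (ht : t ∈ Icc 0 B.T) (X : ℝ → ℝ) :
    B.volumeImpact X t = X t - X 0 - B.recovered X t := by
  simp only [volumeImpact, recovered]
  rw [← intervalIntegral.integral_const_mul]
  congr 1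
  refine intervalIntegral.integral_congr fun u hu => ?_
  have hu' : u ∈ Icc 0 B.T := uIcc_subset_Icc B.zero_mem ht hu
  have h1 : ∫ v in u..t, B.rho v = B.cumRho t - B.cumRho u :=
    (intervalIntegral.integral_interval_sub_left (B.rho_intervalIntegrable B.zero_mem ht)
      (B.rho_intervalIntegrable B.zero_mem hu')).symm
  simp only [h1]
  rw [show -(B.cumRho t - B.cumRho u) = -B.cumRho t + B.cumRho u by ring, Real.exp_add]
  ring

theorem intervalIntegrable_rho_exp_mul (hX : IsLiquidationPath B.T x X) :
    IntervalIntegrable (fun s => B.rho s * Real.exp (B.cumRho s) * (X s - X 0)) volume 0 B.T := by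
  obtain ⟨p, q, hp, hq, h⟩ := hX.exists_monotone_sub
  have hi : IntervalIntegrable (fun s => X s - X 0) volume 0 B.T := by
    rw [h]
    exact (hp.intervalIntegrable.sub hq.intervalIntegrable).sub intervalIntegrable_const
  refine hi.continuousOn_mul ?_
  rw [uIcc_of_le B.T_pos.le]
  exact B.rho_continuousOn.mul B.cumRho_continuousOn.rexp

theorem recovered_continuousOn (hX : IsLiquidationPath B.T x X) :
    ContinuousOn (B.recovered X) (Icc 0 B.T) := by
  refine B.cumRho_continuousOn.neg.rexp.mul ?_
  have h := intervalIntegral.continuousOn_primitive_interval (μ := volume) (a := 0) (b := B.T)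
    (f := fun s => B.rho s * Real.exp (B.cumRho s) * (X s - X 0)) (by
      rw [uIcc_of_le B.T_pos.le]
      exact (intervalIntegrable_iff_integrableOn_Icc_of_le B.T_pos.le).1
        (intervalIntegrable_rho_exp_mul hX))
  rwa [uIcc_of_le B.T_pos.le] at h

variable (B) in
/-- The scaled volume impact `E / λ`. -/
def scaledImpact (X : ℝ → ℝ) (t : ℝ) : ℝ := B.volumeImpact X t / B.lam t

variable (B) in
/-- The scaled volume impact immediately after the trade at time `t`. -/
def scaledImpactRight (X : ℝ → ℝ) (t : ℝ) : ℝ := (B.volumeImpact X t + pathJump X t) / B.lam t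

theorem lam_mul_scaledImpact {t : ℝ} (ht : t ∈ Icc 0 B.T) (X : ℝ → ℝ) :
    B.lam t * B.scaledImpact X t = B.volumeImpact X t :=
  mul_div_cancel₀ _ (B.lam_pos t ht).ne'

theorem lam_mul_scaledImpactRight {t : ℝ} (ht : t ∈ Icc 0 B.T) (X : ℝ → ℝ) :
    B.lam t * B.scaledImpactRight X t = B.volumeImpact X t + pathJump X t :=
  mul_div_cancel₀ _ (B.lam_pos t ht).ne'

theorem scaledImpact_zero (X : ℝ → ℝ) : B.scaledImpact X 0 = 0 := by
  simp [scaledImpact, volumeImpact]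

theorem scaledImpactRight_of_pathJump_eq_zero {t : ℝ} (h : pathJump X t = 0) :
    B.scaledImpactRight X t = B.scaledImpact X t := by
  simp [scaledImpact, scaledImpactRight, h]

theorem tendsto_scaledImpact_left (hX : IsLiquidationPath B.T x X) {s : ℝ} (hs : s ∈ Icc 0 B.T) :
    Tendsto (B.scaledImpact X) (𝓝[Icc 0 B.T ∩ Iic s] s) (𝓝 (B.scaledImpact X s)) := by
  have h1 : Tendsto X (𝓝[Icc 0 B.T ∩ Iic s] s) (𝓝 (X s)) :=
    (hX.left_continuous s).tendsto.mono_left (nhdsWithin_mono _ inter_subset_right)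
  have h2 := (recovered_continuousOn hX s hs).tendsto.mono_left
    (nhdsWithin_mono s (inter_subset_left (t := Iic s)))
  have h3 := (B.lam_continuousOn s hs).tendsto.mono_left
    (nhdsWithin_mono s (inter_subset_left (t := Iic s)))
  have h4 := ((h1.sub_const (X 0)).sub h2).div h3 (B.lam_pos s hs).ne'
  rw [← volumeImpact_eq_sub_recovered hs] at h4
  refine h4.congr' ?_
  filter_upwards [self_mem_nhdsWithin] with t ht
  simp only [scaledImpact, volumeImpact_eq_sub_recovered ht.1, Pi.div_apply]

theorem tendsto_scaledImpact_right (hX : IsLiquidationPath B.T x X) {s : ℝ}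
    (hs : s ∈ Icc 0 B.T) :
    Tendsto (B.scaledImpact X) (𝓝[Icc 0 B.T ∩ Ioi s] s) (𝓝 (B.scaledImpactRight X s)) := by
  have h1 : Tendsto X (𝓝[Icc 0 B.T ∩ Ioi s] s) (𝓝 (X s + pathJump X s)) :=
    (hX.tendsto_right s).mono_left (nhdsWithin_mono _ inter_subset_right)
  have h2 := (recovered_continuousOn hX s hs).tendsto.mono_left
    (nhdsWithin_mono s (inter_subset_left (t := Ioi s)))
  have h3 := (B.lam_continuousOn s hs).tendsto.mono_left
    (nhdsWithin_mono s (inter_subset_left (t := Ioi s)))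
  have h4 := ((h1.sub_const (X 0)).sub h2).div h3 (B.lam_pos s hs).ne'
  have h5 : X s + pathJump X s - X 0 - B.recovered X s = B.volumeImpact X s + pathJump X s := by
    rw [volumeImpact_eq_sub_recovered hs]
    ring
  rw [h5] at h4
  refine h4.congr' ?_
  filter_upwards [self_mem_nhdsWithin] with t ht
  simp only [scaledImpact, volumeImpact_eq_sub_recovered ht.1, Pi.div_apply]

variable (B) in
/-- The scaled volume impact is controlled by the total variation of the path. -/
theorem exists_scaledImpact_bound : ∃ K, 0 ≤ K ∧ ∀ (X : ℝ → ℝ) (M : ℝ≥0),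
    eVariationOn X univ ≤ M → ∀ t ∈ Icc 0 B.T, |B.scaledImpact X t| ≤ K * M ∧
      |B.scaledImpactRight X t| ≤ K * M := by
  obtain ⟨R, hR⟩ := isCompact_Icc.exists_bound_of_continuousOn B.rho_continuousOn
  obtain ⟨L, hL⟩ := isCompact_Icc.exists_bound_of_continuousOn
    (f := fun t => (B.lam t)⁻¹) (s := Icc 0 B.T)
    (B.lam_continuousOn.inv₀ fun t ht => (B.lam_pos t ht).ne')
  have hR0 : 0 ≤ R := (norm_nonneg _).trans (hR 0 B.zero_mem)
  have hL0 : 0 ≤ L := (norm_nonneg _).trans (hL 0 B.zero_mem)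
  have hT := B.T_pos.le
  -- With R and L bounding ρ and 1/λ, one M comes from X − X 0, R·T·M from the recovery integral,
  -- and a further M from the jump.
  refine ⟨(2 + R * B.T) * L, by positivity, fun X M hM t ht => ?_⟩
  have hE : |B.volumeImpact X t| ≤ (1 + R * B.T) * M := by
    have h2 : ‖∫ s in (0 : ℝ)..t, B.rho s * Real.exp (-∫ u in s..t, B.rho u) * (X s - X 0)‖ ≤
        R * M * |t - 0| := by
      refine intervalIntegral.norm_integral_le_of_norm_le_const fun s hs => ?_
      rw [uIoc_of_le ht.1] at hs
      have hs' : s ∈ Icc 0 B.T := ⟨hs.1.le, hs.2.trans ht.2⟩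
      have he : Real.exp (-∫ u in s..t, B.rho u) ≤ 1 := by
        rw [Real.exp_le_one_iff, neg_nonpos]
        exact intervalIntegral.integral_nonneg hs.2 fun u hu =>
          (B.rho_pos u ⟨hs'.1.trans hu.1, hu.2.trans ht.2⟩).le
      rw [norm_mul, norm_mul, Real.norm_of_nonneg (Real.exp_pos _).le]
      refine mul_le_mul ?_ (abs_sub_le_of_eVariationOn_le hM _ _) (norm_nonneg _) hR0
      exact (mul_le_of_le_one_right (norm_nonneg _) he).trans (hR s hs')
    rw [sub_zero, abs_of_nonneg ht.1, Real.norm_eq_abs] at h2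
    have h3 : R * M * t ≤ R * M * B.T := mul_le_mul_of_nonneg_left ht.2 (by positivity)
    calc |B.volumeImpact X t| ≤ |X t - X 0| + _ := abs_sub _ _
      _ ≤ M + R * M * B.T := add_le_add (abs_sub_le_of_eVariationOn_le hM _ _) (h2.trans h3)
      _ = (1 + R * B.T) * M := by ring
  have hJ : |pathJump X t| ≤ M := by
    have hb : BoundedVariationOn X univ := (hM.trans_lt ENNReal.coe_lt_top).ne
    refine le_of_tendsto ((hb.tendsto_rightLim t).sub_const (X t)).abs
      (Eventually.of_forall fun s => abs_sub_le_of_eVariationOn_le hM _ _)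
  have hLt : |(B.lam t)⁻¹| ≤ L := hL t ht
  constructor
  · rw [scaledImpact, div_eq_mul_inv, abs_mul]
    calc _ ≤ (1 + R * B.T) * M * L := mul_le_mul hE hLt (abs_nonneg _) (by positivity)
      _ ≤ (2 + R * B.T) * M * L := by gcongr; norm_num
      _ = _ := by ring
  · rw [scaledImpactRight, div_eq_mul_inv, abs_mul]
    have : |B.volumeImpact X t + pathJump X t| ≤ (2 + R * B.T) * M :=
      (abs_add_le _ _).trans (by linarith)
    calc _ ≤ (2 + R * B.T) * M * L := mul_le_mul this hLt (abs_nonneg _) (by positivity)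
      _ = _ := by ring

theorem exists_scaledImpact_bound_path (hX : IsLiquidationPath B.T x X) :
    ∃ C, ∀ t ∈ Icc 0 B.T, |B.scaledImpact X t| ≤ C ∧ |B.scaledImpactRight X t| ≤ C := by
  obtain ⟨K, -, hK⟩ := B.exists_scaledImpact_bound
  obtain ⟨M, hM⟩ := hX.exists_variation_le
  exact ⟨K * M, hK X M hM⟩

theorem aestronglyMeasurable_volumeImpact (hX : IsLiquidationPath B.T x X) (m : Measure ℝ) :
    AEStronglyMeasurable (B.volumeImpact X) (m.restrict (Icc 0 B.T)) := by
  have h : AEStronglyMeasurable (fun t => X t - X 0 - B.recovered X t)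
      (m.restrict (Icc 0 B.T)) :=
    ((hX.measurable.sub_const _).aestronglyMeasurable).sub
      ((recovered_continuousOn hX).aestronglyMeasurable measurableSet_Icc)
  refine h.congr ((ae_restrict_iff' measurableSet_Icc).2 (Eventually.of_forall fun t ht => ?_))
  exact (volumeImpact_eq_sub_recovered ht X).symm

theorem aestronglyMeasurable_inv_lam (m : Measure ℝ) :
    AEStronglyMeasurable (fun t => (B.lam t)⁻¹) (m.restrict (Icc 0 B.T)) :=
  (B.lam_continuousOn.inv₀ fun t ht => (B.lam_pos t ht).ne').aestronglyMeasurable measurableSet_Icc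

theorem aestronglyMeasurable_scaledImpact (hX : IsLiquidationPath B.T x X) (m : Measure ℝ) :
    AEStronglyMeasurable (B.scaledImpact X) (m.restrict (Icc 0 B.T)) :=
  (aestronglyMeasurable_volumeImpact hX m).mul (aestronglyMeasurable_inv_lam m)

theorem aestronglyMeasurable_scaledImpactRight (hX : IsLiquidationPath B.T x X) (m : Measure ℝ) :
    AEStronglyMeasurable (B.scaledImpactRight X) (m.restrict (Icc 0 B.T)) :=
  ((aestronglyMeasurable_volumeImpact hX m).add hX.measurable_pathJump.aestronglyMeasurable).mul
    (aestronglyMeasurable_inv_lam m)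

variable (B) in
/-- The mean price paid per share for the trade at time `t`. -/
def tradePrice (X : ℝ → ℝ) (t : ℝ) : ℝ :=
  B.meanPrice (B.scaledImpact X t) (B.scaledImpactRight X t)

theorem tradePrice_of_pathJump_eq_zero {t : ℝ} (h : pathJump X t = 0) :
    B.tradePrice X t = B.Finv (B.volumeImpact X t / B.lam t) := by
  rw [tradePrice, scaledImpactRight_of_pathJump_eq_zero h, meanPrice_self, scaledImpact]

theorem tradePrice_mul_pathJump {t : ℝ} (ht : t ∈ Icc 0 B.T) (X : ℝ → ℝ) :
    B.tradePrice X t * pathJump X t = B.lam t *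
      (B.G ((B.volumeImpact X t + pathJump X t) / B.lam t) -
        B.G (B.volumeImpact X t / B.lam t)) := by
  rw [B.G_sub_G, tradePrice]
  change _ = B.lam t * (B.meanPrice (B.scaledImpact X t) (B.scaledImpactRight X t) *
    (B.scaledImpactRight X t - B.scaledImpact X t))
  linear_combination -B.meanPrice (B.scaledImpact X t) (B.scaledImpactRight X t) *
    (lam_mul_scaledImpactRight ht X - lam_mul_scaledImpact ht X)

theorem integrableOn_tradePrice (hX : IsLiquidationPath B.T x X) :
    VectorMeasure.IntegrableOn (stieltjesOf X) (B.tradePrice X) (Icc 0 B.T) := by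
  obtain ⟨C, hC⟩ := exists_scaledImpact_bound_path hX
  obtain ⟨K, hK⟩ := B.exists_meanPrice_bound C
  refine integrableOn_of_forall_abs_le (C := K) measurableSet_Icc ?_ fun t ht =>
    hK _ _ (hC t ht).1 (hC t ht).2
  exact B.meanPrice_continuous.comp_aestronglyMeasurable
    ((aestronglyMeasurable_scaledImpact hX _).prodMk (aestronglyMeasurable_scaledImpactRight hX _))

/-- The continuous part and the sum over jumps are the restrictions of one integral against dX to
the times without and with a jump. -/
theorem realizedCost_eq (hX : IsLiquidationPath B.T x X) {S : ℝ≥0 → ℝ}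
    (hS : VectorMeasure.IntegrableOn (stieltjesOf X) (fun t => S t.toNNReal) (Icc 0 B.T)) :
    B.realizedCost S X = (∫ᵛ t in Icc 0 B.T, S t.toNNReal ∂•(stieltjesOf X)) +
      ∫ᵛ t in Icc 0 B.T, B.tradePrice X t ∂•(stieltjesOf X) := by
  have hP := integrableOn_tradePrice hX
  rw [← VectorMeasure.integral_fun_add hS hP, hX.setIntegral_eq_add_tsum
    (h := fun t => S t.toNNReal + B.tradePrice X t) (hS.add hP),
    realizedCost]
  congr 1
  · refine VectorMeasure.setIntegral_congr_fun fun t ht => ?_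
    simp only [tradePrice_of_pathJump_eq_zero ht.2]
  · refine tsum_congr fun t => ?_
    rw [add_mul, tradePrice_mul_pathJump t.2]

theorem costV_eq_integral_tradePrice (hX : IsLiquidationPath B.T x X) :
    B.costV X = ∫ᵛ t in Icc 0 B.T, B.tradePrice X t ∂•(stieltjesOf X) := by
  rw [hX.setIntegral_eq_add_tsum (integrableOn_tradePrice hX), costV]
  congr 1
  · refine VectorMeasure.setIntegral_congr_fun fun t ht => ?_
    simp only [tradePrice_of_pathJump_eq_zero ht.2]
  · exact tsum_congr fun t => (tradePrice_mul_pathJump t.2 X).symm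

theorem intervalIntegrable_rho_mul_volumeImpact (hX : IsLiquidationPath B.T x X) :
    IntervalIntegrable (fun s => B.rho s * B.volumeImpact X s) volume 0 B.T := by
  obtain ⟨C, hC⟩ := exists_scaledImpact_bound_path hX
  obtain ⟨L, hL⟩ := isCompact_Icc.exists_bound_of_continuousOn B.lam_continuousOn
  have hE : IntervalIntegrable (B.volumeImpact X) volume 0 B.T := by
    rw [intervalIntegrable_iff_integrableOn_Icc_of_le B.T_pos.le]
    refine Integrable.of_bound (aestronglyMeasurable_volumeImpact hX _) (L * C)
      ((ae_restrict_iff' measurableSet_Icc).2 (Eventually.of_forall fun t ht => ?_))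
    rw [← lam_mul_scaledImpact ht, norm_mul]
    exact mul_le_mul (hL t ht) (hC t ht).1 (norm_nonneg _) ((norm_nonneg _).trans (hL t ht))
  exact hE.continuousOn_mul (by rw [uIcc_of_le B.T_pos.le]; exact B.rho_continuousOn)

/-! ### The chain rule for λG(E/λ) and the reduced form of the cost. -/

theorem derivWithin_lam_continuousOn :
    ContinuousOn (derivWithin B.lam (Icc 0 B.T)) (Icc 0 B.T) :=
  B.lam_contDiff.continuousOn_derivWithin (uniqueDiffOn_Icc B.T_pos) (by norm_num)

theorem intervalIntegrable_derivWithin_lam :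
    IntervalIntegrable (derivWithin B.lam (Icc 0 B.T)) volume 0 B.T :=
  ContinuousOn.intervalIntegrable
    (by rw [uIcc_of_le B.T_pos.le]; exact derivWithin_lam_continuousOn)

theorem integral_derivWithin_eq_sub {g : ℝ → ℝ} (hg : ContDiffOn ℝ 1 g (Icc 0 B.T)) {a b : ℝ}
    (ha : 0 ≤ a) (hab : a ≤ b) (hb : b ≤ B.T) :
    ∫ s in a..b, derivWithin g (Icc 0 B.T) s = g b - g a := by
  have hsub : Icc a b ⊆ Icc 0 B.T := Icc_subset_Icc ha hb
  refine intervalIntegral.integral_eq_sub_of_hasDerivAt_of_le hab (hg.continuousOn.mono hsub)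
    (fun s hs => ?_) ?_
  · have hs' : Icc 0 B.T ∈ 𝓝 s := Icc_mem_nhds (ha.trans_lt hs.1) (hs.2.trans_le hb)
    exact ((hg.differentiableOn one_ne_zero s (mem_of_mem_nhds hs')).hasDerivWithinAt).hasDerivAt hs'
  · refine ContinuousOn.intervalIntegrable ?_
    rw [uIcc_of_le hab]
    exact (hg.continuousOn_derivWithin (uniqueDiffOn_Icc B.T_pos) le_rfl).mono hsub

/-- The chain rule for `λ G(E / λ)` along a path of bounded variation. -/
theorem lam_mul_G_scaledImpact (hX : IsLiquidationPath B.T x X) :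
    B.lam B.T * B.G (B.scaledImpact X B.T) =
      (∫ᵛ t in Ico 0 B.T, B.tradePrice X t ∂•(stieltjesOf X)) -
      (∫ s in (0 : ℝ)..B.T, B.tradePrice X s * (B.rho s * B.volumeImpact X s)) +
      ∫ s in (0 : ℝ)..B.T, (B.G (B.scaledImpactRight X s) -
        B.tradePrice X s * B.scaledImpactRight X s) * derivWithin B.lam (Icc 0 B.T) s := by
  have hT := B.T_pos
  obtain ⟨C, hC⟩ := exists_scaledImpact_bound_path hX
  obtain ⟨K, hK⟩ := B.exists_meanPrice_bound C
  obtain ⟨K', hK'⟩ := B.exists_G_bound C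
  set y := B.scaledImpact X with hy
  set t := gridPt B.T with ht
  set a : ℕ → ℕ → ℝ := fun n i => B.meanPrice (y (t n i)) (y (t n (i + 1))) with ha
  -- Over one cell, with a the mean price, Δ(λG(y)) = λ_i a Δy + Δλ G(y_{i+1}) and λ_i Δy = ΔE − Δλ
  -- y_{i+1}. Hence `b` is the coefficient of Δλ, and ΔE = ΔX − ∫ρE supplies the other two sums.
  set b : ℕ → ℕ → ℝ := fun n i => B.G (y (t n (i + 1))) - a n i * y (t n (i + 1)) with hb
  have haC : ∀ n i, i ≤ n → |a n i| ≤ K := fun n i hi =>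
    hK _ _ (hC _ (gridPt_mem_Icc hT (by omega))).1 (hC _ (gridPt_mem_Icc hT (by omega))).1
  have hbC : ∀ n i, i ≤ n → |b n i| ≤ K' + K * C := fun n i hi => by
    have h1 := (hC (t n (i + 1)) (gridPt_mem_Icc hT (by omega))).1
    refine (abs_sub _ _).trans (add_le_add (hK' _ h1) ?_)
    rw [abs_mul]
    exact mul_le_mul (haC n i hi) h1 (abs_nonneg _) ((abs_nonneg _).trans (haC n i hi))
  -- Left grid points see the impact before the trade at s, right grid points the impact after it,
  -- so the mean prices of the cells converge to `tradePrice` even at jumps.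
  have hyl : ∀ s ∈ Ico 0 B.T, Tendsto (fun n => y (t n (gridIdx B.T n s))) atTop (𝓝 (y s)) := by
    intro s hs
    refine (tendsto_scaledImpact_left hX (Ico_subset_Icc_self hs)).comp ?_
    have h := tendsto_gridPt_left hT hs.1
    rw [tendsto_nhdsWithin_iff] at h ⊢
    refine ⟨h.1, ?_⟩
    filter_upwards [h.2] with n hn
    exact ⟨gridPt_mem_Icc hT ((gridIdx_le hT n hs).trans n.le_succ), hn⟩
  have hyr : ∀ s ∈ Ico 0 B.T, Tendsto (fun n => y (t n (gridIdx B.T n s + 1))) atTop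
      (𝓝 (B.scaledImpactRight X s)) := by
    intro s hs
    refine (tendsto_scaledImpact_right hX (Ico_subset_Icc_self hs)).comp ?_
    have h := tendsto_gridPt_right hT hs.1
    rw [tendsto_nhdsWithin_iff] at h ⊢
    refine ⟨h.1, ?_⟩
    filter_upwards [h.2] with n hn
    exact ⟨gridPt_mem_Icc hT (Nat.succ_le_succ (gridIdx_le hT n hs)), hn⟩
  have hal : ∀ s ∈ Ico 0 B.T, Tendsto (fun n => a n (gridIdx B.T n s)) atTop
      (𝓝 (B.tradePrice X s)) := fun s hs =>
    (B.meanPrice_continuous.tendsto (y s, B.scaledImpactRight X s)).comp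
      ((hyl s hs).prodMk_nhds (hyr s hs))
  have hbl : ∀ s ∈ Ico 0 B.T, Tendsto (fun n => b n (gridIdx B.T n s)) atTop
      (𝓝 (B.G (B.scaledImpactRight X s) - B.tradePrice X s * B.scaledImpactRight X s)) :=
    fun s hs => ((B.G_continuous.tendsto _).comp (hyr s hs)).sub ((hal s hs).mul (hyr s hs))
  have hlim := ((tendsto_sum_mul_signedMeasure hT (stieltjesOf X) haC hal).sub
    (tendsto_sum_mul_integral hT (intervalIntegrable_rho_mul_volumeImpact hX) haC hal)).add
    (tendsto_sum_mul_integral hT intervalIntegrable_derivWithin_lam hbC hbl)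
  refine tendsto_nhds_unique ?_ hlim
  refine tendsto_const_nhds.congr fun n => ?_
  rw [← Finset.sum_sub_distrib, ← Finset.sum_add_distrib]
  -- The sums telescope to the value at T, because the impact starts at 0. The jump at T is not
  -- included, whence the half-open interval.
  have htel := Finset.sum_range_sub (fun i => B.lam (t n i) * B.G (y (t n i))) (n + 1)
  rw [show t n (n + 1) = B.T from gridPt_last n, show t n 0 = 0 from gridPt_zero n,
    show y 0 = 0 from scaledImpact_zero X, B.G_zero, mul_zero, sub_zero] at htel
  rw [← htel]
  refine Finset.sum_congr rfl fun i hi => ?_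
  rw [Finset.mem_range] at hi
  have h0 : t n i ∈ Icc 0 B.T := gridPt_mem_Icc hT hi.le
  have h1 : t n (i + 1) ∈ Icc 0 B.T := gridPt_mem_Icc hT hi
  have h01 : t n i ≤ t n (i + 1) := (gridPt_strictMono hT n).monotone i.le_succ
  have hρ := intervalIntegrable_rho_mul_volumeImpact hX
  have hint : ∫ s in (t n i)..(t n (i + 1)), B.rho s * B.volumeImpact X s =
      (∫ s in (0 : ℝ)..(t n (i + 1)), B.rho s * B.volumeImpact X s) -
        ∫ s in (0 : ℝ)..(t n i), B.rho s * B.volumeImpact X s :=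
    (intervalIntegral.integral_interval_sub_left
      (hρ.mono_set (by rw [uIcc_of_le h1.1, uIcc_of_le hT.le]; exact Icc_subset_Icc_right h1.2))
      (hρ.mono_set (by rw [uIcc_of_le h0.1, uIcc_of_le hT.le]; exact Icc_subset_Icc_right h0.2))).symm
  rw [hX.stieltjesOf_Ico h01, hint,
    integral_derivWithin_eq_sub (B.lam_contDiff.of_le (by norm_num)) h0.1 h01 h1.2]
  have e0 := B.volumeImpact_eq hX.finite_variation h0
  have e1 := B.volumeImpact_eq hX.finite_variation h1
  have l0 := lam_mul_scaledImpact h0 X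
  have l1 := lam_mul_scaledImpact h1 X
  have hG := B.G_sub_G (y (t n i)) (y (t n (i + 1)))
  simp only [hb]
  change _ = a n i * _ at hG
  linear_combination B.lam (t n i) * hG + a n i * (l1 - l0) + a n i * (e1 - e0)

variable (B) in
/-- The running cost, as a function of the scaled volume impact. -/
def runningCost (t y : ℝ) : ℝ :=
  B.lam t * ((B.rho t + B.eta t) * (y * B.Finv y) - B.eta t * B.G y)

/-- The cost functional in terms of the scaled volume impact. -/
theorem costV_eq (hX : IsLiquidationPath B.T x X) :
    B.costV X = B.lam B.T * B.G (B.scaledImpactRight X B.T) +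
      ∫ t in (0 : ℝ)..B.T, B.runningCost t (B.scaledImpact X t) := by
  have hP := integrableOn_tradePrice hX
  have hT := B.T_pos
  obtain ⟨C, hC⟩ := exists_scaledImpact_bound_path hX
  obtain ⟨K, hK⟩ := B.exists_meanPrice_bound C
  obtain ⟨K', hK'⟩ := B.exists_G_bound C
  -- The trade at T costs λ(T)(G(y_{T+}) − G(y_T)); its second term cancels the end value produced
  -- by the chain rule.
  rw [costV_eq_integral_tradePrice hX, hX.setIntegral_Icc_eq hT.le hP,
    tradePrice_mul_pathJump B.T_mem]
  have hchain := lam_mul_G_scaledImpact hX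
  have hmP : AEStronglyMeasurable (B.tradePrice X) (volume.restrict (Icc 0 B.T)) :=
    B.meanPrice_continuous.comp_aestronglyMeasurable
      ((aestronglyMeasurable_scaledImpact hX _).prodMk
        (aestronglyMeasurable_scaledImpactRight hX _))
  have hI : ∀ {g k : ℝ → ℝ} {c : ℝ}, AEStronglyMeasurable g (volume.restrict (Icc 0 B.T)) →
      (∀ s ∈ Icc 0 B.T, |g s| ≤ c) → IntervalIntegrable k volume 0 B.T →
      IntervalIntegrable (fun s => g s * k s) volume 0 B.T := by
    intro g k c hg hc hk
    rw [intervalIntegrable_iff_integrableOn_Icc_of_le hT.le] at hk ⊢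
    exact hk.bdd_mul hg ((ae_restrict_iff' measurableSet_Icc).2 (Eventually.of_forall hc))
  have hI1 := hI hmP (fun s hs => hK _ _ (hC s hs).1 (hC s hs).2)
    (intervalIntegrable_rho_mul_volumeImpact hX)
  have hI2 : IntervalIntegrable (fun s => (B.G (B.scaledImpactRight X s) -
      B.tradePrice X s * B.scaledImpactRight X s) * derivWithin B.lam (Icc 0 B.T) s)
      volume 0 B.T := by
    refine hI (c := K' + K * C) ?_ (fun s hs => ?_) intervalIntegrable_derivWithin_lam
    · exact (B.G_continuous.comp_aestronglyMeasurable
        (aestronglyMeasurable_scaledImpactRight hX _)).sub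
        (hmP.mul (aestronglyMeasurable_scaledImpactRight hX _))
    · have h1 : |B.tradePrice X s| ≤ K := hK _ _ (hC s hs).1 (hC s hs).2
      refine (abs_sub _ _).trans (add_le_add (hK' _ (hC s hs).2) ?_)
      rw [abs_mul]
      exact mul_le_mul h1 (hC s hs).2 (abs_nonneg _) ((abs_nonneg _).trans h1)
  have hrun : ∫ t in (0 : ℝ)..B.T, B.runningCost t (B.scaledImpact X t) =
      (∫ s in (0 : ℝ)..B.T, B.tradePrice X s * (B.rho s * B.volumeImpact X s)) -
      ∫ s in (0 : ℝ)..B.T, (B.G (B.scaledImpactRight X s) -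
        B.tradePrice X s * B.scaledImpactRight X s) * derivWithin B.lam (Icc 0 B.T) s := by
    rw [← intervalIntegral.integral_sub hI1 hI2]
    refine intervalIntegral.integral_congr_ae ?_
    -- Jump times are Lebesgue-null, and elsewhere `tradePrice` is F⁻¹(y) and y_{t+} = y_t.
    filter_upwards [hX.countable_jumps.ae_notMem volume] with s hs hs'
    rw [uIoc_of_le hT.le] at hs'
    have hsI : s ∈ Icc 0 B.T := Ioc_subset_Icc_self hs'
    have hj : pathJump X s = 0 := not_not.1 hs
    rw [tradePrice_of_pathJump_eq_zero hj, scaledImpactRight_of_pathJump_eq_zero hj, runningCost,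
      ← lam_mul_scaledImpact hsI]
    change _ = B.Finv (B.lam s * B.scaledImpact X s / B.lam s) * _ - _
    have hl := (B.lam_pos s hsI).ne'
    rw [mul_div_cancel_left₀ _ hl]
    simp only [eta]
    field_simp
    ring
  rw [hrun]
  change _ + B.lam B.T * (B.G (B.scaledImpactRight X B.T) - B.G (B.scaledImpact X B.T)) = _
  linear_combination -hchain

end OrderBook

/-! ### Strict minima, and paths given by two jumps and a trading rate. -/

/-- A function whose derivative is strictly increasing and vanishes at `a` has a strict minimum
at `a`. -/
theorem lt_of_hasDerivAt_strictMono {g g' : ℝ → ℝ} {a b : ℝ} (hd : ∀ y, HasDerivAt g (g' y) y)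
    (hm : StrictMono g') (ha : g' a = 0) (hab : a ≠ b) : g a < g b := by
  have hc : Continuous g := continuous_iff_continuousAt.2 fun y => (hd y).continuousAt
  rcases hab.lt_or_gt with h | h
  · exact strictMonoOn_of_deriv_pos (convex_Ici a) hc.continuousOn (fun y hy => by
      rw [interior_Ici, mem_Ioi] at hy
      rw [(hd y).deriv, ← ha]
      exact hm hy) (mem_Ici.2 le_rfl) (mem_Ici.2 h.le) h
  · exact strictAntiOn_of_deriv_neg (convex_Iic a) hc.continuousOn (fun y hy => by
      rw [interior_Iic, mem_Iio] at hy
      rw [(hd y).deriv, ← ha]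
      exact hm hy) (mem_Iic.2 h.le) (mem_Iic.2 le_rfl) h

/-- The path that starts at `x`, jumps by `a` at time `0`, moves at the rate `k` during `(0, T)` and
jumps by `b` at time `T`. -/
def stepPath (T x a : ℝ) (k : ℝ → ℝ) (b t : ℝ) : ℝ :=
  if t ≤ 0 then x
  else if t ≤ T then x + a + ∫ s in (0 : ℝ)..t, k s
  else x + a + (∫ s in (0 : ℝ)..T, k s) + b

section StepPath

variable {T x a b x' a' b' : ℝ} {k k' : ℝ → ℝ}

theorem stepPath_add (hT : 0 < T) (hk : IntervalIntegrable k volume 0 T)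
    (hk' : IntervalIntegrable k' volume 0 T) (t : ℝ) :
    stepPath T x a k b t + stepPath T x' a' k' b' t =
      stepPath T (x + x') (a + a') (fun s => k s + k' s) (b + b') t := by
  unfold stepPath
  split_ifs with h0 h1
  · rfl
  · have hsub : uIcc 0 t ⊆ uIcc 0 T := by
      rw [uIcc_of_le (not_le.1 h0).le, uIcc_of_le hT.le]
      exact Icc_subset_Icc_right h1
    rw [intervalIntegral.integral_add (hk.mono_set hsub) (hk'.mono_set hsub)]
    ring
  · rw [intervalIntegral.integral_add hk hk']
    ring

theorem stepPath_neg (t : ℝ) :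
    stepPath T (-x) (-a) (fun s => -k s) (-b) t = -stepPath T x a k b t := by
  unfold stepPath
  split_ifs <;> simp only [intervalIntegral.integral_neg] <;> ring

theorem stepPath_monotone (hT : 0 < T) (hk : IntervalIntegrable k volume 0 T) (ha : 0 ≤ a)
    (hk0 : ∀ s ∈ Ioo 0 T, 0 ≤ k s) (hb : 0 ≤ b) : Monotone (stepPath T x a k b) := by
  have hsub : ∀ {u v}, 0 ≤ u → u ≤ v → v ≤ T → uIcc u v ⊆ uIcc 0 T := fun h0 h1 h2 => by
    rw [uIcc_of_le h1, uIcc_of_le hT.le]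
    exact Icc_subset_Icc h0 h2
  have hle : ∀ {u v}, 0 ≤ u → u ≤ v → v ≤ T → ∫ s in (0 : ℝ)..u, k s ≤ ∫ s in (0 : ℝ)..v, k s := by
    intro u v h0 h1 h2
    rw [← intervalIntegral.integral_add_adjacent_intervals (hk.mono_set (hsub le_rfl h0
      (h1.trans h2))) (hk.mono_set (hsub h0 h1 h2)), le_add_iff_nonneg_right,
      intervalIntegral.integral_of_le h1, integral_Ioc_eq_integral_Ioo]
    exact setIntegral_nonneg measurableSet_Ioo fun s hs =>
      hk0 s ⟨h0.trans_lt hs.1, hs.2.trans_le h2⟩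
  intro s t hst
  unfold stepPath
  have h00 : ∫ s in (0 : ℝ)..0, k s = 0 := intervalIntegral.integral_same
  have h0T := hle le_rfl hT.le le_rfl
  split_ifs with h1 h2 h3 h4 h5 h6 h7
  · exact le_rfl
  · have := hle le_rfl (not_le.1 h2).le h3
    linarith
  · linarith
  · linarith
  · have := hle (not_le.1 h1).le hst h6
    linarith
  · have := hle (not_le.1 h1).le h4 le_rfl
    linarith
  · linarith
  · linarith
  · linarith

theorem eVariationOn_le_of_abs_sub_le {X φ : ℝ → ℝ}
    (h : ∀ s t, s ≤ t → |X t - X s| ≤ φ t - φ s) : eVariationOn X univ ≤ eVariationOn φ univ := by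
  refine iSup_le fun p => ?_
  refine le_trans (Finset.sum_le_sum fun i _ => ?_) (eVariationOn.sum_le (n := p.1) p.2.2.1
    p.2.2.2)
  rw [edist_dist, edist_dist]
  refine ENNReal.ofReal_le_ofReal ?_
  rw [Real.dist_eq, Real.dist_eq]
  exact (h _ _ (p.2.2.1 i.le_succ)).trans (le_abs_self _)

/-- The path φ built from the absolute values of the jumps and of the rate is monotone and dominates
every increment, because φ + X and φ − X are monotone too. -/
theorem stepPath_boundedVariationOn (hT : 0 < T) (hk : IntervalIntegrable k volume 0 T) :
    BoundedVariationOn (stepPath T x a k b) univ := by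
  set φ := stepPath T 0 |a| (fun s => |k s|) |b| with hφ
  have hmono : Monotone φ := stepPath_monotone hT hk.abs (abs_nonneg _) (fun _ _ => abs_nonneg _)
    (abs_nonneg _)
  have h1 : Monotone fun t => stepPath T x a k b t + φ t := by
    simp only [hφ, stepPath_add hT hk hk.abs]
    refine stepPath_monotone hT (hk.add hk.abs) ?_ (fun s _ => ?_) ?_
    · linarith [neg_abs_le a]
    · linarith [neg_abs_le (k s)]
    · linarith [neg_abs_le b]
  have h2 : Monotone fun t => -stepPath T x a k b t + φ t := by
    have hneg : IntervalIntegrable (fun s => -k s) volume 0 T := hk.neg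
    simp only [hφ, ← stepPath_neg, stepPath_add hT hneg hk.abs]
    refine stepPath_monotone hT (hneg.add hk.abs) ?_ (fun s _ => ?_) ?_
    · linarith [le_abs_self a]
    · linarith [le_abs_self (k s)]
    · linarith [le_abs_self b]
  have hbd : ∀ t ∈ univ, |φ t| ≤ φ (T + 1) := by
    intro t _
    -- φ is 0 up to time 0 and constant after T, so its value at T + 1 bounds it.
    have h0 : φ (min t 0) = 0 := by simp [hφ, stepPath]
    have h3 : φ t ≤ φ (T + 1) := by
      rcases le_total t (T + 1) with h | h
      · exact hmono h
      · refine le_of_eq ?_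
        have e1 : ¬ t ≤ 0 := by linarith
        have e2 : ¬ t ≤ T := by linarith
        have e3 : ¬ T + 1 ≤ 0 := by linarith
        have e4 : ¬ T + 1 ≤ T := by linarith
        simp only [hφ, stepPath, e1, e2, e3, e4, if_false]
    rwa [abs_of_nonneg (h0 ▸ hmono (min_le_left t 0))]
  have hv : BoundedVariationOn φ univ := (hmono.monotoneOn univ).boundedVariationOn hbd
  refine ((eVariationOn_le_of_abs_sub_le fun s t hst => ?_).trans_lt hv.lt_top).ne
  have e1 := h1 hst
  have e2 := h2 hst
  simp only at e1 e2
  rw [abs_le]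
  constructor <;> linarith

theorem stepPath_left_continuous (hT : 0 < T) (hk : IntervalIntegrable k volume 0 T) (t : ℝ) :
    ContinuousWithinAt (stepPath T x a k b) (Iic t) t := by
  rcases le_or_gt t 0 with h0 | h0
  · exact (continuousWithinAt_const (b := x)).congr (fun s hs => if_pos (le_trans hs h0))
      (if_pos h0)
  rcases le_or_gt t T with h1 | h1
  · have hc : ContinuousOn (fun s => x + a + ∫ u in (0 : ℝ)..s, k u) (Icc 0 T) := by
      refine continuousOn_const.add ?_
      have h := intervalIntegral.continuousOn_primitive_interval (μ := volume) (a := 0) (b := T)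
        (f := k) (by
          rw [uIcc_of_le hT.le]
          exact (intervalIntegrable_iff_integrableOn_Icc_of_le hT.le).1 hk)
      rwa [uIcc_of_le hT.le] at h
    have hc' : ContinuousWithinAt (fun s => x + a + ∫ u in (0 : ℝ)..s, k u) (Ioc 0 t) t :=
      (hc t ⟨h0.le, h1⟩).mono fun s hs => ⟨hs.1.le, hs.2.trans h1⟩
    have hc'' : ContinuousWithinAt (stepPath T x a k b) (Ioc 0 t) t :=
      hc'.congr (fun s hs => by simp [stepPath, not_le.2 hs.1, hs.2.trans h1])
        (by simp [stepPath, not_le.2 h0, h1])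
    refine hc''.mono_of_mem_nhdsWithin ?_
    exact mem_nhdsWithin.2 ⟨Ioi 0, isOpen_Ioi, h0, fun s hs => ⟨hs.1, hs.2⟩⟩
  · refine ContinuousAt.continuousWithinAt ?_
    refine (continuousAt_const (y := x + a + (∫ s in (0 : ℝ)..T, k s) + b)).congr ?_
    filter_upwards [Ioi_mem_nhds h1] with s hs
    simp [stepPath, not_le.2 (hT.trans hs), not_le.2 (mem_Ioi.1 hs)]

end StepPath

/-! ### The Lagrangian, the optimal path and its uniqueness. -/

namespace OrderBook

variable {B : OrderBook} {x ν : ℝ} {X Y : ℝ → ℝ}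

/-- As yF⁻¹(y) ≥ G(y) and ρ + η ≥ 0, the bracket is at least (ρ+η)G − ηG = ρG ≥ 0. -/
theorem runningCost_nonneg {t : ℝ} (ht : t ∈ Icc 0 B.T) (hR : B.ResilienceDominates) (y : ℝ) :
    0 ≤ B.runningCost t y := by
  have h1 := mul_le_mul_of_nonneg_left (B.G_le_mul_Finv y) (hR t ht)
  have h2 := mul_nonneg (B.rho_pos t ht).le (B.G_nonneg y)
  exact mul_nonneg (B.lam_pos t ht).le (by linarith)

theorem costV_nonneg (hR : B.ResilienceDominates) (hX : IsLiquidationPath B.T x X) :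
    0 ≤ B.costV X := by
  rw [costV_eq hX]
  exact add_nonneg (mul_nonneg (B.lam_pos _ B.T_mem).le (B.G_nonneg _))
    (intervalIntegral.integral_nonneg B.T_pos.le fun t ht => runningCost_nonneg ht hR _)

/-- The terminal term is convex with derivative F⁻¹(y) − ν, which vanishes at y = F(ν). -/
theorem G_sub_mul_le (ν y : ℝ) : B.G (B.F ν) - ν * B.F ν ≤ B.G y - ν * y := by
  have := B.G_gradient_le (B.F ν) y
  rw [B.Finv_F] at this
  linarith

variable (B) in
/-- The running cost with the liquidation constraint added with the multiplier `ν`. -/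
def lagrangian (ν t y : ℝ) : ℝ := B.runningCost t y - ν * (B.rho t * (B.lam t * y))

/-- The y-derivative is λρ(h_{V,t}(y) − ν), which is where h comes from; it increases strictly
through 0 at ζ_t. Convexity of the running cost is thus the monotonicity of h. -/
theorem lagrangian_lt (hB : B.IsUnimodal) (hR : B.ResilienceDominates) (ν : ℝ) {t y : ℝ}
    (ht : t ∈ Icc 0 B.T) (hy : B.zeta ν t ≠ y) :
    B.lagrangian ν t (B.zeta ν t) < B.lagrangian ν t y := by
  have hl := B.lam_pos t ht
  have hr := B.rho_pos t ht
  refine lt_of_hasDerivAt_strictMono (g := B.lagrangian ν t)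
    (g' := fun y => B.lam t * B.rho t * (B.hV t y - ν)) (fun y => ?_) (fun u v huv => ?_) ?_ hy
  · have h1 := ((hasDerivAt_id y).mul (B.Finv_hasDerivAt y)).const_mul (B.rho t + B.eta t)
    have h2 := ((h1.sub ((B.G_hasDerivAt y).const_mul (B.eta t))).const_mul (B.lam t)).sub
      ((((hasDerivAt_id y).const_mul (B.lam t)).const_mul (B.rho t)).const_mul ν)
    refine h2.congr_deriv ?_
    simp only [hV, id]
    field_simp
    ring
  · exact mul_lt_mul_of_pos_left
      (sub_lt_sub_right (hV_strictMono hB (hR.coef_nonneg ht) huv) _) (mul_pos hl hr)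
  · rw [hV_zeta hB (hR.coef_nonneg ht), sub_self, mul_zero]

theorem lagrangian_le (hB : B.IsUnimodal) (hR : B.ResilienceDominates) (ν : ℝ) {t : ℝ} (y : ℝ)
    (ht : t ∈ Icc 0 B.T) : B.lagrangian ν t (B.zeta ν t) ≤ B.lagrangian ν t y := by
  rcases eq_or_ne (B.zeta ν t) y with h | h
  · rw [h]
  · exact (lagrangian_lt hB hR ν ht h).le

theorem eta_continuousOn : ContinuousOn B.eta (Icc 0 B.T) := eta_contDiffOn.continuousOn

theorem integrableOn_runningCost {y : ℝ → ℝ} {C : ℝ}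
    (hm : AEStronglyMeasurable y (volume.restrict (Icc 0 B.T))) (hC : ∀ t ∈ Icc 0 B.T, |y t| ≤ C) :
    IntervalIntegrable (fun t => B.runningCost t (y t)) volume 0 B.T := by
  obtain ⟨K, hK⟩ := isCompact_Icc.exists_bound_of_continuousOn (s := Icc (-C) C)
    (f := fun y => y * B.Finv y) (continuous_id.mul B.Finv_continuous).continuousOn
  obtain ⟨K', hK'⟩ := B.exists_G_bound C
  have hi : ∀ {p q : ℝ → ℝ} {c : ℝ}, ContinuousOn p (Icc 0 B.T) →
      AEStronglyMeasurable q (volume.restrict (Icc 0 B.T)) → (∀ t ∈ Icc 0 B.T, |q t| ≤ c) →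
      IntervalIntegrable (fun t => p t * q t) volume 0 B.T := by
    intro p q c hp hq hc
    have hqi : IntervalIntegrable q volume 0 B.T :=
      (intervalIntegrable_iff_integrableOn_Icc_of_le B.T_pos.le).2
        (Integrable.of_bound hq c ((ae_restrict_iff' measurableSet_Icc).2
          (Eventually.of_forall hc)))
    exact hqi.continuousOn_mul (by rwa [uIcc_of_le B.T_pos.le])
  have h1 := hi (B.rho_continuousOn.add eta_continuousOn)
    ((continuous_id.mul B.Finv_continuous).comp_aestronglyMeasurable hm)
    (fun t ht => hK (y t) (abs_le.1 (hC t ht)))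
  have h2 := hi (eta_continuousOn (B := B)) (B.G_continuous.comp_aestronglyMeasurable hm)
    (fun t ht => hK' (y t) (hC t ht))
  exact (h1.sub h2).continuousOn_mul (by rw [uIcc_of_le B.T_pos.le]; exact B.lam_continuousOn)

theorem intervalIntegrable_runningCost_scaledImpact (hX : IsLiquidationPath B.T x X) :
    IntervalIntegrable (fun t => B.runningCost t (B.scaledImpact X t)) volume 0 B.T := by
  obtain ⟨C, hC⟩ := exists_scaledImpact_bound_path hX
  exact integrableOn_runningCost (aestronglyMeasurable_scaledImpact hX _) fun t ht => (hC t ht).1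

theorem intervalIntegrable_lagrangian_scaledImpact (hX : IsLiquidationPath B.T x X) (ν : ℝ) :
    IntervalIntegrable (fun t => B.lagrangian ν t (B.scaledImpact X t)) volume 0 B.T := by
  refine (intervalIntegrable_runningCost_scaledImpact hX).sub (IntervalIntegrable.const_mul ?_ ν)
  refine (intervalIntegrable_rho_mul_volumeImpact hX).congr fun t ht => ?_
  rw [uIoc_of_le B.T_pos.le] at ht
  simp only [lam_mul_scaledImpact (Ioc_subset_Icc_self ht) X]

theorem intervalIntegrable_lagrangian_zeta (hB : B.IsUnimodal) (hR : B.ResilienceDominates)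
    (ν : ℝ) :
    IntervalIntegrable (fun t => B.lagrangian ν t (B.zeta ν t)) volume 0 B.T := by
  have hz := zeta_continuousOn hB hR ν
  obtain ⟨C, hC⟩ := isCompact_Icc.exists_bound_of_continuousOn hz
  refine (integrableOn_runningCost (hz.aestronglyMeasurable measurableSet_Icc) hC).sub
    (IntervalIntegrable.const_mul (ContinuousOn.intervalIntegrable ?_) ν)
  rw [uIcc_of_le B.T_pos.le]
  exact B.rho_continuousOn.mul (B.lam_continuousOn.mul hz)

/-- The liquidation constraint in terms of the scaled volume impact. -/
theorem liquidation_constraint (hX : IsLiquidationPath B.T x X) :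
    B.lam B.T * B.scaledImpactRight X B.T +
      ∫ t in (0 : ℝ)..B.T, B.rho t * (B.lam t * B.scaledImpact X t) = -x := by
  have h1 := B.volumeImpact_eq hX.finite_variation B.T_mem
  have h2 : ∫ t in (0 : ℝ)..B.T, B.rho t * (B.lam t * B.scaledImpact X t) =
      ∫ t in (0 : ℝ)..B.T, B.rho t * B.volumeImpact X t := by
    refine intervalIntegral.integral_congr fun t ht => ?_
    rw [uIcc_of_le B.T_pos.le] at ht
    simp only [lam_mul_scaledImpact ht]
  rw [lam_mul_scaledImpactRight B.T_mem, h2, hX.pathJump_last]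
  linarith [hX.apply_zero]

/-- Adding ν times the constraint leaves a sum in which the values of the impact at different times
can be minimized independently. -/
theorem costV_add_mul_eq (hX : IsLiquidationPath B.T x X) (ν : ℝ) :
    B.costV X + ν * x =
      B.lam B.T * (B.G (B.scaledImpactRight X B.T) - ν * B.scaledImpactRight X B.T) +
        ∫ t in (0 : ℝ)..B.T, B.lagrangian ν t (B.scaledImpact X t) := by
  have h1 := liquidation_constraint hX
  have h2 : ∫ t in (0 : ℝ)..B.T, B.lagrangian ν t (B.scaledImpact X t) =
      (∫ t in (0 : ℝ)..B.T, B.runningCost t (B.scaledImpact X t)) -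
        ν * ∫ t in (0 : ℝ)..B.T, B.rho t * (B.lam t * B.scaledImpact X t) := by
    rw [← intervalIntegral.integral_const_mul, ← intervalIntegral.integral_sub
      (intervalIntegrable_runningCost_scaledImpact hX) (IntervalIntegrable.const_mul ?_ ν)]
    · rfl
    · refine (intervalIntegrable_rho_mul_volumeImpact hX).congr fun t ht => ?_
      rw [uIoc_of_le B.T_pos.le] at ht
      simp only [lam_mul_scaledImpact (Ioc_subset_Icc_self ht) X]
  rw [costV_eq hX, h2]
  linear_combination ν * h1

variable (B) in
/-- The minimum of the Lagrange functional. -/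
def lagrangeValue (ν : ℝ) : ℝ :=
  B.lam B.T * (B.G (B.F ν) - ν * B.F ν) + ∫ t in (0 : ℝ)..B.T, B.lagrangian ν t (B.zeta ν t)

/-- Weak duality: the terminal term and the integrand are bounded below separately. -/
theorem lagrangeValue_le (hB : B.IsUnimodal) (hR : B.ResilienceDominates)
    (hX : IsLiquidationPath B.T x X) (ν : ℝ) : B.lagrangeValue ν ≤ B.costV X + ν * x := by
  rw [costV_add_mul_eq hX]
  exact add_le_add (mul_le_mul_of_nonneg_left (G_sub_mul_le _ _) (B.lam_pos _ B.T_mem).le)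
    (intervalIntegral.integral_mono_on B.T_pos.le (intervalIntegrable_lagrangian_zeta hB hR ν)
      (intervalIntegrable_lagrangian_scaledImpact hX ν) fun t ht => lagrangian_le hB hR ν _ ht)

/-- Equality in weak duality makes the integral of a nonnegative gap zero; the gap then vanishes
almost everywhere, and the minimum at each time is strict. -/
theorem scaledImpact_ae_eq_of_costV_eq (hB : B.IsUnimodal) (hR : B.ResilienceDominates)
    (hX : IsLiquidationPath B.T x X) (h : B.costV X + ν * x = B.lagrangeValue ν) :
    ∀ᵐ t ∂volume, t ∈ Ioc 0 B.T → B.scaledImpact X t = B.zeta ν t := by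
  rw [costV_add_mul_eq hX, lagrangeValue] at h
  have h1 : B.lam B.T * (B.G (B.F ν) - ν * B.F ν) ≤
      B.lam B.T * (B.G (B.scaledImpactRight X B.T) - ν * B.scaledImpactRight X B.T) :=
    mul_le_mul_of_nonneg_left (G_sub_mul_le _ _) (B.lam_pos _ B.T_mem).le
  have hi1 := intervalIntegrable_lagrangian_zeta hB hR ν
  have hi2 := intervalIntegrable_lagrangian_scaledImpact hX ν
  have h2 := intervalIntegral.integral_mono_on B.T_pos.le hi1 hi2
    fun t ht => lagrangian_le hB hR ν _ ht
  have h3 : ∫ t in (0 : ℝ)..B.T,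
      (B.lagrangian ν t (B.scaledImpact X t) - B.lagrangian ν t (B.zeta ν t)) = 0 := by
    rw [intervalIntegral.integral_sub hi2 hi1]
    linarith
  rw [intervalIntegral.integral_eq_zero_iff_of_le_of_nonneg_ae B.T_pos.le
    ((ae_restrict_iff' measurableSet_Ioc).2 (Eventually.of_forall fun t ht =>
      sub_nonneg.2 (lagrangian_le hB hR ν _ (Ioc_subset_Icc_self ht)))) (hi2.sub hi1),
    EventuallyEq, ae_restrict_iff' measurableSet_Ioc] at h3
  filter_upwards [h3] with t ht hmem
  by_contra hne
  have := lagrangian_lt hB hR ν (Ioc_subset_Icc_self hmem) (Ne.symm hne)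
  have h4 := ht hmem
  simp only [Pi.zero_apply] at h4
  linarith

/-- A liquidation path is determined by its volume impact. -/
theorem eq_of_scaledImpact_ae_eq (hX : IsLiquidationPath B.T x X) (hY : IsLiquidationPath B.T x Y)
    (h : ∀ᵐ t ∂volume, t ∈ Ioc 0 B.T → B.scaledImpact X t = B.scaledImpact Y t) : X = Y := by
  have hE : ∀ᵐ t ∂volume, t ∈ Ioc 0 B.T → B.volumeImpact X t = B.volumeImpact Y t := by
    filter_upwards [h] with t ht hmem
    rw [← lam_mul_scaledImpact (Ioc_subset_Icc_self hmem), ht hmem,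
      lam_mul_scaledImpact (Ioc_subset_Icc_self hmem)]
  have hae : ∀ᵐ t ∂volume, t ∈ Ioc 0 B.T → X t = Y t := by
    filter_upwards [hE] with t ht hmem
    have ht' := Ioc_subset_Icc_self hmem
    -- X is recovered from E as X 0 + E + ∫ρE, and the integral ignores null sets.
    have e1 := B.volumeImpact_eq hX.finite_variation ht'
    have e2 := B.volumeImpact_eq hY.finite_variation ht'
    have e3 : ∫ s in (0 : ℝ)..t, B.rho s * B.volumeImpact X s =
        ∫ s in (0 : ℝ)..t, B.rho s * B.volumeImpact Y s := by
      refine intervalIntegral.integral_congr_ae ?_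
      filter_upwards [hE] with s hs hs'
      rw [uIoc_of_le hmem.1.le] at hs'
      rw [hs ⟨hs'.1, hs'.2.trans hmem.2⟩]
    have e4 := ht hmem
    linarith [hX.apply_zero, hY.apply_zero]
  funext t
  rcases le_or_gt t 0 with h0 | h0
  · rw [hX.before t h0, hY.before t h0]
  rcases le_or_gt t B.T with h1 | h1
  · have hfreq : ∃ᶠ s in 𝓝[<] t, X s = Y s := by
      have hpos : ∃ᶠ s in 𝓝[<] t, s ∈ {s | s ∈ Ioc 0 B.T → X s = Y s} := by
        intro hcon
        rw [eventually_iff, mem_nhdsLT_iff_exists_Ioo_subset] at hcon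
        obtain ⟨l, hl, hsub⟩ := hcon
        have hz : volume (Ioo l t) = 0 := measure_mono_null hsub hae
        rw [Real.volume_Ioo, ENNReal.ofReal_eq_zero, sub_nonpos] at hz
        exact absurd hl (not_lt.2 hz)
      refine (hpos.and_eventually (Ioo_mem_nhdsLT h0)).mono fun s hs => ?_
      exact hs.1 ⟨hs.2.1, hs.2.2.le.trans h1⟩
    have hXl := (hX.left_continuous t).tendsto.mono_left (nhdsWithin_mono t Iio_subset_Iic_self)
    have hYl := (hY.left_continuous t).tendsto.mono_left (nhdsWithin_mono t Iio_subset_Iic_self)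
    exact tendsto_nhds_unique_of_frequently_eq hXl hYl hfreq
  · rw [hX.after t h1, hY.after t h1]

/-- The volume impact of a path that moves by `e` plus the integrated recovery of `e` is `e`. -/
theorem volumeImpact_eq_of_sub_eq {e : ℝ → ℝ} (he : ContinuousOn e (Icc 0 B.T))
    (h : ∀ t ∈ Ioc 0 B.T, X t - X 0 = e t + ∫ s in (0 : ℝ)..t, B.rho s * e s) {t : ℝ}
    (ht : t ∈ Ioc 0 B.T) : B.volumeImpact X t = e t := by
  have ht' : t ∈ Icc 0 B.T := Ioc_subset_Icc_self ht
  have hsub : Icc 0 t ⊆ Icc 0 B.T := Icc_subset_Icc_right ht.2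
  set I : ℝ → ℝ := fun s => ∫ u in (0 : ℝ)..s, B.rho u * e u with hI
  have hρe : ContinuousOn (fun s => B.rho s * e s) (Icc 0 B.T) := B.rho_continuousOn.mul he
  have hprim : ∀ {g : ℝ → ℝ}, ContinuousOn g (Icc 0 B.T) →
      ContinuousOn (fun s => ∫ u in (0 : ℝ)..s, g u) (Icc 0 t) ∧
      ∀ s ∈ Ioo 0 t, HasDerivAt (fun s => ∫ u in (0 : ℝ)..s, g u) (g s) s := by
    intro g hg
    constructor
    · have h := intervalIntegral.continuousOn_primitive_interval (μ := volume) (a := 0) (b := t)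
        (f := g) (by rw [uIcc_of_le ht.1.le]; exact (hg.mono hsub).integrableOn_Icc)
      rwa [uIcc_of_le ht.1.le] at h
    · intro s hs
      refine intervalIntegral.integral_hasDerivAt_right ?_ ?_ ?_
      · exact (hg.mono (by
          rw [uIcc_of_le hs.1.le]
          exact Icc_subset_Icc_right (hs.2.le.trans ht.2))).intervalIntegrable
      · exact (hg.mono (Ioo_subset_Icc_self.trans hsub)).stronglyMeasurableAtFilter isOpen_Ioo s hs
      · exact hg.continuousAt (Icc_mem_nhds hs.1 (hs.2.trans_le ht.2))
  -- With X − X 0 = e + I and I' = ρe, the integrand ρ exp(∫ρ)(e + I) is the derivative of exp(∫ρ)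
  -- I.
  have hFTC : ∫ s in (0 : ℝ)..t, B.rho s * Real.exp (B.cumRho s) * (X s - X 0) =
      Real.exp (B.cumRho t) * I t := by
    have h0 : I 0 = 0 := intervalIntegral.integral_same
    have h1 : ∫ s in (0 : ℝ)..t, B.rho s * Real.exp (B.cumRho s) * (X s - X 0) =
        ∫ s in (0 : ℝ)..t, B.rho s * Real.exp (B.cumRho s) * (e s + I s) := by
      refine intervalIntegral.integral_congr_ae (Eventually.of_forall fun s hs => ?_)
      rw [uIoc_of_le ht.1.le] at hs
      simp only [h s ⟨hs.1, hs.2.trans ht.2⟩, hI]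
    have h2 := intervalIntegral.integral_eq_sub_of_hasDerivAt_of_le ht.1.le
      (f := fun s => Real.exp (B.cumRho s) * I s)
      (f' := fun s => B.rho s * Real.exp (B.cumRho s) * (e s + I s))
      ((hprim B.rho_continuousOn).1.rexp.mul (hprim hρe).1) (fun s hs => by
        refine (((hprim B.rho_continuousOn).2 s hs).exp.mul ((hprim hρe).2 s hs)).congr_deriv ?_
        change Real.exp (B.cumRho s) * B.rho s * I s +
          Real.exp (B.cumRho s) * (B.rho s * e s) = _
        ring) (by
        refine ContinuousOn.intervalIntegrable ?_
        rw [uIcc_of_le ht.1.le]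
        exact ((B.rho_continuousOn.mul B.cumRho_continuousOn.rexp).mono hsub).mul
          ((he.mono hsub).add (hprim hρe).1))
    rw [h1, h2, h0, mul_zero, sub_zero]
  rw [volumeImpact_eq_sub_recovered ht', recovered, hFTC, h t ht, ← mul_assoc, ← Real.exp_add]
  simp [hI]

theorem tradingRate_continuousOn (hB : B.IsUnimodal) (hR : B.ResilienceDominates) (ν : ℝ) :
    ContinuousOn (B.tradingRate ν) (Icc 0 B.T) :=
  B.lam_continuousOn.mul (((zeta_contDiffOn hB hR ν).continuousOn_derivWithin
    (uniqueDiffOn_Icc B.T_pos) le_rfl).add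
      ((B.rho_continuousOn.add eta_continuousOn).mul (zeta_continuousOn hB hR ν)))

theorem tradingRate_intervalIntegrable (hB : B.IsUnimodal) (hR : B.ResilienceDominates) (ν : ℝ) :
    IntervalIntegrable (B.tradingRate ν) volume 0 B.T :=
  ContinuousOn.intervalIntegrable
    (by rw [uIcc_of_le B.T_pos.le]; exact tradingRate_continuousOn hB hR ν)

/-- By the product rule the trading rate is (λζ)' + ρλζ: it moves the impact along λζ and replaces
what the resilience removes. -/
theorem initialTrade_add_integral (hB : B.IsUnimodal) (hR : B.ResilienceDominates) (ν : ℝ)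
    {t : ℝ} (ht : t ∈ Icc 0 B.T) :
    B.initialTrade ν + ∫ s in (0 : ℝ)..t, B.tradingRate ν s =
      B.lam t * B.zeta ν t + ∫ s in (0 : ℝ)..t, B.rho s * (B.lam s * B.zeta ν s) := by
  have hu := uniqueDiffOn_Icc B.T_pos
  have hl : ContDiffOn ℝ 1 B.lam (Icc 0 B.T) := B.lam_contDiff.of_le (by norm_num)
  have hz := zeta_contDiffOn hB hR ν
  have hlz : ContDiffOn ℝ 1 (B.lam * B.zeta ν) (Icc 0 B.T) := hl.mul hz
  have h1 := integral_derivWithin_eq_sub hlz le_rfl ht.1 ht.2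
  have hint : ∀ {g : ℝ → ℝ}, ContinuousOn g (Icc 0 B.T) → IntervalIntegrable g volume 0 t :=
    fun hg => (hg.mono (uIcc_subset_Icc B.zero_mem ht)).intervalIntegrable
  have h2 : ∫ s in (0 : ℝ)..t, B.tradingRate ν s =
      (∫ s in (0 : ℝ)..t, derivWithin (B.lam * B.zeta ν) (Icc 0 B.T) s) +
        ∫ s in (0 : ℝ)..t, B.rho s * (B.lam s * B.zeta ν s) := by
    rw [← intervalIntegral.integral_add (g := fun s => B.rho s * (B.lam s * B.zeta ν s))
      (hint (hlz.continuousOn_derivWithin hu le_rfl))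
      (hint (B.rho_continuousOn.mul (B.lam_continuousOn.mul hz.continuousOn)))]
    refine intervalIntegral.integral_congr fun s hs => ?_
    have hs' : s ∈ Icc 0 B.T := uIcc_subset_Icc B.zero_mem ht hs
    simp only [tradingRate, eta]
    rw [derivWithin_mul (hl.differentiableOn one_ne_zero s hs')
      (hz.differentiableOn one_ne_zero s hs')]
    have := (B.lam_pos s hs').ne'
    field_simp
    ring
  rw [h2, h1, initialTrade]
  simp only [Pi.mul_apply]
  ring

theorem strategyPath_eq_stepPath (x ν : ℝ) : B.strategyPath x ν =
    stepPath B.T x (B.initialTrade ν) (B.tradingRate ν) (B.lastTrade ν) := rfl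

theorem strategyPath_isLiquidationPath (hB : B.IsUnimodal) (hR : B.ResilienceDominates)
    (hν : B.SolvesNu x ν) : IsLiquidationPath B.T x (B.strategyPath x ν) := by
  have hk := tradingRate_intervalIntegrable hB hR ν
  rw [strategyPath_eq_stepPath]
  refine ⟨fun t ht => if_pos ht, fun t ht => ?_, stepPath_left_continuous B.T_pos hk,
    stepPath_boundedVariationOn B.T_pos hk⟩
  -- The last trade raises λ(T)ζ_T to λ(T)F(ν), so the final position is x plus the left-hand side
  -- of the equation for ν, that is 0.
  have h1 := initialTrade_add_integral hB hR ν B.T_mem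
  have h2 : ∫ s in (0 : ℝ)..B.T, B.rho s * (B.lam s * B.zeta ν s) =
      ∫ s in (0 : ℝ)..B.T, B.lam s * B.rho s * B.zeta ν s :=
    intervalIntegral.integral_congr fun s _ => by ring
  rw [SolvesNu] at hν
  simp only [stepPath, not_le.2 (B.T_pos.trans ht), not_le.2 ht, if_false, lastTrade]
  linear_combination h1 + h2 + hν

/-- Time 0 is left out: the impact is still 0 there, before the initial trade. -/
theorem scaledImpact_strategyPath (hB : B.IsUnimodal) (hR : B.ResilienceDominates) {t : ℝ}
    (ht : t ∈ Ioc 0 B.T) (x : ℝ) : B.scaledImpact (B.strategyPath x ν) t = B.zeta ν t := by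
  have h := volumeImpact_eq_of_sub_eq (B := B) (X := B.strategyPath x ν)
    (e := fun t => B.lam t * B.zeta ν t)
    (B.lam_continuousOn.mul (zeta_continuousOn hB hR ν)) (fun t ht => ?_) ht
  · rw [scaledImpact, h, mul_div_cancel_left₀ _ (B.lam_pos t (Ioc_subset_Icc_self ht)).ne']
  · rw [← initialTrade_add_integral hB hR ν (Ioc_subset_Icc_self ht)]
    simp only [strategyPath, not_le.2 ht.1, ht.2, if_false, if_true, le_refl]
    ring

/-- Once the impact before T is known, the liquidation constraint determines its terminal value;
comparison with the equation for ν gives F(ν). -/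
theorem scaledImpactRight_strategyPath (hB : B.IsUnimodal) (hR : B.ResilienceDominates)
    (hν : B.SolvesNu x ν) : B.scaledImpactRight (B.strategyPath x ν) B.T = B.F ν := by
  have h1 := liquidation_constraint (strategyPath_isLiquidationPath hB hR hν)
  have h2 : ∫ t in (0 : ℝ)..B.T, B.rho t * (B.lam t * B.scaledImpact (B.strategyPath x ν) t) =
      ∫ s in (0 : ℝ)..B.T, B.lam s * B.rho s * B.zeta ν s := by
    refine intervalIntegral.integral_congr_ae (Eventually.of_forall fun t ht => ?_)
    rw [uIoc_of_le B.T_pos.le] at ht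
    rw [scaledImpact_strategyPath hB hR ht]
    ring
  rw [SolvesNu] at hν
  have h3 : B.lam B.T * (B.scaledImpactRight (B.strategyPath x ν) B.T - B.F ν) = 0 := by
    linear_combination h1 - h2 - hν
  rcases mul_eq_zero.1 h3 with h | h
  · exact absurd h (B.lam_pos _ B.T_mem).ne'
  · linarith

theorem costV_strategyPath (hB : B.IsUnimodal) (hR : B.ResilienceDominates)
    (hν : B.SolvesNu x ν) : B.costV (B.strategyPath x ν) + ν * x = B.lagrangeValue ν := by
  rw [costV_add_mul_eq (strategyPath_isLiquidationPath hB hR hν),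
    scaledImpactRight_strategyPath hB hR hν, lagrangeValue]
  congr 1
  refine intervalIntegral.integral_congr_ae (Eventually.of_forall fun t ht => ?_)
  rw [uIoc_of_le B.T_pos.le] at ht
  rw [scaledImpact_strategyPath hB hR ht]

theorem costV_strategyPath_le (hB : B.IsUnimodal) (hR : B.ResilienceDominates)
    (hν : B.SolvesNu x ν) (hX : IsLiquidationPath B.T x X) :
    B.costV (B.strategyPath x ν) ≤ B.costV X := by
  have h1 := costV_strategyPath hB hR hν
  have h2 := lagrangeValue_le hB hR hX ν
  linarith

theorem eq_strategyPath_of_costV_eq (hB : B.IsUnimodal) (hR : B.ResilienceDominates)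
    (hν : B.SolvesNu x ν) (hX : IsLiquidationPath B.T x X)
    (h : B.costV X = B.costV (B.strategyPath x ν)) : X = B.strategyPath x ν := by
  have h1 := costV_strategyPath hB hR hν
  refine eq_of_scaledImpact_ae_eq hX (strategyPath_isLiquidationPath hB hR hν) ?_
  filter_upwards [scaledImpact_ae_eq_of_costV_eq hB hR hX (ν := ν) (by linarith)] with t ht hmem
  rw [ht hmem, scaledImpact_strategyPath hB hR hmem]

end OrderBook

/-! ### The equation for the multiplier ν and the signs of the trades. -/

namespace OrderBook

variable {B : OrderBook} {x ν : ℝ}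

variable (B) in
/-- The left-hand side of the equation for `ν`. -/
def nuMap (ν : ℝ) : ℝ :=
  (∫ t in (0 : ℝ)..B.T, B.lam t * B.rho t * B.zeta ν t) + B.lam B.T * B.F ν

theorem lam_mul_rho_pos {t : ℝ} (ht : t ∈ Icc 0 B.T) : 0 < B.lam t * B.rho t :=
  mul_pos (B.lam_pos t ht) (B.rho_pos t ht)

theorem intervalIntegrable_lam_rho_zeta (hB : B.IsUnimodal) (hR : B.ResilienceDominates) (ν : ℝ) :
    IntervalIntegrable (fun t => B.lam t * B.rho t * B.zeta ν t) volume 0 B.T :=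
  ContinuousOn.intervalIntegrable (by
    rw [uIcc_of_le B.T_pos.le]
    exact (B.lam_continuousOn.mul B.rho_continuousOn).mul (zeta_continuousOn hB hR ν))

theorem nuMap_strictMono (hB : B.IsUnimodal) (hR : B.ResilienceDominates) :
    StrictMono B.nuMap := fun ν μ h => by
  refine add_lt_add_of_le_of_lt (intervalIntegral.integral_mono_on B.T_pos.le
    (intervalIntegrable_lam_rho_zeta hB hR ν) (intervalIntegrable_lam_rho_zeta hB hR μ)
    fun t ht => ?_) (mul_lt_mul_of_pos_left (B.F_strictMono h) (B.lam_pos _ B.T_mem))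
  exact mul_le_mul_of_nonneg_left (zeta_strictMono hB (hR.coef_nonneg ht) h).le
    (lam_mul_rho_pos ht).le

theorem nuMap_zero (hB : B.IsUnimodal) (hR : B.ResilienceDominates) : B.nuMap 0 = 0 := by
  have : ∫ t in (0 : ℝ)..B.T, B.lam t * B.rho t * B.zeta 0 t = ∫ t in (0 : ℝ)..B.T, (0 : ℝ) := by
    refine intervalIntegral.integral_congr fun t ht => ?_
    rw [uIcc_of_le B.T_pos.le] at ht
    simp only [zeta_zero hB (hR.coef_nonneg ht), mul_zero]
  simp [nuMap, this, B.F_zero]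

theorem nuMap_continuous (hB : B.IsUnimodal) (hR : B.ResilienceDominates) :
    Continuous B.nuMap := by
  refine Continuous.add ?_ (continuous_const.mul B.F_continuous)
  refine continuous_iff_continuousAt.2 fun ν₀ => ?_
  -- ζ is monotone in ν, so on [−N, N] it is dominated by its values at the two ends; ν₀ is interior
  -- to this interval.
  set N := |ν₀| + 1 with hN
  refine intervalIntegral.continuousAt_of_dominated_interval
    (bound := fun t => B.lam t * B.rho t * (|B.zeta N t| + |B.zeta (-N) t|)) ?_ ?_ ?_ ?_
  · exact Eventually.of_forall fun ν =>
      (intervalIntegrable_lam_rho_zeta hB hR ν).def'.aestronglyMeasurable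
  · have hnear : ∀ᶠ ν in 𝓝 ν₀, ν ∈ Icc (-N) N := by
      refine Icc_mem_nhds ?_ ?_
      · linarith [neg_abs_le ν₀]
      · linarith [le_abs_self ν₀]
    filter_upwards [hnear] with ν hν
    refine Eventually.of_forall fun t ht => ?_
    rw [uIoc_of_le B.T_pos.le] at ht
    have ht' := Ioc_subset_Icc_self ht
    have hm := (zeta_strictMono hB (hR.coef_nonneg ht')).monotone
    have h1 := hm hν.1
    have h2 := hm hν.2
    simp only at h1 h2
    rw [norm_mul, Real.norm_of_nonneg (lam_mul_rho_pos ht').le, Real.norm_eq_abs]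
    refine mul_le_mul_of_nonneg_left (abs_le.2 ⟨?_, ?_⟩) (lam_mul_rho_pos ht').le
    · linarith [neg_abs_le (B.zeta (-N) t), abs_nonneg (B.zeta N t)]
    · linarith [le_abs_self (B.zeta N t), abs_nonneg (B.zeta (-N) t)]
  · refine ContinuousOn.intervalIntegrable ?_
    rw [uIcc_of_le B.T_pos.le]
    exact (B.lam_continuousOn.mul B.rho_continuousOn).mul
      ((zeta_continuousOn hB hR N).abs.add (zeta_continuousOn hB hR (-N)).abs)
  · refine Eventually.of_forall fun t ht => ?_
    rw [uIoc_of_le B.T_pos.le] at ht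
    exact ((zeta_continuous_left hB
      (hR.coef_nonneg (Ioc_subset_Icc_self ht))).const_mul _).continuousAt

/-- The integral has the sign of ν, so `nuMap` lies beyond λ(T)F(ν) on either side, and F tends to
±∞. -/
theorem nuMap_surjective (hB : B.IsUnimodal) (hR : B.ResilienceDominates) :
    Function.Surjective B.nuMap := by
  have hl := B.lam_pos _ B.T_mem
  have hz : ∀ {t}, t ∈ Icc 0 B.T → Monotone fun ν => B.zeta ν t := fun ht =>
    (zeta_strictMono hB (hR.coef_nonneg ht)).monotone
  refine (nuMap_continuous hB hR).surjective ?_ ?_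
  · refine tendsto_atTop_mono' _ ?_ (B.f_atTop.const_mul_atTop hl)
    filter_upwards [eventually_ge_atTop 0] with ν hν
    refine le_add_of_nonneg_left (intervalIntegral.integral_nonneg B.T_pos.le fun t ht => ?_)
    exact mul_nonneg (lam_mul_rho_pos ht).le (zeta_zero hB (hR.coef_nonneg ht) ▸ hz ht hν)
  · refine tendsto_atBot_mono' _ ?_ (B.f_atBot.const_mul_atBot hl)
    filter_upwards [eventually_le_atBot 0] with ν hν
    refine add_le_of_nonpos_left ?_
    rw [← neg_nonneg, ← intervalIntegral.integral_neg]
    refine intervalIntegral.integral_nonneg B.T_pos.le fun t ht => neg_nonneg.2 ?_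
    exact mul_nonpos_of_nonneg_of_nonpos (lam_mul_rho_pos ht).le
      (zeta_zero hB (hR.coef_nonneg ht) ▸ hz ht hν)

theorem existsUnique_solvesNu (hB : B.IsUnimodal) (hR : B.ResilienceDominates) (x : ℝ) :
    ∃ ν, B.SolvesNu x ν ∧ ∀ ν', B.SolvesNu x ν' → ν' = ν := by
  obtain ⟨ν, hν⟩ := nuMap_surjective hB hR (-x)
  exact ⟨ν, hν, fun ν' h => (nuMap_strictMono hB hR).injective (Eq.trans h hν.symm)⟩

theorem sign_nu (hB : B.IsUnimodal) (hR : B.ResilienceDominates) (hν : B.SolvesNu x ν) :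
    SignType.sign ν = SignType.sign (-x) := by
  have h : B.nuMap ν = -x := hν
  have hm := nuMap_strictMono hB hR
  rw [← h]
  rcases lt_trichotomy ν 0 with h0 | rfl | h0
  · have := hm h0
    rw [nuMap_zero hB hR] at this
    rw [sign_neg h0, sign_neg this]
  · rw [nuMap_zero hB hR]
  · have := hm h0
    rw [nuMap_zero hB hR] at this
    rw [sign_pos h0, sign_pos this]

theorem nu_nonneg_iff (hB : B.IsUnimodal) (hR : B.ResilienceDominates) (hν : B.SolvesNu x ν) :
    (0 ≤ ν ↔ 0 ≤ -x) ∧ (ν ≤ 0 ↔ -x ≤ 0) := by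
  have h := sign_nu hB hR hν
  rw [← sign_nonneg_iff, h, sign_nonneg_iff, ← sign_nonpos_iff, h, sign_nonpos_iff]
  exact ⟨Iff.rfl, Iff.rfl⟩

theorem sign_initialTrade (hB : B.IsUnimodal) (hR : B.ResilienceDominates)
    (hν : B.SolvesNu x ν) : SignType.sign (B.initialTrade ν) = SignType.sign (-x) := by
  rw [← sign_nu hB hR hν]
  have hc := hR.coef_nonneg B.zero_mem
  have hl := B.lam_pos 0 B.zero_mem
  have hm := zeta_strictMono hB hc
  rw [initialTrade]
  rcases lt_trichotomy ν 0 with h0 | rfl | h0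
  · have h1 := hm h0
    simp only [zeta_zero hB hc] at h1
    rw [sign_neg h0, sign_neg (mul_neg_of_pos_of_neg hl h1)]
  · rw [zeta_zero hB hc, mul_zero]
  · have h1 := hm h0
    simp only [zeta_zero hB hc] at h1
    rw [sign_pos h0, sign_pos (mul_pos hl h1)]

theorem sameSignWeak_lastTrade (hB : B.IsUnimodal) (hR : B.ResilienceDominates)
    (hν : B.SolvesNu x ν) : SameSignWeak (B.lastTrade ν) (-x) := by
  obtain ⟨h1, h2⟩ := nu_nonneg_iff hB hR hν
  obtain ⟨h3, h4⟩ := zeta_le_F_and_F_le_zeta hB (hR.coef_nonneg B.T_mem) (ν := ν)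
  have hl := (B.lam_pos _ B.T_mem).le
  exact ⟨fun h => mul_nonneg hl (sub_nonneg.2 (h3 (h1.2 h))),
    fun h => mul_nonpos_of_nonneg_of_nonpos hl (sub_nonpos.2 (h4 (h2.2 h)))⟩

/-- As ρ/(2ρ+η) = 1/(1+c), the block condition reads −c'/(1+c)² + (ρ+η)/(1+c) ≥ 0; multiply by
(1+c)². -/
theorem derivWithin_coef_le (hR : B.ResilienceDominates) (hb : B.BlockCondition) {t : ℝ}
    (ht : t ∈ Icc 0 B.T) :
    derivWithin B.coef (Icc 0 B.T) t ≤ (B.rho t + B.eta t) * (1 + B.coef t) := by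
  have hu := uniqueDiffOn_Icc B.T_pos t ht
  have hρ := B.rho_pos t ht
  have hc := hR.coef_nonneg ht
  have hden : ∀ s ∈ Icc 0 B.T, B.rho s / (2 * B.rho s + B.eta s) = (1 + B.coef s)⁻¹ := by
    intro s hs
    have := (B.rho_pos s hs).ne'
    have e : 1 + B.coef s = (2 * B.rho s + B.eta s) / B.rho s := by
      rw [coef]
      field_simp
      ring
    rw [e, inv_div]
  have hd : HasDerivWithinAt B.coef (derivWithin B.coef (Icc 0 B.T) t) (Icc 0 B.T) t :=
    ((coef_contDiffOn (B := B)).differentiableOn one_ne_zero t ht).hasDerivWithinAt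
  have hpos : 0 < 1 + B.coef t := by linarith
  have hd' := ((hd.const_add 1).inv hpos.ne').congr_of_mem hden ht
  have h := (hb t ht).2
  rw [hd'.derivWithin hu] at h
  have h1 : (B.rho t + B.eta t) / (2 * B.rho t + B.eta t) =
      (B.rho t + B.eta t) / (B.rho t * (1 + B.coef t)) := by
    congr 1
    rw [coef]
    field_simp
    ring
  have h2 : B.rho t * ((B.rho t + B.eta t) / (B.rho t * (1 + B.coef t))) =
      (B.rho t + B.eta t) * (1 + B.coef t) / (1 + B.coef t) ^ 2 := by
    field_simp
  rw [h1, h2, ← add_div, div_nonneg_iff] at h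
  rcases h with h | h
  · linarith [h.1]
  · exact absurd h.2 (not_le.2 (by positivity))

theorem tradingRate_eq (hB : B.IsUnimodal) (hR : B.ResilienceDominates) (ν : ℝ) {t : ℝ}
    (ht : t ∈ Icc 0 B.T) : B.tradingRate ν t = B.lam t * B.zeta ν t *
      (((B.rho t + B.eta t) * (1 + B.coef t * B.phi' (B.level ν t)) -
        derivWithin B.coef (Icc 0 B.T) t) / (1 + B.coef t * B.phi' (B.level ν t))) := by
  have h := (one_pos.trans_le (one_le_one_add_mul_phi' hB (hR.coef_nonneg ht) (B.level ν t))).ne'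
  rw [tradingRate, (zeta_hasDerivWithinAt hB hR ν ht).derivWithin
    (uniqueDiffOn_Icc B.T_pos t ht)]
  field_simp
  ring

/-- The rate is ζ times a factor whose sign is that of (ρ+η)(1 + cφ') − c'. As φ' ≥ 1, the
block-shaped book φ' = 1 is the worst case, and there the block condition suffices. -/
theorem sameSignWeak_tradingRate (hB : B.IsUnimodal) (hR : B.ResilienceDominates)
    (hν : B.SolvesNu x ν) (hb : B.BlockCondition) {t : ℝ} (ht : t ∈ Icc 0 B.T) :
    SameSignWeak (B.tradingRate ν t) (-x) := by
  have hc := hR.coef_nonneg ht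
  have hl := (B.lam_pos t ht).le
  have hφ := B.one_le_phi' hB.left hB.right (B.level ν t)
  have hfac : 0 ≤ ((B.rho t + B.eta t) * (1 + B.coef t * B.phi' (B.level ν t)) -
      derivWithin B.coef (Icc 0 B.T) t) / (1 + B.coef t * B.phi' (B.level ν t)) := by
    refine div_nonneg ?_ (zero_le_one.trans (one_le_one_add_mul_phi' hB hc _))
    have h1 := derivWithin_coef_le hR hb ht
    have h2 : (B.rho t + B.eta t) * (1 + B.coef t) ≤
        (B.rho t + B.eta t) * (1 + B.coef t * B.phi' (B.level ν t)) :=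
      mul_le_mul_of_nonneg_left (by linarith [le_mul_of_one_le_right hc hφ]) (hR t ht)
    linarith
  obtain ⟨h1, h2⟩ := nu_nonneg_iff hB hR hν
  have hz := (zeta_strictMono hB hc).monotone
  rw [tradingRate_eq hB hR ν ht]
  constructor <;> intro h
  · exact mul_nonneg (mul_nonneg hl (zeta_zero hB hc ▸ hz (h1.2 h))) hfac
  · exact mul_nonpos_of_nonpos_of_nonneg
      (mul_nonpos_of_nonneg_of_nonpos hl (zeta_zero hB hc ▸ hz (h2.2 h))) hfac

theorem strategyPath_antitone_or_monotone (hB : B.IsUnimodal) (hR : B.ResilienceDominates)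
    (hν : B.SolvesNu x ν) (hb : B.BlockCondition) :
    Antitone (B.strategyPath x ν) ∨ Monotone (B.strategyPath x ν) := by
  have hk := tradingRate_intervalIntegrable hB hR ν
  have hs := sign_initialTrade hB hR hν
  have hlast := sameSignWeak_lastTrade hB hR hν
  rw [strategyPath_eq_stepPath]
  rcases le_total 0 (-x) with h | h
  · right
    exact stepPath_monotone B.T_pos hk (by rwa [← sign_nonneg_iff, hs, sign_nonneg_iff])
      (fun t ht => (sameSignWeak_tradingRate hB hR hν hb (Ioo_subset_Icc_self ht)).1 h) (hlast.1 h)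
  · left
    have hneg : IntervalIntegrable (fun s => -B.tradingRate ν s) volume 0 B.T := hk.neg
    -- A sell program is the negative of a buy program started from −x.
    have hm := stepPath_monotone (x := -x) B.T_pos hneg (a := -B.initialTrade ν)
      (b := -B.lastTrade ν)
      (neg_nonneg.2 (by rwa [← sign_nonpos_iff, hs, sign_nonpos_iff]))
      (fun t ht => neg_nonneg.2
        ((sameSignWeak_tradingRate hB hR hν hb (Ioo_subset_Icc_self ht)).2 h))
      (neg_nonneg.2 (hlast.2 h))
    intro s t hst
    have := hm hst
    rw [stepPath_neg, stepPath_neg] at this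
    linarith

end OrderBook

/-! ### Measurability of one-sided continuous functions and processes. -/

section Measurability

theorem tendsto_floor_mul_div (t : ℝ) :
    Tendsto (fun n : ℕ => (⌊t * ((n : ℝ) + 1)⌋ : ℝ) / ((n : ℝ) + 1)) atTop (𝓝[≤] t) := by
  have hle : ∀ n : ℕ, (⌊t * ((n : ℝ) + 1)⌋ : ℝ) / ((n : ℝ) + 1) ≤ t := fun n => by
    rw [div_le_iff₀ (by positivity)]
    exact Int.floor_le _
  refine tendsto_nhdsWithin_iff.2 ⟨?_, Eventually.of_forall hle⟩
  refine tendsto_of_tendsto_of_tendsto_of_le_of_le (g := fun n : ℕ => t - 1 / ((n : ℝ) + 1))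
    ?_ tendsto_const_nhds (fun n => ?_) hle
  · simpa using tendsto_const_nhds.sub (tendsto_one_div_add_atTop_nhds_zero_nat (𝕜 := ℝ))
  · have h0 : (0 : ℝ) < (n : ℝ) + 1 := by positivity
    rw [le_div_iff₀ h0, sub_mul, one_div, inv_mul_cancel₀ h0.ne']
    exact (Int.sub_one_lt_floor _).le

/-- A left-continuous process is jointly measurable. -/
theorem measurable_uncurry_of_leftContinuous {Ω : Type*} [MeasurableSpace Ω] {X : ℝ → Ω → ℝ}
    (hX : ∀ t, Measurable (X t))
    (hc : ∀ ω t, ContinuousWithinAt (fun s => X s ω) (Iic t) t) :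
    Measurable fun p : ℝ × Ω => X p.1 p.2 := by
  refine measurable_of_tendsto_metrizable (f := fun (n : ℕ) (p : ℝ × Ω) =>
    X ((⌊p.1 * ((n : ℝ) + 1)⌋ : ℝ) / ((n : ℝ) + 1)) p.2) (fun n => ?_) ?_
  -- The approximation sees the time only through an integer, so joint measurability reduces to
  -- countably many fixed times.
  · have h1 : Measurable fun q : Ω × ℤ => X ((q.2 : ℝ) / ((n : ℝ) + 1)) q.1 :=
      measurable_from_prod_countable_left fun k => hX ((k : ℝ) / ((n : ℝ) + 1))
    exact h1.comp (measurable_snd.prodMk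
      (Int.measurable_floor.comp (measurable_fst.mul_const ((n : ℝ) + 1))))
  · exact tendsto_pi_nhds.2 fun p => (hc p.2 p.1).tendsto.comp (tendsto_floor_mul_div p.1)

theorem measurable_of_leftContinuous {g : ℝ → ℝ}
    (hc : ∀ t, ContinuousWithinAt g (Iic t) t) : Measurable g :=
  (measurable_uncurry_of_leftContinuous (Ω := Unit) (X := fun t _ => g t)
    (fun _ => measurable_const) fun _ => hc).comp (measurable_id.prodMk (measurable_const (a := ())))

theorem measurable_of_rightContinuous {g : ℝ → ℝ}
    (hc : ∀ t, ContinuousWithinAt g (Ici t) t) : Measurable g := by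
  have h : Measurable fun t => g (-t) := measurable_of_leftContinuous fun t =>
    (hc (-t)).comp continuous_neg.continuousWithinAt fun s (hs : s ≤ t) => neg_le_neg hs
  simpa [Function.comp_def] using h.comp measurable_neg

theorem continuousWithinAt_comp_toNNReal {s : ℝ≥0 → ℝ}
    (hs : ∀ t, ContinuousWithinAt s (Ici t) t) (t : ℝ) :
    ContinuousWithinAt (fun r : ℝ => s r.toNNReal) (Ici t) t :=
  (hs t.toNNReal).comp continuous_real_toNNReal.continuousWithinAt
    fun r (hr : t ≤ r) => Real.toNNReal_le_toNNReal hr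

end Measurability

/-! ### Almost sure boundedness of a right-continuous martingale on [0, T]. -/

section Martingale

variable {Ω : Type*} [mΩ : MeasurableSpace Ω] {P : Measure Ω}
  {ℱ : Filtration ℝ≥0 mΩ} {S : ℝ≥0 → Ω → ℝ} {T : ℝ}

/-- The trading times of the `n`-th partition, stopped at `T`. -/
def tradeTime (T : ℝ) (n i : ℕ) : ℝ≥0 := (min (gridPt T n i) T).toNNReal

theorem tradeTime_mono (hT : 0 < T) (n : ℕ) : Monotone (tradeTime T n) := fun _ _ h =>
  Real.toNNReal_le_toNNReal (min_le_min_right _ ((gridPt_strictMono hT n).monotone h))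

theorem tradeTime_of_le (hT : 0 < T) {n i : ℕ} (hi : i ≤ n + 1) :
    tradeTime T n i = (gridPt T n i).toNNReal := by
  rw [tradeTime, min_eq_left (gridPt_mem_Icc hT hi).2]

theorem tradeTime_of_ge (hT : 0 < T) {n i : ℕ} (hi : n + 1 ≤ i) :
    tradeTime T n i = T.toNNReal := by
  rw [tradeTime, min_eq_right]
  exact (gridPt_last (T := T) n).symm.le.trans ((gridPt_strictMono hT n).monotone hi)

theorem tradeTime_le (n i : ℕ) : tradeTime T n i ≤ T.toNNReal :=
  Real.toNNReal_le_toNNReal (min_le_right _ _)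

theorem submartingale_abs_tradeTime (hS : Martingale S ℱ P) (hT : 0 < T) (n : ℕ) :
    Submartingale (fun i ω => |S (tradeTime T n i) ω|)
      ⟨fun i => ℱ (tradeTime T n i), fun _ _ h => ℱ.mono (tradeTime_mono hT n h),
        fun _ => ℱ.le _⟩ P := by
  have h : Submartingale (fun t => S t ⊔ -S t) ℱ P := hS.submartingale.sup hS.neg.submartingale
  exact ⟨fun i => h.1 _, fun i j hij => h.2.1 _ _ (tradeTime_mono hT n hij),
    fun i => h.2.2 _⟩

/-- Doob's maximal inequality for the submartingale |S| along the grid; the bound E|S_T| does not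
depend on the grid. -/
theorem measure_exists_tradeTime_le [IsProbabilityMeasure P] (hS : Martingale S ℱ P) (hT : 0 < T) (n : ℕ) (K : ℝ≥0) :
    K * P {ω | ∃ i ≤ n + 1, (K : ℝ) ≤ |S (tradeTime T n i) ω|} ≤
      ENNReal.ofReal (∫ ω, |S T.toNNReal ω| ∂P) := by
  have h := maximal_ineq (submartingale_abs_tradeTime hS hT n)
    (fun _ _ => abs_nonneg _) (ε := K) (n + 1)
  have hset : {ω | (K : ℝ) ≤ (Finset.range (n + 1 + 1)).sup' Finset.nonempty_range_add_one
      fun k => |S (tradeTime T n k) ω|} = {ω | ∃ i ≤ n + 1, (K : ℝ) ≤ |S (tradeTime T n i) ω|} := by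
    ext ω
    simp [Finset.le_sup'_iff]
  rw [hset] at h
  refine h.trans (ENNReal.ofReal_le_ofReal ?_)
  rw [tradeTime_of_ge hT le_rfl]
  exact setIntegral_le_integral (hS.integrable _).abs (Eventually.of_forall fun _ => abs_nonneg _)

theorem measure_exists_lt_le [IsProbabilityMeasure P] (hS : Martingale S ℱ P)
    (hr : ∀ ω t, ContinuousWithinAt (fun s => S s ω) (Ici t) t) (hT : 0 < T) (K : ℝ≥0) :
    K * P {ω | ∃ t ∈ Icc 0 T, (K : ℝ) < |S t.toNNReal ω|} ≤
      ENNReal.ofReal (∫ ω, |S T.toNNReal ω| ∂P) := by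
  set A : ℕ → Set Ω := fun n => {ω | ∃ i ≤ n + 1, (K : ℝ) ≤ |S (tradeTime T n i) ω|} with hA
  -- If |S_t| > K, right-continuity makes |S| exceed K at the next grid point for all fine grids; at
  -- t = T the grid itself contains t. The event therefore lies in the lower limit of the grid
  -- events, an increasing union.
  have hsub : {ω | ∃ t ∈ Icc 0 T, (K : ℝ) < |S t.toNNReal ω|} ⊆ ⋃ m, ⋂ n ≥ m, A n := by
    rintro ω ⟨t, ht, hK⟩
    rcases ht.2.lt_or_eq with htT | rfl
    · have h1 : Tendsto (fun n => |S (gridPt T n (gridIdx T n t + 1)).toNNReal ω|) atTop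
          (𝓝 |S t.toNNReal ω|) :=
        ((continuousWithinAt_comp_toNNReal (hr ω) t).tendsto.comp
          ((tendsto_gridPt_right hT ht.1).mono_right (nhdsWithin_mono _ Ioi_subset_Ici_self))).abs
      obtain ⟨m, hm⟩ := eventually_atTop.1 (h1.eventually (lt_mem_nhds hK))
      refine mem_iUnion.2 ⟨m, mem_iInter₂.2 fun n hn => ⟨gridIdx T n t + 1, ?_, ?_⟩⟩
      · exact Nat.succ_le_succ (gridIdx_le hT n ⟨ht.1, htT⟩)
      · rw [tradeTime_of_le hT (Nat.succ_le_succ (gridIdx_le hT n ⟨ht.1, htT⟩))]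
        exact (hm n hn).le
    · exact mem_iUnion.2 ⟨0, mem_iInter₂.2 fun n _ =>
        ⟨n + 1, le_rfl, by rw [tradeTime_of_ge hT le_rfl]; exact hK.le⟩⟩
  refine (mul_le_mul_right (measure_mono hsub) _).trans ?_
  have hmono : Monotone fun m => ⋂ n ≥ m, A n := fun m m' h =>
    biInter_mono (fun n (hn : m' ≤ n) => h.trans hn) fun _ _ => subset_rfl
  rw [hmono.measure_iUnion, ENNReal.mul_iSup]
  exact iSup_le fun m => (mul_le_mul_right (measure_mono (biInter_subset_of_mem le_rfl)) _).trans
    (measure_exists_tradeTime_le hS hT m K)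

/-- A right-continuous martingale is almost surely bounded on compact time intervals. -/
theorem ae_exists_bound [IsProbabilityMeasure P] (hS : Martingale S ℱ P)
    (hr : ∀ ω t, ContinuousWithinAt (fun s => S s ω) (Ici t) t) (hT : 0 < T) :
    ∀ᵐ ω ∂P, ∃ K : ℝ, ∀ t ∈ Icc 0 T, |S t.toNNReal ω| ≤ K := by
  set c := ENNReal.ofReal (∫ ω, |S T.toNNReal ω| ∂P)
  rw [ae_iff]
  set U := {ω | ¬∃ K : ℝ, ∀ t ∈ Icc 0 T, |S t.toNNReal ω| ≤ K}
  -- An unbounded path exceeds every K, so K·P(U) stays below a fixed finite number for all K, which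
  -- forces P(U) = 0.
  have h : ∀ K : ℕ, (K : ENNReal) * P U ≤ c := fun K => by
    have h1 := measure_exists_lt_le hS hr hT (K : ℝ≥0)
    refine le_trans ?_ h1
    rw [ENNReal.coe_natCast]
    refine mul_le_mul_right (measure_mono fun ω hω => ?_) _
    simp only [U, mem_ofPred_eq, not_exists, not_forall, not_le] at hω
    obtain ⟨t, ht, hK⟩ := hω K
    exact ⟨t, ht, by simpa using hK⟩
  by_contra h0
  obtain ⟨K, hK⟩ := ENNReal.exists_nat_mul_gt h0 (ENNReal.ofReal_ne_top : c ≠ ⊤)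
  exact absurd (h K) (not_le.2 hK)

end Martingale

/-! ### Sums of conditional expectations with adapted weights. -/

section WeightedCondExp

variable {Ω ι : Type*} [mΩ : MeasurableSpace Ω] {P : Measure Ω}
  {s : Finset ι} {m : ι → MeasurableSpace Ω} {w : ι → Ω → ℝ} {M : ℝ≥0} {Z : Ω → ℝ}

theorem ae_norm_le_of_sum_enorm_le (hM : ∀ᵐ ω ∂P, ∑ i ∈ s, ‖w i ω‖ₑ ≤ M) {i : ι} (hi : i ∈ s) :
    ∀ᵐ ω ∂P, ‖w i ω‖ ≤ M := by
  filter_upwards [hM] with ω h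
  have h1 : ‖w i ω‖ₑ ≤ (M : ENNReal) :=
    (Finset.single_le_sum (f := fun i => ‖w i ω‖ₑ) (fun _ _ => zero_le) hi).trans h
  rw [enorm_eq_nnnorm, ENNReal.coe_le_coe] at h1
  exact_mod_cast h1

theorem condExp_mul_weight [IsProbabilityMeasure P] (hm : ∀ i ∈ s, m i ≤ mΩ)
    (hw : ∀ i ∈ s, StronglyMeasurable[m i] (w i)) (hM : ∀ᵐ ω ∂P, ∑ i ∈ s, ‖w i ω‖ₑ ≤ M)
    (hZ : Integrable Z P) {i : ι} (hi : i ∈ s) :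
    Integrable (Z * w i) P ∧ P[Z * w i|m i] =ᵐ[P] P[Z|m i] * w i := by
  have h : Integrable (Z * w i) P :=
    hZ.mul_bdd (c := M) ((hw i hi).mono (hm i hi)).aestronglyMeasurable (ae_norm_le_of_sum_enorm_le hM hi)
  exact ⟨h, condExp_mul_of_stronglyMeasurable_right (hw i hi) h hZ⟩

/-- Each weight moves inside its conditional expectation, which contracts the L¹ norm; then the
weights are summed pointwise. -/
theorem eLpNorm_sum_condExp_mul_le [IsProbabilityMeasure P] (hm : ∀ i ∈ s, m i ≤ mΩ)
    (hw : ∀ i ∈ s, StronglyMeasurable[m i] (w i)) (hM : ∀ᵐ ω ∂P, ∑ i ∈ s, ‖w i ω‖ₑ ≤ M)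
    (hZ : Integrable Z P) :
    eLpNorm (fun ω => ∑ i ∈ s, (P[Z|m i]) ω * w i ω) 1 P ≤ M * eLpNorm Z 1 P := by
  have hwm : ∀ i ∈ s, AEMeasurable (fun ω => ‖Z ω * w i ω‖ₑ) P := fun i hi =>
    (condExp_mul_weight hm hw hM hZ hi).1.aestronglyMeasurable.enorm
  rw [eLpNorm_one_eq_lintegral_enorm, eLpNorm_one_eq_lintegral_enorm]
  calc ∫⁻ ω, ‖∑ i ∈ s, (P[Z|m i]) ω * w i ω‖ₑ ∂P
      ≤ ∫⁻ ω, ∑ i ∈ s, ‖(P[Z|m i]) ω * w i ω‖ₑ ∂P := lintegral_mono fun ω => enorm_sum_le _ _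
    _ = ∑ i ∈ s, ∫⁻ ω, ‖(P[Z|m i]) ω * w i ω‖ₑ ∂P :=
        lintegral_finsetSum' _ fun i hi =>
          ((integrable_condExp (m := m i) (f := Z * w i)).congr
            (condExp_mul_weight hm hw hM hZ hi).2).aestronglyMeasurable.enorm
    _ ≤ ∑ i ∈ s, ∫⁻ ω, ‖Z ω * w i ω‖ₑ ∂P := by
        refine Finset.sum_le_sum fun i hi => ?_
        have h := eLpNorm_condExp_le_eLpNorm (μ := P) (m := m i) (Z * w i) le_rfl
        rw [eLpNorm_congr_ae (condExp_mul_weight hm hw hM hZ hi).2,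
          eLpNorm_one_eq_lintegral_enorm, eLpNorm_one_eq_lintegral_enorm] at h
        exact h
    _ = ∫⁻ ω, ∑ i ∈ s, ‖Z ω * w i ω‖ₑ ∂P := (lintegral_finsetSum' _ hwm).symm
    _ ≤ ∫⁻ ω, M * ‖Z ω‖ₑ ∂P := by
        refine lintegral_mono_ae ?_
        filter_upwards [hM] with ω h
        simp only [enorm_mul]
        rw [← Finset.mul_sum, mul_comm]
        exact mul_le_mul_left h _
    _ = M * ∫⁻ ω, ‖Z ω‖ₑ ∂P := lintegral_const_mul' _ _ ENNReal.coe_ne_top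

theorem ae_norm_sum_condExp_mul_le {K : ℝ≥0} (hM : ∀ᵐ ω ∂P, ∑ i ∈ s, ‖w i ω‖ₑ ≤ M)
    (hK : ∀ᵐ ω ∂P, |Z ω| ≤ K) :
    ∀ᵐ ω ∂P, ‖∑ i ∈ s, (P[Z|m i]) ω * w i ω‖ₑ ≤ K * M := by
  have h : ∀ᵐ ω ∂P, ∀ i ∈ s, |(P[Z|m i]) ω| ≤ K :=
    (Finset.eventually_all s).2 fun i _ => ae_bdd_abs_condExp_of_ae_bdd_abs hK
  filter_upwards [h, hM] with ω h1 h2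
  refine (enorm_sum_le _ _).trans ?_
  calc ∑ i ∈ s, ‖(P[Z|m i]) ω * w i ω‖ₑ ≤ ∑ i ∈ s, K * ‖w i ω‖ₑ := by
        refine Finset.sum_le_sum fun i hi => ?_
        rw [enorm_mul]
        refine mul_le_mul_left ?_ _
        rw [enorm_eq_nnnorm, ENNReal.coe_le_coe]
        exact_mod_cast h1 i hi
    _ = K * ∑ i ∈ s, ‖w i ω‖ₑ := Finset.mul_sum .. |>.symm
    _ ≤ K * M := mul_le_mul_right h2 _

theorem integral_sum_condExp_mul [IsProbabilityMeasure P] (hm : ∀ i ∈ s, m i ≤ mΩ)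
    (hw : ∀ i ∈ s, StronglyMeasurable[m i] (w i)) (hM : ∀ᵐ ω ∂P, ∑ i ∈ s, ‖w i ω‖ₑ ≤ M)
    (hZ : Integrable Z P) :
    Integrable (fun ω => ∑ i ∈ s, (P[Z|m i]) ω * w i ω) P ∧
      ∫ ω, ∑ i ∈ s, (P[Z|m i]) ω * w i ω ∂P = ∫ ω, Z ω * ∑ i ∈ s, w i ω ∂P := by
  have hint : ∀ i ∈ s, Integrable (fun ω => (P[Z|m i]) ω * w i ω) P := fun i hi =>
    (integrable_condExp (m := m i) (f := Z * w i)).congr (condExp_mul_weight hm hw hM hZ hi).2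
  refine ⟨integrable_finsetSum _ hint, ?_⟩
  simp_rw [Finset.mul_sum]
  rw [integral_finsetSum _ hint,
    integral_finsetSum (f := fun i ω => Z ω * w i ω) _ fun i hi =>
      (condExp_mul_weight hm hw hM hZ hi).1]
  refine Finset.sum_congr rfl fun i hi => ?_
  exact (integral_congr_ae (condExp_mul_weight hm hw hM hZ hi).2).symm.trans
    (integral_condExp (hm i hi))

end WeightedCondExp

/-- Sums of conditional expectations of an integrable variable, with adapted weights whose
absolute values sum to at most a constant, are uniformly integrable. -/
theorem uniformIntegrable_sum_condExp_mul {Ω ι κ : Type*} [mΩ : MeasurableSpace Ω]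
    {P : Measure Ω} [IsProbabilityMeasure P] {s : κ → Finset ι} {m : κ → ι → MeasurableSpace Ω}
    {w : κ → ι → Ω → ℝ} {M : ℝ≥0} {Z : Ω → ℝ} (hm : ∀ k, ∀ i ∈ s k, m k i ≤ mΩ)
    (hw : ∀ k, ∀ i ∈ s k, StronglyMeasurable[m k i] (w k i))
    (hM : ∀ k, ∀ᵐ ω ∂P, ∑ i ∈ s k, ‖w k i ω‖ₑ ≤ M) (hZm : StronglyMeasurable Z)
    (hZ : Integrable Z P) :
    UniformIntegrable (fun k ω => ∑ i ∈ s k, (P[Z|m k i]) ω * w k i ω) 1 P := by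
  refine ⟨fun k => (integral_sum_condExp_mul (hm k) (hw k) (hM k) hZ).1.aestronglyMeasurable,
    fun ε hε => ?_, (M * eLpNorm Z 1 P).toNNReal, fun k => ?_⟩
  -- Truncate Z at level K. The large part is small in L¹, and its sum stays so up to the factor M;
  -- the bounded part gives sums of size at most KM, harmless on sets of small measure. The + 1 in
  -- each denominator avoids division by zero.
  · obtain ⟨K, hK⟩ := (memLp_one_iff_integrable.2 hZ).eLpNorm_indicator_norm_ge_le hZm
      (ε := ε / 2 / (M + 1)) (by positivity)
    set A : Set Ω := {ω | K ≤ ‖Z ω‖₊} with hA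
    have hAm : MeasurableSet A :=
      measurableSet_le measurable_const hZm.measurable.nnnorm.coe_nnreal_real
    set Z₂ := A.indicator Z with hZ₂
    set Z₁ := Aᶜ.indicator Z with hZ₁
    have hZ₁i : Integrable Z₁ P := hZ.indicator hAm.compl
    have hZ₂i : Integrable Z₂ P := hZ.indicator hAm
    have hZ₁K : ∀ ω, |Z₁ ω| ≤ K.toNNReal := fun ω => by
      by_cases hω : ω ∈ A
      · simp [hZ₁, hω]
      · have : |Z ω| < K := by simpa [hA] using hω
        simpa [hZ₁, hω] using Or.inl this.le
    have hsum : Z₁ + Z₂ = Z := Set.indicator_compl_add_self A Z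
    refine ⟨ε / 2 / (K.toNNReal * M + 1), by positivity, fun k t ht htδ => ?_⟩
    set Y₁ : Ω → ℝ := fun ω => ∑ i ∈ s k, (P[Z₁|m k i]) ω * w k i ω with hY₁
    set Y₂ : Ω → ℝ := fun ω => ∑ i ∈ s k, (P[Z₂|m k i]) ω * w k i ω with hY₂
    have hY₁m := (integral_sum_condExp_mul (hm k) (hw k) (hM k) hZ₁i).1.aestronglyMeasurable
    have hY₂m := (integral_sum_condExp_mul (hm k) (hw k) (hM k) hZ₂i).1.aestronglyMeasurable
    have hY : (fun ω => ∑ i ∈ s k, (P[Z|m k i]) ω * w k i ω) =ᵐ[P] Y₁ + Y₂ := by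
      have h : ∀ᵐ ω ∂P, ∀ i ∈ s k, (P[Z|m k i]) ω = (P[Z₁|m k i]) ω + (P[Z₂|m k i]) ω :=
        (Finset.eventually_all _).2 fun i _ => by
          rw [← hsum]; exact condExp_add hZ₁i hZ₂i _
      filter_upwards [h] with ω h
      simp only [hY₁, hY₂, Pi.add_apply]
      rw [← Finset.sum_add_distrib]
      exact Finset.sum_congr rfl fun i hi => by rw [h i hi, add_mul]
    have h1 : eLpNorm (t.indicator Y₁) 1 P ≤ ENNReal.ofReal (ε / 2) := by
      rw [eLpNorm_one_eq_lintegral_enorm]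
      simp_rw [enorm_indicator_eq_indicator_enorm]
      rw [lintegral_indicator ht]
      calc ∫⁻ ω in t, ‖Y₁ ω‖ₑ ∂P ≤ ∫⁻ ω in t, (K.toNNReal * M : ENNReal) ∂P :=
            lintegral_mono_ae (ae_restrict_of_ae
              (ae_norm_sum_condExp_mul_le (hM k) (Eventually.of_forall hZ₁K)))
        _ = K.toNNReal * M * P t := setLIntegral_const _ _
        _ ≤ ENNReal.ofReal (K.toNNReal * M) *
              ENNReal.ofReal (ε / 2 / (K.toNNReal * M + 1)) := by
            rw [ENNReal.ofReal_mul (NNReal.coe_nonneg _), ENNReal.ofReal_coe_nnreal,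
              ENNReal.ofReal_coe_nnreal]
            exact mul_le_mul_right htδ _
        _ ≤ ENNReal.ofReal (ε / 2) := by
            rw [← ENNReal.ofReal_mul (by positivity)]
            refine ENNReal.ofReal_le_ofReal ?_
            rw [mul_div_assoc', div_le_iff₀ (by positivity)]
            have : 0 < ε / 2 := by positivity
            nlinarith
    have h2 : eLpNorm (t.indicator Y₂) 1 P ≤ ENNReal.ofReal (ε / 2) := by
      refine (eLpNorm_indicator_le _).trans ?_
      refine (eLpNorm_sum_condExp_mul_le (hm k) (hw k) (hM k) hZ₂i).trans ?_
      refine (mul_le_mul_right hK _).trans ?_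
      rw [← ENNReal.ofReal_coe_nnreal, ← ENNReal.ofReal_mul (by positivity)]
      refine ENNReal.ofReal_le_ofReal ?_
      rw [mul_div_assoc', div_le_iff₀ (by positivity)]
      have : 0 < ε / 2 := by positivity
      nlinarith
    calc eLpNorm (t.indicator fun ω => ∑ i ∈ s k, (P[Z|m k i]) ω * w k i ω) 1 P
        = eLpNorm (t.indicator Y₁ + t.indicator Y₂) 1 P := by
          rw [← Set.indicator_add']
          refine eLpNorm_congr_ae ?_
          filter_upwards [hY] with ω h
          by_cases hω : ω ∈ t <;> simp [hω, h]
      _ ≤ eLpNorm (t.indicator Y₁) 1 P + eLpNorm (t.indicator Y₂) 1 P :=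
          eLpNorm_add_le (hY₁m.indicator ht) (hY₂m.indicator ht) le_rfl
      _ ≤ ENNReal.ofReal (ε / 2) + ENNReal.ofReal (ε / 2) := add_le_add h1 h2
      _ = ENNReal.ofReal ε := by
          rw [← ENNReal.ofReal_add (by positivity) (by positivity), add_halves]
  · rw [ENNReal.coe_toNNReal (ENNReal.mul_ne_top ENNReal.coe_ne_top
      (memLp_one_iff_integrable.2 hZ).eLpNorm_ne_top)]
    exact eLpNorm_sum_condExp_mul_le (hm k) (hw k) (hM k) hZ

/-! ### The mean value of the trades at a martingale price. -/

/-- The value `∫ s dX` of the trades of the path `X` at the price path `s`. -/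
def tradedValue (T : ℝ) (s : ℝ≥0 → ℝ) (X : ℝ → ℝ) : ℝ :=
  ∫ᵛ t in Icc 0 T, s t.toNNReal ∂•(stieltjesOf X)

section Pathwise

variable {T x : ℝ} {X : ℝ → ℝ} {s : ℝ≥0 → ℝ}

theorem integrableOn_price (hs : ∀ t, ContinuousWithinAt s (Ici t) t)
    (hb : ∃ K : ℝ, ∀ t ∈ Icc 0 T, |s t.toNNReal| ≤ K) (μ : SignedMeasure ℝ) :
    VectorMeasure.IntegrableOn μ (fun t => s t.toNNReal) (Icc 0 T) := by
  obtain ⟨K, hK⟩ := hb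
  exact integrableOn_of_forall_abs_le measurableSet_Icc
    (measurable_of_rightContinuous
      (continuousWithinAt_comp_toNNReal hs)).stronglyMeasurable.aestronglyMeasurable hK

/-- The price is taken at the right end of each cell: the increment of X is known only then, and the
price is right-continuous. The extra term, from T to a grid point beyond T, is the last trade −X T
at price s_T. -/
theorem tendsto_sum_tradeTime (hT : 0 < T) (hX : IsLiquidationPath T x X)
    (hs : ∀ t, ContinuousWithinAt s (Ici t) t)
    (hb : ∃ K : ℝ, ∀ t ∈ Icc 0 T, |s t.toNNReal| ≤ K) :
    Tendsto (fun n => ∑ i ∈ Finset.range (n + 2), s (tradeTime T n (i + 1)) *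
      (X (gridPt T n (i + 1)) - X (gridPt T n i))) atTop (𝓝 (tradedValue T s X)) := by
  have hint := integrableOn_price hs hb (stieltjesOf X)
  obtain ⟨K, hK⟩ := hb
  have h := tendsto_sum_mul_signedMeasure hT (stieltjesOf X) (C := K)
    (a := fun n i => s (gridPt T n (i + 1)).toNNReal) (h := fun t => s t.toNNReal)
    (fun n i hi => hK _ (gridPt_mem_Icc hT (by lia)))
    fun t ht => (continuousWithinAt_comp_toNNReal hs t).tendsto.comp
      ((tendsto_gridPt_right hT ht.1).mono_right (nhdsWithin_mono _ Ioi_subset_Ici_self))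
  rw [tradedValue, hX.setIntegral_Icc_eq hT.le hint, hX.pathJump_last]
  refine (h.add_const _).congr fun n => ?_
  rw [Finset.sum_range_succ _ (n + 1)]
  congr 1
  · refine Finset.sum_congr rfl fun i hi => ?_
    rw [hX.stieltjesOf_Ico ((gridPt_strictMono hT n).monotone i.le_succ),
      tradeTime_of_le hT (by have := Finset.mem_range.1 hi; lia)]
  · rw [tradeTime_of_ge hT (by lia), gridPt_last, hX.after (gridPt T n (n + 1 + 1))
      ((gridPt_last (T := T) n).symm.trans_lt (gridPt_strictMono hT n (Nat.lt_succ_self _))),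
      zero_sub]

end Pathwise

section Admissible

variable {Ω : Type*} [mΩ : MeasurableSpace Ω] {P : Measure Ω} {ℱ : Filtration ℝ≥0 mΩ}
  {S : ℝ≥0 → Ω → ℝ} {T x : ℝ} {X : ℝ → Ω → ℝ}

theorem IsAdmissible.measurable_gridPt (hT : 0 < T) (hX : IsAdmissible P ℱ T x X) (n i : ℕ) :
    Measurable[ℱ (tradeTime T n i)] (X (gridPt T n i)) := by
  rcases le_or_gt i (n + 1) with hi | hi
  · have h := hX.adapted (gridPt T n i).toNNReal
    rwa [Real.coe_toNNReal _ (gridPt_mem_Icc hT hi).1, ← tradeTime_of_le hT hi] at h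
  · have h : X (gridPt T n i) = fun _ => 0 := funext fun ω => (hX.path ω).after _
      ((gridPt_last (T := T) n).symm.trans_lt (gridPt_strictMono hT n hi))
    rw [h]
    exact measurable_const

theorem IsAdmissible.measurable (hX : IsAdmissible P ℱ T x X) (t : ℝ) : Measurable (X t) := by
  rcases le_total 0 t with ht | ht
  · have h := (hX.adapted t.toNNReal).mono (ℱ.le _) le_rfl
    rwa [Real.coe_toNNReal _ ht] at h
  · have h : X t = fun _ => x := funext fun ω => (hX.path ω).before _ ht
    rw [h]
    exact measurable_const

theorem IsAdmissible.sum_increments (hT : 0 < T) (hX : IsAdmissible P ℱ T x X) (n : ℕ) (ω : Ω) :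
    ∑ i ∈ Finset.range (n + 2), (X (gridPt T n (i + 1)) ω - X (gridPt T n i) ω) = -x := by
  rw [Finset.sum_range_sub fun i => X (gridPt T n i) ω, gridPt_zero, (hX.path ω).apply_zero,
    (hX.path ω).after _
      ((gridPt_last (T := T) n).symm.trans_lt (gridPt_strictMono hT n (Nat.lt_succ_self _))),
    zero_sub]

/-- The value of the trades of an admissible strategy at a martingale price is integrable, and its
mean depends on the strategy only through the initial position. -/
theorem IsAdmissible.integral_tradedValue [IsProbabilityMeasure P] (hT : 0 < T)
    (hS : Martingale S ℱ P) (hr : ∀ ω t, ContinuousWithinAt (fun s => S s ω) (Ici t) t)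
    (hX : IsAdmissible P ℱ T x X) :
    Integrable (fun ω => tradedValue T (fun t => S t ω) fun t => X t ω) P ∧
      ∫ ω, tradedValue T (fun t => S t ω) (fun t => X t ω) ∂P =
        -x * ∫ ω, S T.toNNReal ω ∂P := by
  obtain ⟨M, hM⟩ := hX.bounded_variation
  set w : ℕ → ℕ → Ω → ℝ := fun n i => X (gridPt T n (i + 1)) - X (gridPt T n i) with hw
  set m : ℕ → ℕ → MeasurableSpace Ω := fun n i => ℱ (tradeTime T n (i + 1)) with hm
  set Z := S T.toNNReal with hZ
  have hZi : Integrable Z P := hS.integrable _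
  have hm' : ∀ n, ∀ i ∈ Finset.range (n + 2), m n i ≤ mΩ := fun n i _ => ℱ.le _
  have hw' : ∀ n, ∀ i ∈ Finset.range (n + 2), StronglyMeasurable[m n i] (w n i) :=
    fun n i _ => ((hX.measurable_gridPt hT n (i + 1)).sub ((hX.measurable_gridPt hT n i).mono
      (ℱ.mono (tradeTime_mono hT n i.le_succ)) le_rfl)).stronglyMeasurable
  have hM' : ∀ n, ∀ᵐ ω ∂P, ∑ i ∈ Finset.range (n + 2), ‖w n i ω‖ₑ ≤ M := fun n => by
    filter_upwards [hM] with ω h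
    refine le_trans (le_of_eq ?_) ((eVariationOn.sum_le (f := fun t => X t ω) (s := univ)
      (n := n + 2) (gridPt_strictMono hT n).monotone fun _ => mem_univ _).trans h)
    simp only [hw, Pi.sub_apply, edist_eq_enorm_sub]
  set Y : ℕ → Ω → ℝ := fun n ω => ∑ i ∈ Finset.range (n + 2), (P[Z|m n i]) ω * w n i ω with hY
  have hUI : UniformIntegrable Y 1 P := uniformIntegrable_sum_condExp_mul hm' hw' hM'
    ((hS.stronglyMeasurable _).mono (ℱ.le _)) hZi
  have hcond : ∀ᵐ ω ∂P, ∀ n i, (P[Z|m n i]) ω = S (tradeTime T n (i + 1)) ω :=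
    -- By the martingale property the weighted sums of conditional expectations of S_T are the
    -- Riemann sums of ∫ S dX.
    ae_all_iff.2 fun n => ae_all_iff.2 fun i => hS.2 _ _ (tradeTime_le n (i + 1))
  have hlim : ∀ᵐ ω ∂P, Tendsto (fun n => Y n ω) atTop
      (𝓝 (tradedValue T (fun t => S t ω) fun t => X t ω)) := by
    filter_upwards [hcond, ae_exists_bound hS hr hT] with ω h1 h2
    refine (tendsto_sum_tradeTime hT (hX.path ω) (hr ω) h2).congr fun n => ?_
    simp only [hY, hw, h1, Pi.sub_apply]
  have hint := hUI.integrable_of_ae_tendsto hlim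
  refine ⟨hint, ?_⟩
  have h1 : Tendsto (fun n => ∫ ω, Y n ω ∂P) atTop
      (𝓝 (∫ ω, tradedValue T (fun t => S t ω) (fun t => X t ω) ∂P)) :=
    tendsto_integral_of_L1' _ hint.aestronglyMeasurable
      (Eventually.of_forall fun n => (hUI.memLp n).integrable le_rfl)
      (tendsto_Lp_finite_of_tendsto_ae le_rfl ENNReal.one_ne_top (fun n => hUI.1 n)
        (memLp_one_iff_integrable.2 hint) hUI.2.1 hlim)
  -- Each approximation already has the exact mean: every price may be replaced by S_T, after which
  -- the increments telescope to −x.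
  have h2 : ∀ n, ∫ ω, Y n ω ∂P = -x * ∫ ω, Z ω ∂P := fun n => by
    rw [(integral_sum_condExp_mul (hm' n) (hw' n) (hM' n) hZi).2, ← integral_const_mul]
    refine integral_congr_ae (Eventually.of_forall fun ω => ?_)
    simp only [hw, Pi.sub_apply, hX.sum_increments hT n ω, mul_comm]
  exact tendsto_nhds_unique h1 (by simp only [h2, tendsto_const_nhds])

end Admissible

theorem IsLiquidationPath.isAdmissible {Ω : Type*} [mΩ : MeasurableSpace Ω] (P : Measure Ω)
    (ℱ : Filtration ℝ≥0 mΩ) {T x : ℝ} {p : ℝ → ℝ} (hp : IsLiquidationPath T x p) :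
    IsAdmissible P ℱ T x fun t _ => p t :=
  ⟨fun _ => hp, fun _ => measurable_const,
    hp.exists_variation_le.imp fun _ h => Eventually.of_forall fun _ => h⟩

/-! ### Expected costs of admissible strategies and the absence of TTPM. -/

namespace OrderBook

variable {B : OrderBook} {x ν : ℝ}

variable (B) in
/-- The projection of a time onto the trading period. -/
def clampTime (t : ℝ) : ℝ := max 0 (min B.T t)

theorem clampTime_mem (t : ℝ) : B.clampTime t ∈ Icc 0 B.T :=
  ⟨le_max_left _ _, max_le B.T_pos.le (min_le_left _ _)⟩

theorem clampTime_of_mem {t : ℝ} (ht : t ∈ Icc 0 B.T) : B.clampTime t = t := by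
  rw [clampTime, min_eq_right ht.2, max_eq_right ht.1]

/-- λ, ρ and η are regular only on [0, T]; after projecting time onto that interval they are
measurable on the whole line. -/
theorem measurable_comp_clampTime {g : ℝ → ℝ} (hg : ContinuousOn g (Icc 0 B.T)) :
    Measurable fun t => g (B.clampTime t) :=
  (hg.comp_continuous (by unfold clampTime; fun_prop) clampTime_mem).measurable

theorem exists_runningCost_bound (C : ℝ) :
    ∃ K, ∀ t ∈ Icc 0 B.T, ∀ y, |y| ≤ C → |B.runningCost t y| ≤ K := by
  have h1 : ∀ {g : ℝ → ℝ}, ContinuousOn g (Icc 0 B.T) →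
      ContinuousOn (fun p : ℝ × ℝ => g p.1) (Icc 0 B.T ×ˢ Icc (-C) C) := fun hg =>
    hg.comp continuousOn_fst fun _ hp => hp.1
  obtain ⟨K, hK⟩ := (isCompact_Icc.prod isCompact_Icc).exists_bound_of_continuousOn
    (s := Icc 0 B.T ×ˢ Icc (-C) C) (f := fun p : ℝ × ℝ => B.runningCost p.1 p.2)
    ((h1 B.lam_continuousOn).mul ((((h1 B.rho_continuousOn).add (h1 eta_continuousOn)).mul
      (continuousOn_snd.mul (B.Finv_continuous.comp continuous_snd).continuousOn)).sub
      ((h1 eta_continuousOn).mul (B.G_continuous.comp continuous_snd).continuousOn)))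
  exact ⟨K, fun t ht y hy => hK (t, y) ⟨ht, abs_le.1 hy⟩⟩

section Admissible

variable {Ω : Type*} [mΩ : MeasurableSpace Ω] {P : Measure Ω}
  {ℱ : Filtration ℝ≥0 mΩ} {S : ℝ≥0 → Ω → ℝ} {X : ℝ → Ω → ℝ}

/-- The recovery integral has a moving upper limit; writing it as an indicator makes it a parameter
integral of a jointly measurable function. -/
theorem exists_measurable_scaledImpact (hX : IsAdmissible P ℱ B.T x X) :
    ∃ y : ℝ × Ω → ℝ, Measurable y ∧
      ∀ t ∈ Icc 0 B.T, ∀ ω, y (t, ω) = B.scaledImpact (fun t => X t ω) t := by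
  have hXm : Measurable fun p : ℝ × Ω => X p.1 p.2 := measurable_uncurry_of_leftContinuous
    hX.measurable fun ω => (hX.path ω).left_continuous
  have hX0 : Measurable fun p : ℝ × Ω => X 0 p.2 := (hX.measurable 0).comp measurable_snd
  have hR : Measurable fun t => B.cumRho (B.clampTime t) :=
    measurable_comp_clampTime B.cumRho_continuousOn
  set g : (ℝ × Ω) × ℝ → ℝ := fun q => {q : (ℝ × Ω) × ℝ | 0 < q.2 ∧ q.2 ≤ q.1.1}.indicator
    (fun q => B.rho (B.clampTime q.2) * Real.exp (B.cumRho (B.clampTime q.2)) *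
      (X q.2 q.1.2 - X 0 q.1.2)) q with hg
  have hgm : Measurable g := by
    refine Measurable.indicator ?_ ((measurableSet_lt measurable_const measurable_snd).inter
      (measurableSet_le measurable_snd (measurable_fst.comp measurable_fst)))
    exact (((measurable_comp_clampTime B.rho_continuousOn).comp measurable_snd).mul
      (hR.comp measurable_snd).exp).mul
        ((hXm.comp (measurable_snd.prodMk (measurable_snd.comp measurable_fst))).sub
          (hX0.comp measurable_fst))
  refine ⟨fun p => (X p.1 p.2 - X 0 p.2 - Real.exp (-B.cumRho (B.clampTime p.1)) *
    ∫ s, g (p, s)) / B.lam (B.clampTime p.1), ?_, fun t ht ω => ?_⟩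
  · exact ((hXm.sub hX0).sub ((hR.comp measurable_fst).neg.exp.mul
      hgm.stronglyMeasurable.integral_prod_right'.measurable)).div
        ((measurable_comp_clampTime B.lam_continuousOn).comp measurable_fst)
  · rw [scaledImpact, volumeImpact_eq_sub_recovered ht, recovered]
    simp only [clampTime_of_mem ht]
    congr 3
    rw [intervalIntegral.integral_of_le ht.1, ← integral_indicator measurableSet_Ioc]
    congr 1
    ext s
    by_cases hs : s ∈ Ioc 0 t
    · rw [indicator_of_mem hs, hg]
      simp only
      rw [indicator_of_mem (show ((t, ω), s) ∈ _ from hs),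
        clampTime_of_mem ⟨hs.1.le, hs.2.trans ht.2⟩]
    · rw [indicator_of_notMem hs, hg]
      exact indicator_of_notMem (show ((t, ω), s) ∉ _ from hs) _

/-- The reduced form of the cost replaces a Stieltjes integral whose measure depends on ω by a
Lebesgue integral over a fixed interval, which is measurable in ω. -/
theorem measurable_costV (hX : IsAdmissible P ℱ B.T x X) :
    Measurable fun ω => B.costV fun t => X t ω := by
  obtain ⟨y, hy, hyX⟩ := exists_measurable_scaledImpact hX
  have h : (fun ω => B.costV fun t => X t ω) = fun ω =>
      B.lam B.T * B.G (y (B.T, ω) - X B.T ω / B.lam B.T) +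
        ∫ t in Ioc 0 B.T, B.lam (B.clampTime t) * ((B.rho (B.clampTime t) +
          B.eta (B.clampTime t)) * (y (t, ω) * B.Finv (y (t, ω))) -
            B.eta (B.clampTime t) * B.G (y (t, ω))) := by
    ext ω
    rw [costV_eq (hX.path ω), hyX _ B.T_mem ω, scaledImpactRight, (hX.path ω).pathJump_last,
      scaledImpact, ← sub_div, ← sub_eq_add_neg, intervalIntegral.integral_of_le B.T_pos.le]
    congr 1
    refine setIntegral_congr_fun measurableSet_Ioc fun t ht => ?_
    have ht' : t ∈ Icc 0 B.T := ⟨ht.1.le, ht.2⟩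
    simp only [hyX t ht' ω, clampTime_of_mem ht', runningCost]
  rw [h]
  have hT : Measurable fun ω => y (B.T, ω) - X B.T ω / B.lam B.T :=
    (hy.comp measurable_prodMk_left).sub ((hX.measurable _).div_const _)
  refine ((B.G_continuous.measurable.comp hT).const_mul _).add
    (StronglyMeasurable.integral_prod_left' (f := fun p : ℝ × Ω => B.lam (B.clampTime p.1) *
      ((B.rho (B.clampTime p.1) + B.eta (B.clampTime p.1)) * (y p * B.Finv (y p)) -
        B.eta (B.clampTime p.1) * B.G (y p))) ?_).measurable
  have h1 : ∀ {g : ℝ → ℝ}, ContinuousOn g (Icc 0 B.T) →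
      Measurable fun p : ℝ × Ω => g (B.clampTime p.1) := fun hg =>
    (measurable_comp_clampTime hg).comp measurable_fst
  exact ((h1 B.lam_continuousOn).mul ((((h1 B.rho_continuousOn).add (h1 eta_continuousOn)).mul
    (hy.mul (B.Finv_continuous.measurable.comp hy))).sub
      ((h1 eta_continuousOn).mul (B.G_continuous.measurable.comp hy)))).stronglyMeasurable

theorem integrable_costV [IsProbabilityMeasure P] (hX : IsAdmissible P ℱ B.T x X) :
    Integrable (fun ω => B.costV fun t => X t ω) P := by
  obtain ⟨M, hM⟩ := hX.bounded_variation
  obtain ⟨K, -, hK⟩ := B.exists_scaledImpact_bound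
  obtain ⟨K₁, hK₁⟩ := B.exists_G_bound (K * M)
  obtain ⟨K₂, hK₂⟩ := exists_runningCost_bound (B := B) (K * M)
  refine Integrable.of_bound (measurable_costV hX).aestronglyMeasurable
    (B.lam B.T * K₁ + K₂ * |B.T - 0|) ?_
  filter_upwards [hM] with ω h
  have hb := hK _ M h
  rw [costV_eq (hX.path ω)]
  refine (norm_add_le _ _).trans (add_le_add ?_ ?_)
  · rw [norm_mul, Real.norm_of_nonneg (B.lam_pos _ B.T_mem).le]
    exact mul_le_mul_of_nonneg_left (hK₁ _ (hb _ B.T_mem).2) (B.lam_pos _ B.T_mem).le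
  · refine intervalIntegral.norm_integral_le_of_norm_le_const fun t ht => ?_
    rw [uIoc_of_le B.T_pos.le] at ht
    have ht' : t ∈ Icc 0 B.T := ⟨ht.1.le, ht.2⟩
    exact hK₂ t ht' _ (hb t ht').1

/-- Only almost sure: splitting off ∫ S dX uses that the price path is bounded on [0, T]. -/
theorem realizedCost_ae_eq [IsProbabilityMeasure P] (hS : Martingale S ℱ P)
    (hr : ∀ ω t, ContinuousWithinAt (fun s => S s ω) (Ici t) t)
    (hX : IsAdmissible P ℱ B.T x X) :
    (fun ω => B.realizedCost (fun t => S t ω) fun t => X t ω) =ᵐ[P] fun ω =>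
      tradedValue B.T (fun t => S t ω) (fun t => X t ω) + B.costV fun t => X t ω := by
  filter_upwards [ae_exists_bound hS hr B.T_pos] with ω h
  rw [realizedCost_eq (hX.path ω) (S := fun t => S t ω)
    (integrableOn_price (s := fun t => S t ω) (hr ω) h (stieltjesOf fun t => X t ω)),
    costV_eq_integral_tradePrice (hX.path ω), tradedValue]

theorem integrable_realizedCost [IsProbabilityMeasure P] (hS : Martingale S ℱ P)
    (hr : ∀ ω t, ContinuousWithinAt (fun s => S s ω) (Ici t) t)
    (hX : IsAdmissible P ℱ B.T x X) :
    Integrable (fun ω => B.realizedCost (fun t => S t ω) fun t => X t ω) P :=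
  ((hX.integral_tradedValue B.T_pos hS hr).1.add (integrable_costV hX)).congr
    (realizedCost_ae_eq hS hr hX).symm

/-- The price enters only through a constant fixed by x, so minimizing the expected cost means
minimizing the mean of the pathwise cost. -/
theorem expectedCost_eq [IsProbabilityMeasure P] (hS : Martingale S ℱ P)
    (hr : ∀ ω t, ContinuousWithinAt (fun s => S s ω) (Ici t) t)
    (hX : IsAdmissible P ℱ B.T x X) :
    B.expectedCost P S X =
      -x * (∫ ω, S B.T.toNNReal ω ∂P) + ∫ ω, B.costV (fun t => X t ω) ∂P := by
  have h := hX.integral_tradedValue B.T_pos hS hr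
  rw [expectedCost, integral_congr_ae (realizedCost_ae_eq hS hr hX),
    integral_add h.1 (integrable_costV hX), h.2]

/-- The excess expected cost of a strategy over a deterministic strategy is the mean excess cost
of its paths. -/
theorem expectedCost_sub_eq [IsProbabilityMeasure P] (hS : Martingale S ℱ P)
    (hr : ∀ ω t, ContinuousWithinAt (fun s => S s ω) (Ici t) t)
    (hX : IsAdmissible P ℱ B.T x X) {p : ℝ → ℝ}
    (hp : IsLiquidationPath B.T x p) :
    B.expectedCost P S X - B.expectedCost P S (fun t _ => p t) =
      ∫ ω, (B.costV (fun t => X t ω) - B.costV p) ∂P := by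
  rw [expectedCost_eq hS hr hX, expectedCost_eq hS hr (hp.isAdmissible P ℱ),
    integral_sub (integrable_costV hX) (integrable_const _)]
  ring

theorem expectedCost_strategyPath_le [IsProbabilityMeasure P] (hS : Martingale S ℱ P)
    (hr : ∀ ω t, ContinuousWithinAt (fun s => S s ω) (Ici t) t)
    (hB : B.IsUnimodal) (hR : B.ResilienceDominates) (hν : B.SolvesNu x ν)
    (hX : IsAdmissible P ℱ B.T x X) :
    B.expectedCost P S (fun t _ => B.strategyPath x ν t) ≤ B.expectedCost P S X := by
  rw [← sub_nonneg, expectedCost_sub_eq hS hr hX (strategyPath_isLiquidationPath hB hR hν)]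
  exact integral_nonneg fun ω => sub_nonneg.2 (costV_strategyPath_le hB hR hν (hX.path ω))

theorem ae_eq_strategyPath_of_expectedCost_eq [IsProbabilityMeasure P] (hS : Martingale S ℱ P)
    (hr : ∀ ω t, ContinuousWithinAt (fun s => S s ω) (Ici t) t)
    (hB : B.IsUnimodal) (hR : B.ResilienceDominates) (hν : B.SolvesNu x ν)
    (hX : IsAdmissible P ℱ B.T x X)
    (h : B.expectedCost P S X = B.expectedCost P S (fun t _ => B.strategyPath x ν t)) :
    ∀ᵐ ω ∂P, ∀ t, X t ω = B.strategyPath x ν t := by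
  have h1 := expectedCost_sub_eq hS hr hX (strategyPath_isLiquidationPath hB hR hν)
  rw [sub_eq_zero.2 h, eq_comm, integral_eq_zero_iff_of_nonneg
    (fun ω => sub_nonneg.2 (costV_strategyPath_le hB hR hν (hX.path ω)))
    ((integrable_costV hX).sub (integrable_const _))] at h1
  filter_upwards [h1] with ω hω
  exact congrFun (eq_strategyPath_of_costV_eq hB hR hν (hX.path ω) (sub_eq_zero.1 hω))

/-- The optimal strategy is itself monotone, so the infimum over monotone strategies is at most the
global minimum. -/
theorem not_admitsTTPM [IsProbabilityMeasure P] (hS : Martingale S ℱ P)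
    (hr : ∀ ω t, ContinuousWithinAt (fun s => S s ω) (Ici t) t)
    (hB : B.IsUnimodal) (hR : B.ResilienceDominates)
    (hb : B.BlockCondition) : ¬ B.AdmitsTTPM P ℱ S := by
  rintro ⟨x, X, hX, hlt⟩
  obtain ⟨ν, hν, -⟩ := existsUnique_solvesNu hB hR x
  refine absurd hlt (not_lt.2 ((iInf₂_le (fun t _ => B.strategyPath x ν t) ⟨?_, ?_⟩).trans
    (EReal.coe_le_coe_iff.2 (expectedCost_strategyPath_le hS hr hB hR hν hX))))
  · exact (strategyPath_isLiquidationPath hB hR hν).isAdmissible P ℱ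
  · exact (strategyPath_antitone_or_monotone hB hR hν hb).imp (fun h _ => h) fun h _ => h

end Admissible

end OrderBook

end

theorem mainTheorem7 (B : OrderBook) (hf : ContDiff ℝ 1 B.f)
    (hf_left : MonotoneOn B.f (Iic 0)) (hf_right : AntitoneOn B.f (Ici 0))
    (hrho : ∀ t ∈ Icc 0 B.T, 0 ≤ B.rho t + B.eta t)
    {Ω : Type*} [mΩ : MeasurableSpace Ω] (P : Measure Ω) [IsProbabilityMeasure P]
    (ℱ : Filtration ℝ≥0 mΩ) (S : ℝ≥0 → Ω → ℝ) (hS : Martingale S ℱ P)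
    (hS_right : ∀ ω t, ContinuousWithinAt (fun s => S s ω) (Ici t) t) :
    -- `h_{V,t}` is a bijection of class `C¹` with positive derivative
    (∀ t ∈ Icc 0 B.T, ContDiff ℝ 1 (B.hV t) ∧ Function.Bijective (B.hV t) ∧
      ∀ y, 0 < deriv (B.hV t) y) ∧
    -- the cost functional is nonnegative, and expected costs are well defined
    (∀ x X, IsLiquidationPath B.T x X → 0 ≤ B.costV X) ∧
    (∀ x X, IsAdmissible P ℱ B.T x X →
      Integrable (fun ω => B.realizedCost (fun t => S t ω) (fun t => X t ω)) P) ∧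
    (∀ x : ℝ, ∃ ν : ℝ, B.SolvesNu x ν ∧ (∀ ν', B.SolvesNu x ν' → ν' = ν) ∧
      ContDiffOn ℝ 1 (B.zeta ν) (Icc 0 B.T) ∧
      -- the explicit strategy is admissible and is the unique minimizer, both of the
      -- deterministic cost among paths and of the expected cost among processes
      IsLiquidationPath B.T x (B.strategyPath x ν) ∧
      IsAdmissible P ℱ B.T x (fun t _ => B.strategyPath x ν t) ∧
      (∀ X, IsLiquidationPath B.T x X → B.costV (B.strategyPath x ν) ≤ B.costV X ∧
        (B.costV X = B.costV (B.strategyPath x ν) → X = B.strategyPath x ν)) ∧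
      (∀ X, IsAdmissible P ℱ B.T x X →
        B.expectedCost P S (fun t _ => B.strategyPath x ν t) ≤ B.expectedCost P S X ∧
        (B.expectedCost P S X = B.expectedCost P S (fun t _ => B.strategyPath x ν t) →
          ∀ᵐ ω ∂P, ∀ t, X t ω = B.strategyPath x ν t)) ∧
      -- signs of the trades
      SignType.sign (B.initialTrade ν) = SignType.sign (-x) ∧
      SameSignWeak (B.lastTrade ν) (-x) ∧
      (B.BlockCondition → ∀ t ∈ Ioo 0 B.T, SameSignWeak (B.tradingRate ν t) (-x))) ∧
    -- transaction-triggered price manipulations are excluded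
    (B.BlockCondition → ¬ B.AdmitsTTPM P ℱ S) := by
  have hB : B.IsUnimodal := ⟨hf, hf_left, hf_right⟩
  have hR : B.ResilienceDominates := hrho
  refine ⟨fun t ht => ⟨OrderBook.hV_contDiff hB t, OrderBook.hV_bijective hB (hR.coef_nonneg ht),
    OrderBook.hV_deriv_pos hB (hR.coef_nonneg ht)⟩, fun x X hX => OrderBook.costV_nonneg hR hX,
    fun x X hX => OrderBook.integrable_realizedCost hS hS_right hX, fun x => ?_,
    OrderBook.not_admitsTTPM hS hS_right hB hR⟩
  obtain ⟨ν, hν, huniq⟩ := OrderBook.existsUnique_solvesNu hB hR x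
  have hpath := OrderBook.strategyPath_isLiquidationPath hB hR hν
  exact ⟨ν, hν, huniq, OrderBook.zeta_contDiffOn hB hR ν, hpath, hpath.isAdmissible P ℱ,
    fun X hX => ⟨OrderBook.costV_strategyPath_le hB hR hν hX,
      OrderBook.eq_strategyPath_of_costV_eq hB hR hν hX⟩,
    fun X hX => ⟨OrderBook.expectedCost_strategyPath_le hS hS_right hB hR hν hX,
      OrderBook.ae_eq_strategyPath_of_expectedCost_eq hS hS_right hB hR hν hX⟩,
    OrderBook.sign_initialTrade hB hR hν, OrderBook.sameSignWeak_lastTrade hB hR hν,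
    fun hb t ht => OrderBook.sameSignWeak_tradingRate hB hR hν hb (Ioo_subset_Icc_self ht)⟩
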